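/- Let $A:\mathbb R\to\mathbb R$ be smooth with $A(x)=O(e^{-cx})$ as $x\to+\infty$ for some $c>0$. Let $\sigma:\mathbb R\to\mathbb R$ be nondecreasing, smooth except at finitely many points, with $\sigma(t)\to0$ as $t\to-\infty$ and $\sigma(t)\to\gamma\in(0,1]$ as $t\to+\infty$, both exponentially fast. Write $\sigma'$ for the Lebesgue–Stieltjes measure $d\sigma$ (jumps of $\sigma$ give Dirac masses). For $s\in\mathbb R$ let $A_s$ be the operator from $L^2(\mathbb R_+)$ to functions on $\mathbb R$ with kernel $A_s(x,y)=A(x+y+s)$, $x\in\mathbb R$, $y\in\mathbb R_+$, and let $K_1=\sigma A_sA_s^{\mathsf T}$ and $K_2=A_s^{\mathsf T}\sigma A_s$ have the kernels $$K_1(x,y)=\sigma(x)\int_0^\infty A(x+r+s)A(y+r+s)\,dr\ \ (x,y\in\mathbb R),$$ $$K_2(x,y)=\int_{\mathbb R}\sigma(r)A(x+r+s)A(y+r+s)\,dr\ \ (x,y\in\mathbb R_+).$$ Assume that these objects converge in the following sense: for every $s$, $\int_{\mathbb R}\int_0^\infty\sigma(x)A(x+y+s)^2\,dy\,dx<\infty$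 (that is, $\sigma^{1/2}A_s$ is Hilbert–Schmidt), and $s\mapsto\int_{\mathbb R}A(t+s)^2\,d\sigma(t)$ is finite and continuous. Then for every $s$ the kernel $K_2$ is square integrable on $\mathbb R_+^2$, the Fredholm series of $\mathrm{Det}(I-K_1)_{L^2(\mathbb R)}$ and $\mathrm{Det}(I-K_2)_{L^2(\mathbb R_+)}$ converge absolutely, and the two determinants are equal. Let moreover $s$ be such that $I-K_2$ is invertible on $L^2(\mathbb R_+)$. Let $\langle\delta|$, $|\delta\rangle$ denote evaluation at $0$, with $(I-K_2)^{-1}|\delta\rangle=|\delta\rangle+(I-K_2)^{-1}K_2(\cdot,0)$, and put $$q_0(t)=\Big(A_s\tfrac{1}{I-K_2}|\delta\rangle\Big)(t)=A(t+s)+\int_0^\infty A(t+y+s)\,\big[(I-K_2)^{-1}K_2(\cdot,0)\big](y)\,dy,$$ $$u_0(t,t')=\Big(A_s\tfrac{1}{I-K_2}A_s^{\mathsf T}\Big)(t,t')=\int_0^\infty A(t+y+s)\,\big[(I-K_2)^{-1}A(t'+\cdot+s)\big](y)\,dy,$$ $$\langle\delta|\tfrac{K_2}{I-K_2}|\delta\rangle=K_2(0,0)+\int_0^\infty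 K_2(0,y)\,\big[(I-K_2)^{-1}K_2(\cdot,0)\big](y)\,dy.$$ Then $\mathrm{Det}(I-K_1)=\mathrm{Det}(I-K_2)\neq0$, and it is positive if $A$ satisfies $\int_{\mathbb R}A(s+r)A(r+s')\,dr=\delta(s-s')$ (tested against smooth compactly supported functions of $s$ and $s'$). With $\log$ understood as $\log|\cdot|$ (the usual logarithm when the determinant is positive), $$\partial_s\log\mathrm{Det}(I-K_1)=\langle\delta|\tfrac{K_2}{I-K_2}|\delta\rangle,\qquad \partial_s\log\mathrm{Det}(I-K_2)=\mathrm{Tr}(\sigma'u_0):=\int_{\mathbb R}u_0(t,t)\,d\sigma(t),$$ these two values being equal, and $$\partial_s^2\log\mathrm{Det}(I-K_1)=\partial_s^2\log\mathrm{Det}(I-K_2)=-(q_0^{\mathsf T}\sigma'q_0):=-\int_{\mathbb R}q_0(t)^2\,d\sigma(t),$$ where the derivatives exist and the integrals against $d\sigma$ converge absolutely. -/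

import Mathlib

open MeasureTheory Set Filter Topology
open scoped ContDiff

noncomputable section

namespace InhomFredholm

/-! ### Hilbert–Schmidt integral operators on real `L²` spaces -/

section IntegralOperator

variable {α : Type*} [MeasurableSpace α] {μ : Measure α} [SFinite μ]

theorem eLpNorm_integral_kernel_le {k : α → α → ℝ}
    (hk : MemLp (Function.uncurry k) 2 (μ.prod μ)) {f : α → ℝ} (hf : MemLp f 2 μ) :
    eLpNorm (fun x => ∫ y, k x y * f y ∂μ) 2 μ ≤
      eLpNorm (Function.uncurry k) 2 (μ.prod μ) * eLpNorm f 2 μ := by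
  have hkm := hk.aestronglyMeasurable
  have h1 : ∀ᵐ x ∂μ, ‖∫ y, k x y * f y ∂μ‖ₑ ^ (2 : ℝ) ≤
      (∫⁻ y, ‖k x y‖ₑ ^ (2 : ℝ) ∂μ) * (∫⁻ y, ‖f y‖ₑ ^ (2 : ℝ) ∂μ) := by
    filter_upwards [hkm.prodMk_left] with x hx
    have h2 : ‖∫ y, k x y * f y ∂μ‖ₑ ≤
        (∫⁻ y, ‖k x y‖ₑ ^ (2 : ℝ) ∂μ) ^ (1 / (2 : ℝ)) *
          (∫⁻ y, ‖f y‖ₑ ^ (2 : ℝ) ∂μ) ^ (1 / (2 : ℝ)) := by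
      refine (enorm_integral_le_lintegral_enorm _).trans ?_
      simp only [enorm_mul]
      exact ENNReal.lintegral_mul_le_Lp_mul_Lq μ Real.HolderConjugate.two_two
        hx.enorm hf.aestronglyMeasurable.enorm
    calc ‖∫ y, k x y * f y ∂μ‖ₑ ^ (2 : ℝ)
        ≤ ((∫⁻ y, ‖k x y‖ₑ ^ (2 : ℝ) ∂μ) ^ (1 / (2 : ℝ)) *
          (∫⁻ y, ‖f y‖ₑ ^ (2 : ℝ) ∂μ) ^ (1 / (2 : ℝ))) ^ (2 : ℝ) := by gcongr
      _ = _ := by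
        rw [ENNReal.mul_rpow_of_nonneg _ _ (by norm_num), ← ENNReal.rpow_mul,
          ← ENNReal.rpow_mul]
        norm_num
  have hm : AEMeasurable (fun p : α × α => ‖k p.1 p.2‖ₑ ^ (2 : ℝ)) (μ.prod μ) :=
    hkm.enorm.pow_const _
  rw [eLpNorm_eq_lintegral_rpow_enorm_toReal (by norm_num) (by norm_num),
    eLpNorm_eq_lintegral_rpow_enorm_toReal (by norm_num) (by norm_num),
    eLpNorm_eq_lintegral_rpow_enorm_toReal (by norm_num) (by norm_num),
    ← ENNReal.mul_rpow_of_nonneg _ _ (by positivity)]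
  gcongr
  simp only [ENNReal.toReal_ofNat, Function.uncurry_def]
  rw [lintegral_prod _ hm, ← lintegral_mul_const'' _ hm.lintegral_prod_right']
  exact lintegral_mono_ae h1

theorem memLp_integral_kernel {k : α → α → ℝ}
    (hk : MemLp (Function.uncurry k) 2 (μ.prod μ)) {f : α → ℝ} (hf : MemLp f 2 μ) :
    MemLp (fun x => ∫ y, k x y * f y ∂μ) 2 μ := by
  refine ⟨?_, (eLpNorm_integral_kernel_le hk hf).trans_lt
    (ENNReal.mul_lt_top hk.eLpNorm_lt_top hf.eLpNorm_lt_top)⟩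
  exact (hk.aestronglyMeasurable.mul
    hf.aestronglyMeasurable.comp_snd).integral_prod_right'

theorem ae_integrable_kernel {k : α → α → ℝ}
    (hk : MemLp (Function.uncurry k) 2 (μ.prod μ)) {f : α → ℝ} (hf : MemLp f 2 μ) :
    ∀ᵐ x ∂μ, Integrable (fun y => k x y * f y) μ := by
  have h := (hk.integrable_sq).prod_right_ae
  filter_upwards [h, hk.aestronglyMeasurable.prodMk_left] with x hx hxm
  exact MemLp.integrable_mul ((memLp_two_iff_integrable_sq hxm).2 hx) hf

/-- The bounded operator `(T f)(x) = ∫ k(x,y) f(y) dμ(y)` on `L²(μ)` defined by a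
square-integrable kernel `k`. -/
def hilbertSchmidtOp (k : α → α → ℝ) (hk : MemLp (Function.uncurry k) 2 (μ.prod μ)) :
    Lp ℝ 2 μ →L[ℝ] Lp ℝ 2 μ :=
  LinearMap.mkContinuous
    { toFun := fun f => (memLp_integral_kernel hk (Lp.memLp f)).toLp _
      map_add' := by
        intro f g
        rw [← MemLp.toLp_add]
        refine MemLp.toLp_congr _ _ ?_
        filter_upwards [ae_integrable_kernel hk (Lp.memLp f),
          ae_integrable_kernel hk (Lp.memLp g)] with x hf hg
        rw [Pi.add_apply, ← integral_add hf hg]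
        refine integral_congr_ae ?_
        filter_upwards [Lp.coeFn_add f g] with y hy
        rw [hy, Pi.add_apply, mul_add]
      map_smul' := by
        intro c f
        rw [RingHom.id_apply, ← MemLp.toLp_const_smul]
        refine MemLp.toLp_congr _ _ (ae_of_all _ fun x => ?_)
        rw [Pi.smul_apply, smul_eq_mul, ← integral_const_mul]
        refine integral_congr_ae ?_
        filter_upwards [Lp.coeFn_smul c f] with y hy
        rw [hy, Pi.smul_apply, smul_eq_mul]
        ring }
    (eLpNorm (Function.uncurry k) 2 (μ.prod μ)).toReal
    (by
      intro f
      simp only [LinearMap.coe_mk, AddHom.coe_mk]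
      rw [Lp.norm_toLp, Lp.norm_def, ← ENNReal.toReal_mul]
      exact ENNReal.toReal_mono
        (ENNReal.mul_lt_top hk.eLpNorm_lt_top (Lp.memLp f).eLpNorm_lt_top).ne
        (eLpNorm_integral_kernel_le hk (Lp.memLp f)))

theorem hilbertSchmidtOp_apply (k : α → α → ℝ)
    (hk : MemLp (Function.uncurry k) 2 (μ.prod μ)) (f : Lp ℝ 2 μ) :
    hilbertSchmidtOp k hk f =ᵐ[μ] fun x => ∫ y, k x y * f y ∂μ :=
  MemLp.coeFn_toLp (memLp_integral_kernel hk (Lp.memLp f))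

open Classical in
/-- The integral operator on `L²(μ)` with kernel `k`; it is `0` by convention if `k` is not
square integrable. -/
def integralOp (μ : Measure α) [SFinite μ] (k : α → α → ℝ) : Lp ℝ 2 μ →L[ℝ] Lp ℝ 2 μ :=
  if hk : MemLp (Function.uncurry k) 2 (μ.prod μ) then hilbertSchmidtOp k hk else 0

open Classical in
/-- The class in `L²(μ)` of a function; it is `0` by convention if the function is not
square integrable. -/
def toL2 (μ : Measure α) (f : α → ℝ) : Lp ℝ 2 μ :=
  if hf : MemLp f 2 μ then hf.toLp f else 0

end IntegralOperator

/-! ### Fredholm determinants -/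

section Determinant

variable {α : Type*} [MeasurableSpace α]

/-- The integrand `det [K(xᵢ, xⱼ)]` of the `n`-th term of the Fredholm series. -/
def fredholmMinor (K : α → α → ℝ) (n : ℕ) (x : Fin n → α) : ℝ :=
  (Matrix.of fun i j : Fin n => K (x i) (x j)).det

/-- The `n`-th term `(-1)ⁿ / n! ∫ det [K(xᵢ, xⱼ)] dμ(x₁) ⋯ dμ(xₙ)` of the Fredholm series
(it is `1` for `n = 0`). -/
def fredholmTerm (μ : Measure α) (K : α → α → ℝ) (n : ℕ) : ℝ :=
  (-1) ^ n / (n.factorial : ℝ) *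
    ∫ x : Fin n → α, fredholmMinor K n x ∂(Measure.pi fun _ => μ)

/-- `Det(I - K)` on `L²(μ)`, as the Fredholm series. -/
def fredholmDet (μ : Measure α) (K : α → α → ℝ) : ℝ :=
  ∑' n, fredholmTerm μ K n

/-- All integrals of the Fredholm series of `Det(I - K)` converge, and so does the series. -/
def FredholmSeriesConverges (μ : Measure α) (K : α → α → ℝ) : Prop :=
  (∀ n, Integrable (fredholmMinor K n) (Measure.pi fun _ : Fin n => μ)) ∧
    Summable (fredholmTerm μ K)

end Determinant

/-! ### The operators `A_s`, `K₁`, `K₂` and the functions `q₀`, `u₀` -/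

/-- Lebesgue measure on the half-line `ℝ₊`. -/
abbrev halfLine : Measure ℝ := volume.restrict (Ioi 0)

/-- The kernel of `A_s : L²(ℝ₊) → L²(ℝ)`. -/
def kerA (A : ℝ → ℝ) (s x y : ℝ) : ℝ := A (x + y + s)

/-- The kernel of `K₁ = σ A_s A_sᵀ` on `L²(ℝ)`. -/
def kerK₁ (A σ : ℝ → ℝ) (s x y : ℝ) : ℝ :=
  σ x * ∫ r, kerA A s x r * kerA A s y r ∂halfLine

/-- The kernel of `K₂ = A_sᵀ σ A_s` on `L²(ℝ₊)`. -/
def kerK₂ (A σ : ℝ → ℝ) (s x y : ℝ) : ℝ :=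
  ∫ r, kerA A s r x * σ r * kerA A s r y

/-- The operator `K₂` on `L²(ℝ₊)`. -/
def opK₂ (A σ : ℝ → ℝ) (s : ℝ) : Lp ℝ 2 halfLine →L[ℝ] Lp ℝ 2 halfLine :=
  integralOp halfLine (kerK₂ A σ s)

/-- The resolvent `(I - K₂)⁻¹` (used only when `I - K₂` is invertible). -/
def resolvent (A σ : ℝ → ℝ) (s : ℝ) : Lp ℝ 2 halfLine →L[ℝ] Lp ℝ 2 halfLine :=
  Ring.inverse (1 - opK₂ A σ s)

/-- The regular part `(I - K₂)⁻¹ K₂ |δ⟩` of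
`(I - K₂)⁻¹ |δ⟩ = |δ⟩ + (I - K₂)⁻¹ K₂ |δ⟩`, where `K₂ |δ⟩` is the function `K₂(·, 0)`. -/
def resolventDelta (A σ : ℝ → ℝ) (s : ℝ) : Lp ℝ 2 halfLine :=
  resolvent A σ s (toL2 halfLine fun y => kerK₂ A σ s y 0)

/-- The pairing `⟨k| (I - K₂)⁻¹ |δ⟩ = k(0) + ∫ k(y) ((I - K₂)⁻¹ K₂ |δ⟩)(y) dy` over `ℝ₊`. -/
def pairResolventDelta (A σ : ℝ → ℝ) (s : ℝ) (k : ℝ → ℝ) : ℝ :=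
  k 0 + ∫ y, k y * resolventDelta A σ s y ∂halfLine

/-- `⟨δ| K₂ (I - K₂)⁻¹ |δ⟩`. -/
def deltaResolventDelta (A σ : ℝ → ℝ) (s : ℝ) : ℝ :=
  pairResolventDelta A σ s fun y => kerK₂ A σ s 0 y

/-- `q₀ = A_s (I - K₂)⁻¹ |δ⟩`, a function on `ℝ`. -/
def q₀ (A σ : ℝ → ℝ) (s t : ℝ) : ℝ :=
  pairResolventDelta A σ s fun y => kerA A s t y

/-- `u₀ = A_s (I - K₂)⁻¹ A_sᵀ`, a kernel on `ℝ`. -/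
def u₀ (A σ : ℝ → ℝ) (s t t' : ℝ) : ℝ :=
  ∫ y, kerA A s t y * resolvent A σ s (toL2 halfLine fun z => kerA A s t' z) y ∂halfLine

/-- The orthogonality relation `∫ A(s + r) A(r + s') dr = δ(s - s')`, tested against smooth
compactly supported functions of `s` and `s'`. -/
def OrthogonalityRelation (A : ℝ → ℝ) : Prop :=
  ∀ f g : ℝ → ℝ, ContDiff ℝ ∞ f → HasCompactSupport f → ContDiff ℝ ∞ g → HasCompactSupport g →
    Integrable (fun r => (∫ s, A (s + r) * f s) * ∫ s', A (r + s') * g s') ∧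
    ∫ r, (∫ s, A (s + r) * f s) * (∫ s', A (r + s') * g s') = ∫ s, f s * g s

end InhomFredholm

end

open InhomFredholm

open scoped InnerProductSpace

/-! ### Hadamard's inequality for mixed Gram determinants -/

/-! The determinant is presented as a Fredholm determinant of a kernel independent of `s` over a
region `{height > s}`. Almost every configuration of points there has a unique lowest point, and
integrating out the points above it turns the Fredholm series into `Det(s) = 1 - ∫_{height p > s}
D_{height p}(p, p)`, where `D_u` is Fredholm's first minor over `{height > u}`
(`IsHadamardKernel.fredholmDet_height`). Now `s` occurs only in the domain of integration, so the
fundamental theorem of calculus gives the derivative as a first minor at the endpoint. Where `I -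
K₂` is invertible, Fredholm's relation makes this minor `Det` times a matrix element of the
resolvent.

Two such presentations are used. With `b_x = σ^{1/2} A(· + x)` in `L²(ℝ)`, `K₂(x, y) = ⟪b_{x+s},
b_{y+s}⟫`, so the region is `(s, ∞)`; the endpoint yields `⟨δ| K₂ (I - K₂)⁻¹ |δ⟩`
(`firstMinor_endpoint`). Secondly, `σ(r)` is the `dσ`-mass of `(-∞, r)` for almost every `r`, so
`σ(r) dr` is the image of `dy dσ(t)` on `y > 0` under `r = y + t` (`map_strip_stieltjesFunction`).
Hence `K₂ = ∫_{y > s} a_{y+t} ⊗ a_{y+t} dy dσ(t)` with `a_τ = A(τ + ·)` in `L²(ℝ₊)`; the Gram kernel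
of these vectors, with height `y`, yields `∫ u₀(t, t) dσ(t)`. Andréief's identity
(`fredholmTerm_gram_comm`) matches these series and those of `K₁`, `K₂` term by term, and Hadamard's
inequality bounds the terms by `Tⁿ / n!`. The two first-derivative values agree because a derivative
is unique.

The strip formula also differentiates `K₂`, `K₂(·, 0)` and `K₂(0, 0)` in norm, with `∂ₛ K₂ = -A_sᵀ
σ' A_s`; differentiating the resolvent expression then produces minus a perfect square
(`hasDerivAt_deltaResolventDelta`). The continuity needed here comes from dominated convergence with
varying majorants, as only the integrals of the majorants are controlled.

For nonvanishing, `Φ(z) = Det(I - zK₂)` is a power series converging everywhere, and `|Φ'| ≤ C |Φ|`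
near `1` since the resolvent stays bounded. A zero at `1` would spread by Grönwall and analyticity
to `Φ = 0`, against `Φ(0) = 1`. The orthogonality relation and `σ ≤ 1` give `K₂ ≤ I`, so `Φ` has no
zero on `[0, 1]` and stays positive. -/

theorem OrthonormalBasis.abs_det_inner_le {E : Type*} [NormedAddCommGroup E]
    [InnerProductSpace ℝ E] {n : ℕ} (b : OrthonormalBasis (Fin n) ℝ E) (v : Fin n → E) :
    |(Matrix.of fun i j => ⟪b i, v j⟫_ℝ).det| ≤ ∏ j, ‖v j‖ := by
  have hfin : Module.finrank ℝ E = n := by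
    simpa using Module.finrank_eq_card_basis b.toBasis
  have : Fact (Module.finrank ℝ E = n) := ⟨hfin⟩
  have h := (b.toBasis.orientation).abs_volumeForm_apply_le v
  rw [Orientation.volumeForm_robust' _ b] at h
  have : (Matrix.of fun i j => ⟪b i, v j⟫_ℝ) = b.toBasis.toMatrix v := by
    ext i j
    simp [Module.Basis.toMatrix_apply, b.repr_apply_apply]
  rwa [this]

/-- For independent `u`, projecting `v` onto the span of `u` leaves the matrix unchanged; in an
orthonormal basis of the span it is a product of two square coordinate matrices, each obeying the
classical Hadamard bound. For dependent `u` the rows are dependent. -/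
theorem abs_det_inner_le {E : Type*} [NormedAddCommGroup E] [InnerProductSpace ℝ E] {n : ℕ}
    (u v : Fin n → E) :
    |(Matrix.of fun i j => ⟪u i, v j⟫_ℝ).det| ≤ (∏ i, ‖u i‖) * ∏ j, ‖v j‖ := by
  by_cases hu : LinearIndependent ℝ u
  · let S := Submodule.span ℝ (Set.range u)
    have hS : Module.finrank ℝ S = n := by simpa using finrank_span_eq_card hu
    have : FiniteDimensional ℝ S := FiniteDimensional.span_of_finite ℝ (Set.finite_range u)
    let b : OrthonormalBasis (Fin n) ℝ S := (stdOrthonormalBasis ℝ S).reindex (finCongr hS)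
    let u' : Fin n → S := fun i => ⟨u i, Submodule.subset_span ⟨i, rfl⟩⟩
    let v' : Fin n → S := fun j => S.orthogonalProjectionOnto (v j)
    have hmat : (Matrix.of fun i j => ⟪u i, v j⟫_ℝ) =
        (Matrix.of fun k i => ⟪b k, u' i⟫_ℝ).transpose * Matrix.of fun k j => ⟪b k, v' j⟫_ℝ := by
      ext i j
      have h1 : ⟪u i, v j⟫_ℝ = ⟪u' i, v' j⟫_ℝ :=
        (Submodule.inner_orthogonalProjectionOnto_eq_of_mem_left (u' i) (v j)).symm
      rw [Matrix.mul_apply, Matrix.of_apply, h1, ← b.sum_inner_mul_inner (u' i) (v' j)]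
      refine Finset.sum_congr rfl fun k _ => ?_
      simp [real_inner_comm]
    rw [hmat, Matrix.det_mul, Matrix.det_transpose, abs_mul]
    have hv : ∏ j, ‖v' j‖ ≤ ∏ j, ‖v j‖ :=
      Finset.prod_le_prod (fun _ _ => norm_nonneg _) fun j _ =>
        S.norm_orthogonalProjectionOnto_apply_le (v j)
    have h1 : |(Matrix.of fun k i => ⟪b k, u' i⟫_ℝ).det| ≤ ∏ i, ‖u i‖ := b.abs_det_inner_le u'
    have h2 := (b.abs_det_inner_le v').trans hv
    exact mul_le_mul h1 h2 (abs_nonneg _) (by positivity)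
  · obtain ⟨g, hg, i, hi⟩ := Fintype.not_linearIndependent_iff.1 hu
    have : (Matrix.of fun i j => ⟪u i, v j⟫_ℝ).det = 0 := by
      refine Matrix.exists_vecMul_eq_zero_iff.1 ⟨g, fun h => hi (congr_fun h i), ?_⟩
      ext j
      simp only [Matrix.vecMul, dotProduct, Matrix.of_apply, Pi.zero_apply]
      rw [← inner_zero_left (𝕜 := ℝ) (v j), ← hg, sum_inner]
      simp [inner_smul_left]
    rw [this, abs_zero]
    positivity

/-! ### Sequences dominated by a convergent sequence of integrable functions -/

/-- The bound is `‖F n - f‖ ≤ min ‖F n - f‖ (2G) + (g n - min (g n) G)`. The first summand is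
dominated by `2G`; the integral of the second tends to `0` because both `∫ g n` and `∫ min (g n) G`
tend to `∫ G`. -/
theorem tendsto_integral_norm_sub_of_tendsto_integral_bound {α E : Type*} [MeasurableSpace α]
    {μ : Measure α} [NormedAddCommGroup E] {F : ℕ → α → E} {f : α → E}
    {g : ℕ → α → ℝ} {G : α → ℝ} (hFm : ∀ n, AEStronglyMeasurable (F n) μ)
    (hfm : AEStronglyMeasurable f μ)
    (hg : ∀ n, Integrable (g n) μ) (hG : Integrable G μ)
    (hFg : ∀ n, ∀ᵐ x ∂μ, ‖F n x‖ ≤ g n x)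
    (hF : ∀ᵐ x ∂μ, Tendsto (fun n => F n x) atTop (𝓝 (f x)))
    (hgG : ∀ᵐ x ∂μ, Tendsto (fun n => g n x) atTop (𝓝 (G x)))
    (hint : Tendsto (fun n => ∫ x, g n x ∂μ) atTop (𝓝 (∫ x, G x ∂μ))) :
    Tendsto (fun n => ∫ x, ‖F n x - f x‖ ∂μ) atTop (𝓝 0) := by
  have hFg' := ae_all_iff.2 hFg
  have hfG : ∀ᵐ x ∂μ, ‖f x‖ ≤ G x := by
    filter_upwards [hFg', hF, hgG] with x h1 h2 h3
    exact le_of_tendsto_of_tendsto' h2.norm h3 h1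
  have hA : Tendsto (fun n => ∫ x, min ‖F n x - f x‖ (2 * G x) ∂μ) atTop (𝓝 0) := by
    rw [← integral_zero α ℝ (μ := μ)]
    refine tendsto_integral_of_dominated_convergence (fun x => 2 * G x) (fun n => ?_)
      (hG.const_mul 2) (fun n => ?_) ?_
    · exact ((hFm n).sub hfm).norm.inf (hG.const_mul 2).aestronglyMeasurable
    · filter_upwards [hfG] with x hx
      have : 0 ≤ G x := (norm_nonneg _).trans hx
      rw [Real.norm_of_nonneg (by positivity)]
      exact min_le_right _ _
    · filter_upwards [hF, hfG] with x hx hx'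
      have h0 : 0 ≤ G x := (norm_nonneg _).trans hx'
      have : Tendsto (fun n => ‖F n x - f x‖) atTop (𝓝 0) := by
        simpa using (hx.sub_const (f x)).norm
      have h2 := this.min (tendsto_const_nhds (x := 2 * G x))
      rwa [min_eq_left (by positivity)] at h2
  have hB : Tendsto (fun n => ∫ x, (g n x - min (g n x) (G x)) ∂μ) atTop (𝓝 0) := by
    have h1 : Tendsto (fun n => ∫ x, min (g n x) (G x) ∂μ) atTop (𝓝 (∫ x, G x ∂μ)) := by
      refine tendsto_integral_of_dominated_convergence G (fun n => ?_) hG (fun n => ?_) ?_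
      · exact (hg n).aestronglyMeasurable.inf hG.aestronglyMeasurable
      · filter_upwards [hfG, hFg n] with x hx hx'
        have h0 : 0 ≤ G x := (norm_nonneg _).trans hx
        have h1 : 0 ≤ g n x := (norm_nonneg _).trans hx'
        rw [Real.norm_of_nonneg (by positivity)]
        exact min_le_right _ _
      · filter_upwards [hgG] with x hx
        simpa using hx.min (tendsto_const_nhds (x := G x))
    have h2 := hint.sub h1
    rw [sub_self] at h2
    refine h2.congr fun n => ?_
    exact (integral_sub (hg n) ((hg n).inf hG)).symm
  have hAB := hA.add hB
  rw [add_zero] at hAB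
  have hminI : ∀ n, Integrable (fun x => min ‖F n x - f x‖ (2 * G x)) μ := fun n => by
    refine (hG.const_mul 2).mono' (((hFm n).sub hfm).norm.inf
      (hG.const_mul 2).aestronglyMeasurable) ?_
    filter_upwards [hfG] with x hx
    have : 0 ≤ G x := (norm_nonneg _).trans hx
    rw [Real.norm_of_nonneg (by simp; positivity)]
    exact min_le_right _ _
  have hI : ∀ n, Integrable (fun x => g n x - min (g n x) (G x)) μ := fun n =>
    (hg n).sub ((hg n).inf hG)
  refine tendsto_of_tendsto_of_tendsto_of_le_of_le tendsto_const_nhds hAB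
    (fun n => integral_nonneg fun x => norm_nonneg _) fun n => ?_
  simp only
  rw [← integral_add (hminI n) (hI n)]
  refine integral_mono_of_nonneg (ae_of_all _ fun x => norm_nonneg _)
    ((hminI n).add (hI n)) ?_
  filter_upwards [hfG, hFg n] with x h1 h2
  have h3 := norm_sub_le (F n x) (f x)
  rcases le_total ‖F n x - f x‖ (2 * G x) with h | h
  · rw [min_eq_left h]
    have := min_le_left (g n x) (G x)
    linarith
  · rw [min_eq_right h]
    rcases le_total (g n x) (G x) with h' | h'
    · rw [min_eq_left h']; linarith
    · rw [min_eq_right h']; linarith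

theorem continuousAt_integral_of_continuousAt_integral_bound {X α E : Type*}
    [TopologicalSpace X] [FirstCountableTopology X] [MeasurableSpace α]
    {μ : Measure α} [NormedAddCommGroup E] [NormedSpace ℝ E] {F : X → α → E}
    {g : X → α → ℝ} {x₀ : X} {U : Set X} (hU : U ∈ 𝓝 x₀)
    (hFm : ∀ x ∈ U, AEStronglyMeasurable (F x) μ)
    (hg : ∀ x ∈ U, Integrable (g x) μ)
    (hFg : ∀ x ∈ U, ∀ᵐ t ∂μ, ‖F x t‖ ≤ g x t)
    (hF : ∀ᵐ t ∂μ, ContinuousAt (fun x => F x t) x₀)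
    (hgc : ∀ᵐ t ∂μ, ContinuousAt (fun x => g x t) x₀)
    (hint : ContinuousAt (fun x => ∫ t, g x t ∂μ) x₀) :
    ContinuousAt (fun x => ∫ t, F x t ∂μ) x₀ := by
  classical
  have hx₀ : x₀ ∈ U := mem_of_mem_nhds hU
  refine tendsto_of_seq_tendsto fun u hu => ?_
  have hev : ∀ᶠ n in atTop, u n ∈ U := hu.eventually hU
  -- The bounds hold only on `U`, so the finitely many terms outside `U` are replaced by `x₀`.
  let v : ℕ → X := fun n => if u n ∈ U then u n else x₀
  have hvU : ∀ n, v n ∈ U := fun n => by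
    by_cases h : u n ∈ U <;> simp [v, h, hx₀]
  have huv : ∀ᶠ n in atTop, v n = u n := hev.mono fun n h => by simp [v, h]
  have hv : Tendsto v atTop (𝓝 x₀) := hu.congr' (huv.mono fun n h => h.symm)
  have key := tendsto_integral_norm_sub_of_tendsto_integral_bound (fun n => hFm (v n) (hvU n))
    (hFm x₀ hx₀) (fun n => hg (v n) (hvU n)) (hg x₀ hx₀) (fun n => hFg (v n) (hvU n))
    (hF.mono fun t ht => ht.tendsto.comp hv) (hgc.mono fun t ht => ht.tendsto.comp hv)
    (hint.tendsto.comp hv)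
  have hFI : ∀ x ∈ U, Integrable (F x) μ := fun x hx => (hg x hx).mono' (hFm x hx) (hFg x hx)
  have h2 : Tendsto (fun n => ∫ t, F (v n) t ∂μ) atTop (𝓝 (∫ t, F x₀ t ∂μ)) := by
    rw [tendsto_iff_norm_sub_tendsto_zero]
    refine squeeze_zero (fun n => norm_nonneg _) (fun n => ?_) key
    rw [← integral_sub (hFI _ (hvU n)) (hFI _ hx₀)]
    exact norm_integral_le_integral_norm _
  exact h2.congr' (huv.mono fun n h => by rw [h]; rfl)

/-- Pointwise continuity together with continuity of the norms gives strong continuity: `(a - b)² ≤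
2a² + 2b²` supplies a majorant whose integral is continuous. -/
theorem continuous_toLp_two {X α : Type*} [TopologicalSpace X] [FirstCountableTopology X]
    [MeasurableSpace α] {μ : Measure α} {f : X → α → ℝ} (hf : ∀ x, MemLp (f x) 2 μ)
    (hc : ∀ t, Continuous fun x => f x t)
    (hint : Continuous fun x => ∫ t, f x t ^ 2 ∂μ) :
    Continuous fun x => (hf x).toLp (f x) := by
  rw [continuous_iff_continuousAt]
  intro x₀
  have hn : ∀ x, ‖(hf x).toLp (f x) - (hf x₀).toLp (f x₀)‖ ^ 2 =
      ∫ t, (f x t - f x₀ t) ^ 2 ∂μ := fun x => by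
    rw [← MemLp.toLp_sub, ← real_inner_self_eq_norm_sq, L2.inner_def]
    refine integral_congr_ae ?_
    filter_upwards [((hf x).sub (hf x₀)).coeFn_toLp] with t ht
    rw [ht]
    simp [pow_two]
  have h := continuousAt_integral_of_continuousAt_integral_bound (x₀ := x₀) (U := univ) (μ := μ)
    (F := fun x t => (f x t - f x₀ t) ^ 2) (g := fun x t => 2 * f x t ^ 2 + 2 * f x₀ t ^ 2)
    univ_mem
    (fun x _ => (((hf x).sub (hf x₀)).integrable_sq).aestronglyMeasurable)
    (fun x _ => ((hf x).integrable_sq.const_mul 2).add ((hf x₀).integrable_sq.const_mul 2))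
    (fun x _ => ae_of_all _ fun t => by
      rw [Real.norm_of_nonneg (sq_nonneg _)]
      nlinarith [sq_nonneg (f x t + f x₀ t)])
    (ae_of_all _ fun t => by have := (hc t).continuousAt (x := x₀); fun_prop)
    (ae_of_all _ fun t => by have := (hc t).continuousAt (x := x₀); fun_prop)
    (by
      have : (fun x => ∫ t, (2 * f x t ^ 2 + 2 * f x₀ t ^ 2) ∂μ) =
          fun x => 2 * ∫ t, f x t ^ 2 ∂μ + 2 * ∫ t, f x₀ t ^ 2 ∂μ := by
        ext x
        rw [integral_add ((hf x).integrable_sq.const_mul 2)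
          ((hf x₀).integrable_sq.const_mul 2), integral_const_mul, integral_const_mul]
      rw [this]
      exact ((hint.const_mul 2).add_const _).continuousAt)
  rw [ContinuousAt, tendsto_iff_norm_sub_tendsto_zero]
  have h2 : Tendsto (fun x => Real.sqrt (∫ t, (f x t - f x₀ t) ^ 2 ∂μ)) (𝓝 x₀) (𝓝 0) := by
    have := h.tendsto.sqrt
    simpa using this
  refine h2.congr fun x => ?_
  rw [← hn, Real.sqrt_sq (norm_nonneg _)]

/-! ### Fredholm theory of kernels with a Hadamard-type bound -/

section FredholmTheory

variable {α : Type*} [MeasurableSpace α]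

/-- A measurable kernel whose mixed minors obey Hadamard's inequality with a square integrable
weight `c`. -/
structure IsHadamardKernel (m : Measure α) (K : α → α → ℝ) (c : α → ℝ) : Prop where
  measurable : Measurable (Function.uncurry K)
  nonneg : ∀ p, 0 ≤ c p
  memLp : MemLp c 2 m
  bound : ∀ (n : ℕ) (u v : Fin n → α),
    |(Matrix.of fun i j => K (u i) (v j)).det| ≤ (∏ i, c (u i)) * ∏ j, c (v j)

/-- The minor of `K` with rows `p, x` and columns `q, x`. -/
noncomputable def firstMinor (K : α → α → ℝ) (n : ℕ) (p q : α) (x : Fin n → α) : ℝ :=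
  (Matrix.of fun i j : Fin (n + 1) =>
    K ((Fin.cons p x : Fin (n + 1) → α) i) ((Fin.cons q x : Fin (n + 1) → α) j)).det

/-- The `n`-th term of the series of Fredholm's first minor. -/
noncomputable def firstMinorTerm (m : Measure α) (K : α → α → ℝ) (n : ℕ) (p q : α) : ℝ :=
  (-1) ^ n / (n.factorial : ℝ) * ∫ x, firstMinor K n p q x ∂(Measure.pi fun _ : Fin n => m)

/-- Fredholm's first minor. -/
noncomputable def fredholmFirstMinor (m : Measure α) (K : α → α → ℝ) (p q : α) : ℝ :=
  ∑' n, firstMinorTerm m K n p q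

theorem measurable_det_kernel {β : Type*} [MeasurableSpace β] {K : α → α → ℝ}
    (hK : Measurable (Function.uncurry K)) {n : ℕ} {f g : Fin n → β → α}
    (hf : ∀ i, Measurable (f i)) (hg : ∀ i, Measurable (g i)) :
    Measurable fun x => (Matrix.of fun i j => K (f i x) (g j x)).det := by
  simp only [Matrix.det_apply, Matrix.of_apply]
  refine Finset.measurable_sum _ fun π _ => Measurable.const_smul ?_ _
  exact Finset.measurable_prod _ fun i _ => hK.comp ((hf _).prodMk (hg _))

theorem measurable_finCons {n : ℕ} (i : Fin (n + 1)) :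
    Measurable fun p : α × (Fin n → α) => (Fin.cons p.1 p.2 : Fin (n + 1) → α) i := by
  refine Fin.cases ?_ (fun j => ?_) i
  · simpa using measurable_fst
  · simpa [Function.comp_def] using (measurable_pi_apply j).comp
      (measurable_snd (α := α) (β := Fin n → α))

theorem measurable_firstMinor {K : α → α → ℝ} (hK : Measurable (Function.uncurry K)) (n : ℕ) :
    Measurable fun r : α × α × (Fin n → α) => firstMinor K n r.1 r.2.1 r.2.2 :=
  measurable_det_kernel hK
    (fun i => (measurable_finCons i).comp (measurable_fst.prodMk measurable_snd.snd))
    (fun i => (measurable_finCons i).comp measurable_snd)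

/-- Expansion of the first minor along its first row. -/
theorem firstMinor_succ (K : α → α → ℝ) (n : ℕ) (p q : α) (x : Fin (n + 1) → α) :
    firstMinor K (n + 1) p q x = K p q * fredholmMinor K (n + 1) x -
      ∑ k, K p (x k) * firstMinor K n (x k) q (fun j => x (k.succAbove j)) := by
  rw [firstMinor, Matrix.det_succ_row_zero, Fin.sum_univ_succ, sub_eq_add_neg,
    ← Finset.sum_neg_distrib]
  congr 1
  · simp [fredholmMinor, Matrix.submatrix, Matrix.of_apply]
  · refine Finset.sum_congr rfl fun k _ => ?_
    -- Moving the row of `x k` to the front is a cycle of sign `(-1)^k`. Against the cofactor sign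
    -- `(-1)^(k+1)` this leaves the uniform minus sign.
    have hcons : (Fin.cons (x k) (fun j => x (k.succAbove j)) : Fin (n + 1) → α) =
        x ∘ k.cycleRange.symm := by
      rw [← Fin.insertNth_comp_cycleRange_symm]
      congr 1
      exact Fin.insertNth_self_removeNth k x
    have h1 : firstMinor K n (x k) q (fun j => x (k.succAbove j)) = (-1) ^ (k : ℕ) *
        (Matrix.of fun i j : Fin (n + 1) => K (x i)
          ((Fin.cons q (fun j => x (k.succAbove j)) : Fin (n + 1) → α) j)).det := by
      rw [firstMinor, hcons]
      have h := Matrix.det_permute k.cycleRange.symm (Matrix.of fun i j : Fin (n + 1) => K (x i)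
          ((Fin.cons q (fun j => x (k.succAbove j)) : Fin (n + 1) → α) j))
      rw [Equiv.Perm.sign_symm, Fin.sign_cycleRange] at h
      push_cast at h
      rw [← h]
      rfl
    have h2 : (Matrix.of fun i j : Fin (n + 1 + 1) => K ((Fin.cons p x : Fin (n + 2) → α) i)
          ((Fin.cons q x : Fin (n + 2) → α) j)).submatrix Fin.succ k.succ.succAbove =
        Matrix.of fun i j : Fin (n + 1) => K (x i)
          ((Fin.cons q (fun j => x (k.succAbove j)) : Fin (n + 1) → α) j) := by
      ext i j
      simp only [Matrix.submatrix_apply, Matrix.of_apply, Fin.cons_succ]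
      congr 1
      refine Fin.cases ?_ (fun j => ?_) j
      · simp
      · simp
    rw [h2, h1]
    simp only [Matrix.of_apply, Fin.cons_zero, Fin.cons_succ, Fin.val_succ, pow_succ]
    have : ((-1 : ℝ) ^ (k : ℕ)) * (-1) ^ (k : ℕ) = 1 := by rw [← mul_pow]; simp
    ring

namespace IsHadamardKernel

variable {m : Measure α} {K : α → α → ℝ} {c : α → ℝ}

theorem mono_measure {m' : Measure α} (h : IsHadamardKernel m K c) (hm : m' ≤ m) :
    IsHadamardKernel m' K c :=
  ⟨h.measurable, h.nonneg, h.memLp.mono_measure hm, h.bound⟩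

theorem integrable_sq (h : IsHadamardKernel m K c) : Integrable (fun p => c p ^ 2) m :=
  h.memLp.integrable_sq

theorem abs_le (h : IsHadamardKernel m K c) (p q : α) : |K p q| ≤ c p * c q := by
  simpa using h.bound 1 (fun _ => p) (fun _ => q)

theorem abs_fredholmMinor_le (h : IsHadamardKernel m K c) {n : ℕ} (x : Fin n → α) :
    |fredholmMinor K n x| ≤ ∏ i, c (x i) ^ 2 := by
  refine (h.bound n x x).trans_eq ?_
  rw [← Finset.prod_mul_distrib]
  simp [pow_two]

theorem abs_firstMinor_le (h : IsHadamardKernel m K c) {n : ℕ} (p q : α) (x : Fin n → α) :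
    |firstMinor K n p q x| ≤ c p * c q * ∏ i, c (x i) ^ 2 := by
  refine (h.bound (n + 1) _ _).trans_eq ?_
  rw [Fin.prod_univ_succ, Fin.prod_univ_succ]
  simp only [Fin.cons_zero, Fin.cons_succ, pow_two, Finset.prod_mul_distrib]
  ring

variable [SigmaFinite m]

theorem integrable_prod_sq (h : IsHadamardKernel m K c) (n : ℕ) :
    Integrable (fun x : Fin n → α => ∏ i, c (x i) ^ 2) (Measure.pi fun _ => m) :=
  Integrable.fintype_prod (f := fun _ p => c p ^ 2) fun _ => h.integrable_sq

theorem integral_prod_sq (c : α → ℝ) (n : ℕ) :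
    ∫ x : Fin n → α, ∏ i, c (x i) ^ 2 ∂(Measure.pi fun _ => m) = (∫ p, c p ^ 2 ∂m) ^ n := by
  rw [integral_fintype_prod_eq_prod (fun _ p => c p ^ 2)]
  simp

theorem integrable_fredholmMinor (h : IsHadamardKernel m K c) (n : ℕ) :
    Integrable (fredholmMinor K n) (Measure.pi fun _ => m) :=
  (h.integrable_prod_sq n).mono'
    (measurable_det_kernel h.measurable (fun i => measurable_pi_apply i)
      (fun i => measurable_pi_apply i)).aestronglyMeasurable
    (ae_of_all _ h.abs_fredholmMinor_le)

theorem integrable_firstMinor (h : IsHadamardKernel m K c) (n : ℕ) (p q : α) :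
    Integrable (firstMinor K n p q) (Measure.pi fun _ => m) :=
  ((h.integrable_prod_sq n).const_mul (c p * c q)).mono'
    ((measurable_firstMinor h.measurable n).comp
      (measurable_const.prodMk (measurable_const.prodMk measurable_id))).aestronglyMeasurable
    (ae_of_all _ (h.abs_firstMinor_le p q))

theorem abs_fredholmTerm_le (h : IsHadamardKernel m K c) (n : ℕ) :
    |fredholmTerm m K n| ≤ (∫ p, c p ^ 2 ∂m) ^ n / n.factorial := by
  rw [fredholmTerm, abs_mul, abs_div, abs_pow, abs_neg, abs_one, one_pow, Nat.abs_cast,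
    ← integral_prod_sq, div_mul_eq_mul_div, one_mul]
  gcongr
  exact (abs_integral_le_integral_abs).trans
    (integral_mono (h.integrable_fredholmMinor n).abs (h.integrable_prod_sq n)
      h.abs_fredholmMinor_le)

theorem abs_firstMinorTerm_le (h : IsHadamardKernel m K c) (n : ℕ) (p q : α) :
    |firstMinorTerm m K n p q| ≤ c p * c q * ((∫ p, c p ^ 2 ∂m) ^ n / n.factorial) := by
  rw [firstMinorTerm, abs_mul, abs_div, abs_pow, abs_neg, abs_one, one_pow, Nat.abs_cast,
    ← integral_prod_sq, div_mul_eq_mul_div, one_mul, ← mul_div_assoc, ← integral_const_mul]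
  gcongr
  exact (abs_integral_le_integral_abs).trans
    (integral_mono (h.integrable_firstMinor n p q).abs
      ((h.integrable_prod_sq n).const_mul _) (h.abs_firstMinor_le p q))

theorem summable_fredholmTerm (h : IsHadamardKernel m K c) : Summable (fredholmTerm m K) :=
  Summable.of_norm_bounded (Real.summable_pow_div_factorial _) h.abs_fredholmTerm_le

theorem fredholmSeriesConverges (h : IsHadamardKernel m K c) : FredholmSeriesConverges m K :=
  ⟨h.integrable_fredholmMinor, h.summable_fredholmTerm⟩

theorem summable_firstMinorTerm (h : IsHadamardKernel m K c) (p q : α) :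
    Summable fun n => firstMinorTerm m K n p q :=
  Summable.of_norm_bounded ((Real.summable_pow_div_factorial (∫ p, c p ^ 2 ∂m)).mul_left
    (c p * c q)) fun n => h.abs_firstMinorTerm_le n p q

theorem abs_fredholmFirstMinor_le (h : IsHadamardKernel m K c) (p q : α) :
    |fredholmFirstMinor m K p q| ≤ c p * c q * Real.exp (∫ p, c p ^ 2 ∂m) := by
  rw [Real.exp_eq_exp_ℝ, NormedSpace.exp_eq_tsum_div, ← tsum_mul_left]
  exact tsum_of_norm_bounded (f := fun n => firstMinorTerm m K n p q)
    (((Real.summable_pow_div_factorial (∫ p, c p ^ 2 ∂m)).mul_left (c p * c q)).hasSum)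
    fun n => h.abs_firstMinorTerm_le n p q

theorem measurable_firstMinorTerm (hK : Measurable (Function.uncurry K)) (n : ℕ) :
    Measurable fun r : α × α => firstMinorTerm m K n r.1 r.2 := by
  have h1 : StronglyMeasurable (fun r : (α × α) × (Fin n → α) =>
      firstMinor K n r.1.1 r.1.2 r.2) :=
    ((measurable_firstMinor hK n).comp
      (measurable_fst.fst.prodMk (measurable_fst.snd.prodMk measurable_snd))).stronglyMeasurable
  exact (h1.integral_prod_right (ν := Measure.pi fun _ : Fin n => m)).measurable.const_mul _

theorem measurable_fredholmFirstMinor (h : IsHadamardKernel m K c) :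
    Measurable fun r : α × α => fredholmFirstMinor m K r.1 r.2 := by
  refine measurable_of_tendsto_metrizable (f := fun N (r : α × α) =>
    ∑ n ∈ Finset.range N, firstMinorTerm m K n r.1 r.2)
    (fun N => Finset.measurable_sum _ fun n _ => measurable_firstMinorTerm h.measurable n) ?_
  rw [tendsto_pi_nhds]
  exact fun r => (h.summable_firstMinorTerm r.1 r.2).hasSum.tendsto_sum_nat

theorem integrable_kernel_mul_firstMinor (h : IsHadamardKernel m K c) (n : ℕ) (p q : α) :
    Integrable (fun r : α × (Fin n → α) => K p r.1 * firstMinor K n r.1 q r.2)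
      (m.prod (Measure.pi fun _ => m)) := by
  have hb : Integrable (fun r : α × (Fin n → α) => c p * c q * (c r.1 ^ 2 * ∏ i, c (r.2 i) ^ 2))
      (m.prod (Measure.pi fun _ => m)) :=
    (h.integrable_sq.mul_prod (h.integrable_prod_sq n)).const_mul _
  refine hb.mono' (Measurable.aestronglyMeasurable ?_) (ae_of_all _ fun r => ?_)
  · exact (h.measurable.comp (measurable_const.prodMk measurable_fst)).mul
      ((measurable_firstMinor h.measurable n).comp
        (measurable_fst.prodMk (measurable_const.prodMk measurable_snd)))
  · rw [norm_mul]
    refine (mul_le_mul (h.abs_le p r.1) (h.abs_firstMinor_le r.1 q r.2) (abs_nonneg _)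
      (mul_nonneg (h.nonneg _) (h.nonneg _))).trans_eq ?_
    ring

/-- All `n + 1` terms of the row expansion have the same integral, because singling out any one
coordinate preserves the product measure. -/
theorem integral_firstMinor_succ (h : IsHadamardKernel m K c) (n : ℕ) (p q : α) :
    ∫ x, firstMinor K (n + 1) p q x ∂(Measure.pi fun _ => m) =
      K p q * ∫ x, fredholmMinor K (n + 1) x ∂(Measure.pi fun _ => m) -
        (n + 1) * ∫ z, K p z * ∫ x, firstMinor K n z q x ∂(Measure.pi fun _ => m) ∂m := by
  have hI := h.integrable_kernel_mul_firstMinor n p q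
  have hmp := fun k : Fin (n + 1) => measurePreserving_piFinSuccAbove (fun _ : Fin (n + 1) => m) k
  have hk : ∀ k : Fin (n + 1), Integrable (fun x : Fin (n + 1) → α =>
      K p (x k) * firstMinor K n (x k) q (fun j => x (k.succAbove j))) (Measure.pi fun _ => m) :=
    fun k => ((hmp k).integrable_comp_emb (MeasurableEquiv.measurableEmbedding _)).2 hI
  have hk' : ∀ k : Fin (n + 1), ∫ x : Fin (n + 1) → α,
      K p (x k) * firstMinor K n (x k) q (fun j => x (k.succAbove j)) ∂(Measure.pi fun _ => m) =
      ∫ z, K p z * ∫ x, firstMinor K n z q x ∂(Measure.pi fun _ => m) ∂m := fun k => by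
    have h2 := integral_prod _ hI
    simp only [integral_const_mul] at h2
    rw [← h2]
    exact (hmp k).integral_comp' (fun r : α × (Fin n → α) => K p r.1 * firstMinor K n r.1 q r.2)
  simp only [firstMinor_succ]
  rw [integral_sub ((h.integrable_fredholmMinor _).const_mul _)
    (integrable_finsetSum _ fun k _ => hk k), integral_const_mul,
    integral_finsetSum _ fun k _ => hk k]
  simp [hk']

theorem integral_firstMinor_diag (h : IsHadamardKernel m K c) (n : ℕ) :
    ∫ p, ∫ x, firstMinor K n p p x ∂(Measure.pi fun _ => m) ∂m =
      ∫ x, fredholmMinor K (n + 1) x ∂(Measure.pi fun _ => m) := by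
  have hb : Integrable (fun r : α × (Fin n → α) => c r.1 ^ 2 * ∏ i, c (r.2 i) ^ 2)
      (m.prod (Measure.pi fun _ => m)) :=
    h.integrable_sq.mul_prod (h.integrable_prod_sq n)
  have hI : Integrable (fun r : α × (Fin n → α) => firstMinor K n r.1 r.1 r.2)
      (m.prod (Measure.pi fun _ => m)) := by
    refine hb.mono' ((measurable_firstMinor h.measurable n).comp
      (measurable_fst.prodMk (measurable_fst.prodMk measurable_snd))).aestronglyMeasurable
      (ae_of_all _ fun r => (h.abs_firstMinor_le _ _ _).trans_eq ?_)
    ring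
  rw [← integral_prod _ hI, ← (measurePreserving_piFinSuccAbove (fun _ : Fin (n + 1) => m)
    0).integral_comp']
  refine integral_congr_ae (ae_of_all _ fun x => ?_)
  simp only [MeasurableEquiv.piFinSuccAbove_apply, firstMinor, fredholmMinor]
  have : (Fin.cons (x 0) (Fin.tail x) : Fin (n + 1) → α) = x := Fin.cons_self_tail x
  congr 2
  ext i j
  change K ((Fin.cons (x 0) (Fin.tail x) : Fin (n + 1) → α) i)
    ((Fin.cons (x 0) (Fin.tail x) : Fin (n + 1) → α) j) = _
  rw [this]

theorem firstMinorTerm_succ (h : IsHadamardKernel m K c) (n : ℕ) (p q : α) :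
    firstMinorTerm m K (n + 1) p q = K p q * fredholmTerm m K (n + 1) +
      ∫ z, K p z * firstMinorTerm m K n z q ∂m := by
  have h1 : ∀ z, K p z * firstMinorTerm m K n z q = (-1) ^ n / (n.factorial : ℝ) *
      (K p z * ∫ x, firstMinor K n z q x ∂(Measure.pi fun _ => m)) := fun z => by
    rw [firstMinorTerm]; ring
  simp only [h1]
  rw [integral_const_mul, firstMinorTerm, h.integral_firstMinor_succ, fredholmTerm,
    Nat.factorial_succ]
  push_cast
  have : (n.factorial : ℝ) ≠ 0 := by positivity
  have h3 : (n + 1 : ℝ) ≠ 0 := by positivity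
  field_simp
  ring

theorem fredholmTerm_zero (m : Measure α) [SigmaFinite m] (K : α → α → ℝ) :
    fredholmTerm m K 0 = 1 := by
  simp [fredholmTerm, fredholmMinor, measureReal_def]

theorem firstMinorTerm_zero (m : Measure α) [SigmaFinite m] (K : α → α → ℝ) (p q : α) :
    firstMinorTerm m K 0 p q = K p q := by
  simp [firstMinorTerm, firstMinor, measureReal_def]

theorem integrable_kernel_mul_firstMinorTerm (h : IsHadamardKernel m K c) (n : ℕ) (p q : α) :
    Integrable (fun z => K p z * firstMinorTerm m K n z q) m := by
  have h1 := (h.integrable_kernel_mul_firstMinor n p q).integral_prod_left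
  refine (h1.const_mul ((-1) ^ n / (n.factorial : ℝ))).congr (ae_of_all _ fun z => ?_)
  simp only [integral_const_mul, firstMinorTerm]
  ring

/-- Fredholm's first fundamental relation. -/
theorem fredholmFirstMinor_eq (h : IsHadamardKernel m K c) (p q : α) :
    fredholmFirstMinor m K p q = fredholmDet m K * K p q +
      ∫ z, K p z * fredholmFirstMinor m K z q ∂m := by
  have hsum : Summable fun n => ∫ z, ‖K p z * firstMinorTerm m K n z q‖ ∂m := by
    refine Summable.of_nonneg_of_le (fun n => integral_nonneg fun z => norm_nonneg _)
      (fun n => ?_) ((Real.summable_pow_div_factorial (∫ p, c p ^ 2 ∂m)).mul_left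
        (c p * c q * ∫ z, c z ^ 2 ∂m))
    rw [mul_assoc, mul_comm (∫ z, c z ^ 2 ∂m), ← mul_assoc, ← integral_const_mul]
    refine integral_mono (h.integrable_kernel_mul_firstMinorTerm n p q).norm
      (h.integrable_sq.const_mul _) fun z => ?_
    simp only [norm_mul]
    refine (mul_le_mul (h.abs_le p z) (h.abs_firstMinorTerm_le n z q) (abs_nonneg _)
      (mul_nonneg (h.nonneg _) (h.nonneg _))).trans_eq ?_
    ring
  have h1 := hasSum_integral_of_summable_integral_norm
    (h.integrable_kernel_mul_firstMinorTerm · p q) hsum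
  simp only [tsum_mul_left] at h1
  rw [fredholmFirstMinor, (h.summable_firstMinorTerm p q).tsum_eq_zero_add, fredholmDet,
    h.summable_fredholmTerm.tsum_eq_zero_add, firstMinorTerm_zero, fredholmTerm_zero]
  simp only [h.firstMinorTerm_succ]
  have h2 := ((summable_nat_add_iff 1).2 h.summable_fredholmTerm).mul_left (K p q)
  rw [h2.tsum_add h1.summable, h1.tsum_eq, tsum_mul_left]
  simp only [fredholmFirstMinor]
  ring

end IsHadamardKernel

end FredholmTheory

/-! ### Fredholm determinants on superlevel sets of a height function -/

section Height

variable {α : Type*} [MeasurableSpace α] {μ : Measure α} [SigmaFinite μ] {y : α → ℝ}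

/-- The restriction of `μ` to the superlevel set `{y > s}`. -/
noncomputable abbrev heightRestrict (μ : Measure α) (y : α → ℝ) (s : ℝ) : Measure α :=
  μ.restrict {p | s < y p}

theorem measurableSet_height (hy : Measurable y) (s : ℝ) : MeasurableSet {p | s < y p} :=
  hy measurableSet_Ioi

/-- Ensures that the lowest point of a configuration is almost surely unique. -/
theorem ae_pi_height_ne (hy : Measurable y) {m : Measure α} [SigmaFinite m]
    (hy0 : ∀ t, m {p | y p = t} = 0) (n : ℕ) :
    ∀ᵐ x : Fin (n + 1) → α ∂(Measure.pi fun _ => m),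
      ∀ (i : Fin (n + 1)) (j : Fin n), y (x i) ≠ y (x (i.succAbove j)) := by
  rw [ae_all_iff]
  intro i
  rw [ae_all_iff]
  intro j
  have h : ∀ᵐ r : α × (Fin n → α) ∂(m.prod (Measure.pi fun _ : Fin n => m)),
      y r.1 ≠ y (r.2 j) := by
    rw [ae_iff, Measure.measure_prod_null]
    · refine ae_of_all _ fun p => ?_
      refine measure_mono_null (t := (Function.eval j) ⁻¹' {q | y q = y p}) ?_
        (Measure.pi_eval_preimage_null _ (hy0 _))
      intro x hx
      simpa [eq_comm] using hx
    · simp only [ne_eq, not_not]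
      exact measurableSet_eq_fun (hy.comp measurable_fst)
        (hy.comp ((measurable_pi_apply j).comp measurable_snd))
  exact (measurePreserving_piFinSuccAbove (fun _ : Fin (n + 1) => m) i).quasiMeasurePreserving.ae h

/-- The same cycle acts on rows and on columns, so its sign cancels. -/
theorem fredholmMinor_eq_firstMinor (K : α → α → ℝ) {n : ℕ} (i : Fin (n + 1))
    (x : Fin (n + 1) → α) :
    fredholmMinor K (n + 1) x = firstMinor K n (x i) (x i) (fun j => x (i.succAbove j)) := by
  have hcons : (Fin.cons (x i) (fun j => x (i.succAbove j)) : Fin (n + 1) → α) =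
      x ∘ i.cycleRange.symm := by
    rw [← Fin.insertNth_comp_cycleRange_symm]
    congr 1
    exact (Fin.insertNth_self_removeNth i x).symm ▸ rfl
  rw [firstMinor, hcons, fredholmMinor]
  exact (Matrix.det_submatrix_equiv_self i.cycleRange.symm _).symm

namespace IsHadamardKernel

variable {K : α → α → ℝ} {c : α → ℝ} {s : ℝ}

theorem heightRestrict_mono (h : IsHadamardKernel (heightRestrict μ y s) K c) {u : ℝ}
    (hu : s ≤ u) : IsHadamardKernel (heightRestrict μ y u) K c :=
  h.mono_measure (Measure.restrict_mono (fun _ hp => lt_of_le_of_lt hu hp) le_rfl)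

theorem integral_sq_heightRestrict_le (h : IsHadamardKernel (heightRestrict μ y s) K c) {u : ℝ}
    (hu : s ≤ u) :
    ∫ p, c p ^ 2 ∂(heightRestrict μ y u) ≤ ∫ p, c p ^ 2 ∂(heightRestrict μ y s) :=
  integral_mono_measure (Measure.restrict_mono (fun _ hp => lt_of_le_of_lt hu hp) le_rfl)
    (ae_of_all _ fun _ => sq_nonneg _) h.integrable_sq

/-- The integrand of the `n`-th first minor, with the variables above the base point. -/
theorem integrable_indicator_firstMinor (h : IsHadamardKernel (heightRestrict μ y s) K c)
    (hy : Measurable y) (n : ℕ) :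
    Integrable (fun r : α × (Fin n → α) => {r : α × (Fin n → α) | ∀ j, y r.1 < y (r.2 j)}.indicator
      (fun r => firstMinor K n r.1 r.1 r.2) r)
      ((heightRestrict μ y s).prod (Measure.pi fun _ => heightRestrict μ y s)) := by
  have hb : Integrable (fun r : α × (Fin n → α) => c r.1 ^ 2 * ∏ i, c (r.2 i) ^ 2)
      ((heightRestrict μ y s).prod (Measure.pi fun _ => heightRestrict μ y s)) :=
    h.integrable_sq.mul_prod (h.integrable_prod_sq n)
  refine Integrable.indicator ?_ ?_
  · refine hb.mono' ((measurable_firstMinor h.measurable n).comp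
      (measurable_fst.prodMk (measurable_fst.prodMk measurable_snd))).aestronglyMeasurable
      (ae_of_all _ fun r => (h.abs_firstMinor_le _ _ _).trans_eq ?_)
    ring
  · rw [Set.ofPred_forall]
    exact MeasurableSet.iInter fun j => measurableSet_lt (hy.comp measurable_fst)
      (hy.comp ((measurable_pi_apply j).comp measurable_snd))

theorem integral_indicator_firstMinor (hy : Measurable y) (n : ℕ) {p : α} (hp : s < y p) :
    ∫ x, {r : α × (Fin n → α) | ∀ j, y r.1 < y (r.2 j)}.indicator
      (fun r => firstMinor K n r.1 r.1 r.2) (p, x) ∂(Measure.pi fun _ => heightRestrict μ y s) =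
    ∫ x, firstMinor K n p p x ∂(Measure.pi fun _ => heightRestrict μ y (y p)) := by
  have h1 : (Measure.pi fun _ : Fin n => heightRestrict μ y (y p)) =
      (Measure.pi fun _ : Fin n => heightRestrict μ y s).restrict
        (univ.pi fun _ => {q | y p < y q}) := by
    rw [Measure.restrict_pi_pi]
    congr 1
    ext1 _
    rw [heightRestrict, heightRestrict, Measure.restrict_restrict (measurableSet_height hy _)]
    congr 1
    ext q
    simp only [mem_ofPred_eq, mem_inter_iff]
    exact ⟨fun h => ⟨h, hp.trans h⟩, fun h => h.1⟩
  rw [h1, ← integral_indicator (MeasurableSet.univ_pi fun _ => measurableSet_height hy _)]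
  refine integral_congr_ae (ae_of_all _ fun x => ?_)
  simp [indicator]

/-- Configurations are sorted by which of their `n + 1` points is lowest. The cases contribute
equally, and the remaining points range over the superlevel set of the lowest one. -/
theorem integral_fredholmMinor_height (h : IsHadamardKernel (heightRestrict μ y s) K c)
    (hy : Measurable y) (hy0 : ∀ t, μ {p | y p = t} = 0) (n : ℕ) :
    ∫ x, fredholmMinor K (n + 1) x ∂(Measure.pi fun _ => heightRestrict μ y s) =
      (n + 1) * ∫ p, ∫ x, firstMinor K n p p x ∂(Measure.pi fun _ => heightRestrict μ y (y p))
        ∂(heightRestrict μ y s) := by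
  have hy0' : ∀ t, heightRestrict μ y s {p | y p = t} = 0 := fun t =>
    le_antisymm ((Measure.restrict_apply_le _ _).trans_eq (hy0 t)) (zero_le)
  have hI := h.integrable_indicator_firstMinor hy n
  have hmp := fun k : Fin (n + 1) =>
    measurePreserving_piFinSuccAbove (fun _ : Fin (n + 1) => heightRestrict μ y s) k
  let G : α × (Fin n → α) → ℝ := {r : α × (Fin n → α) | ∀ j, y r.1 < y (r.2 j)}.indicator
      (fun r => firstMinor K n r.1 r.1 r.2)
  have hk : ∀ k : Fin (n + 1), Integrable (fun x : Fin (n + 1) → α =>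
      G (x k, fun j => x (k.succAbove j))) (Measure.pi fun _ => heightRestrict μ y s) :=
    fun k => ((hmp k).integrable_comp_emb (MeasurableEquiv.measurableEmbedding _)).2 hI
  have hk' : ∀ k : Fin (n + 1), ∫ x : Fin (n + 1) → α,
      G (x k, fun j => x (k.succAbove j)) ∂(Measure.pi fun _ => heightRestrict μ y s) =
      ∫ p, ∫ x, firstMinor K n p p x ∂(Measure.pi fun _ => heightRestrict μ y (y p))
        ∂(heightRestrict μ y s) := fun k => by
    have h2 : ∫ r, G r ∂((heightRestrict μ y s).prod
        (Measure.pi fun _ => heightRestrict μ y s)) = _ := integral_prod _ hI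
    have h3 : ∫ p, ∫ x, G (p, x) ∂(Measure.pi fun _ => heightRestrict μ y s)
        ∂(heightRestrict μ y s) = ∫ p, ∫ x, firstMinor K n p p x
          ∂(Measure.pi fun _ => heightRestrict μ y (y p)) ∂(heightRestrict μ y s) := by
      refine integral_congr_ae ?_
      filter_upwards [ae_restrict_mem (measurableSet_height hy s)] with p hp
      exact integral_indicator_firstMinor hy n hp
    rw [← h3, ← h2]
    exact (hmp k).integral_comp' G
  have hsum : ∫ x, fredholmMinor K (n + 1) x ∂(Measure.pi fun _ => heightRestrict μ y s) =
      ∫ x : Fin (n + 1) → α, ∑ k, G (x k, fun j => x (k.succAbove j))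
        ∂(Measure.pi fun _ => heightRestrict μ y s) := by
    refine integral_congr_ae ?_
    filter_upwards [ae_pi_height_ne hy hy0' n] with x hx
    obtain ⟨i, -, hi⟩ := Finset.exists_min_image Finset.univ (fun i => y (x i))
      ⟨0, Finset.mem_univ _⟩
    rw [Finset.sum_eq_single i]
    · have hm : (x i, fun j => x (i.succAbove j)) ∈
          {r : α × (Fin n → α) | ∀ j, y r.1 < y (r.2 j)} := fun j =>
        lt_of_le_of_ne (hi _ (Finset.mem_univ _)) (hx i j)
      simp only [G, indicator_of_mem hm]
      exact fredholmMinor_eq_firstMinor K i x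
    · intro k _ hki
      refine indicator_of_notMem (fun hm => ?_) _
      obtain ⟨j, hj⟩ := Fin.exists_succAbove_eq hki.symm
      have := hm j
      simp only [hj] at this
      exact absurd (hi k (Finset.mem_univ _)) (not_le.2 this)
    · simp
  rw [hsum, integral_finsetSum _ fun k _ => hk k]
  simp [hk']

theorem fredholmTerm_height (h : IsHadamardKernel (heightRestrict μ y s) K c)
    (hy : Measurable y) (hy0 : ∀ t, μ {p | y p = t} = 0) (n : ℕ) :
    fredholmTerm (heightRestrict μ y s) K (n + 1) =
      -∫ p, firstMinorTerm (heightRestrict μ y (y p)) K n p p ∂(heightRestrict μ y s) := by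
  simp only [firstMinorTerm]
  rw [integral_const_mul, fredholmTerm, h.integral_fredholmMinor_height hy hy0, Nat.factorial_succ]
  push_cast
  have : (n.factorial : ℝ) ≠ 0 := by positivity
  have h3 : (n + 1 : ℝ) ≠ 0 := by positivity
  field_simp
  ring

theorem integrable_firstMinorTerm_height (h : IsHadamardKernel (heightRestrict μ y s) K c)
    (hy : Measurable y) (n : ℕ) :
    Integrable (fun p => firstMinorTerm (heightRestrict μ y (y p)) K n p p)
      (heightRestrict μ y s) := by
  refine (((h.integrable_indicator_firstMinor hy n).integral_prod_left).const_mul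
    ((-1) ^ n / (n.factorial : ℝ))).congr ?_
  filter_upwards [ae_restrict_mem (measurableSet_height hy s)] with p hp
  rw [integral_indicator_firstMinor hy n hp]
  rfl

theorem abs_firstMinorTerm_height_le (h : IsHadamardKernel (heightRestrict μ y s) K c)
    (n : ℕ) {p : α} (hp : s < y p) :
    |firstMinorTerm (heightRestrict μ y (y p)) K n p p| ≤
      c p ^ 2 * ((∫ p, c p ^ 2 ∂(heightRestrict μ y s)) ^ n / n.factorial) := by
  refine ((h.heightRestrict_mono hp.le).abs_firstMinorTerm_le n p p).trans ?_
  rw [← pow_two]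
  have := h.integral_sq_heightRestrict_le hp.le
  have h0 : 0 ≤ ∫ q, c q ^ 2 ∂(heightRestrict μ y (y p)) := integral_nonneg fun _ => sq_nonneg _
  gcongr

/-- The first minor at the lowest point is integrable. -/
theorem integrable_fredholmFirstMinor_height (h : IsHadamardKernel (heightRestrict μ y s) K c)
    (hy : Measurable y) :
    Integrable (fun p => fredholmFirstMinor (heightRestrict μ y (y p)) K p p)
      (heightRestrict μ y s) := by
  have hmem := ae_restrict_mem (μ := μ) (measurableSet_height hy s)
  refine (h.integrable_sq.mul_const (Real.exp (∫ p, c p ^ 2 ∂(heightRestrict μ y s)))).mono'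
    (aestronglyMeasurable_of_tendsto_ae atTop (f := fun N p => ∑ n ∈ Finset.range N,
      firstMinorTerm (heightRestrict μ y (y p)) K n p p) (fun N => ?_) ?_) ?_
  · exact (integrable_finsetSum _ fun n _ =>
      h.integrable_firstMinorTerm_height hy n).aestronglyMeasurable
  · filter_upwards [hmem] with p hp
    exact ((h.heightRestrict_mono (le_of_lt hp)).summable_firstMinorTerm
      p p).hasSum.tendsto_sum_nat
  · filter_upwards [hmem] with p hp
    refine ((h.heightRestrict_mono (le_of_lt hp)).abs_fredholmFirstMinor_le p p).trans ?_
    rw [← pow_two]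
    have := h.integral_sq_heightRestrict_le (le_of_lt hp)
    gcongr

/-- The factor `n + 1` from the choice of the lowest point turns `1 / (n + 1)!` into `1 / n!`, so
the terms resum to first minors. The integrand no longer involves `s`, which makes the determinant
differentiable in `s` by the fundamental theorem of calculus. -/
theorem fredholmDet_height (h : IsHadamardKernel (heightRestrict μ y s) K c)
    (hy : Measurable y) (hy0 : ∀ t, μ {p | y p = t} = 0) :
    fredholmDet (heightRestrict μ y s) K = 1 -
      ∫ p, fredholmFirstMinor (heightRestrict μ y (y p)) K p p ∂(heightRestrict μ y s) := by
  have hsum : Summable fun n => ∫ p, ‖firstMinorTerm (heightRestrict μ y (y p)) K n p p‖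
      ∂(heightRestrict μ y s) := by
    refine Summable.of_nonneg_of_le (fun n => integral_nonneg fun z => norm_nonneg _)
      (fun n => ?_) ((Real.summable_pow_div_factorial
        (∫ p, c p ^ 2 ∂(heightRestrict μ y s))).mul_left (∫ p, c p ^ 2 ∂(heightRestrict μ y s)))
    rw [← integral_mul_const]
    refine integral_mono_ae (h.integrable_firstMinorTerm_height hy n).norm
      (h.integrable_sq.mul_const _) ?_
    filter_upwards [ae_restrict_mem (measurableSet_height hy s)] with p hp
    exact h.abs_firstMinorTerm_height_le n hp
  have h1 := hasSum_integral_of_summable_integral_norm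
    (h.integrable_firstMinorTerm_height hy ·) hsum
  rw [fredholmDet, h.summable_fredholmTerm.tsum_eq_zero_add, fredholmTerm_zero]
  simp only [h.fredholmTerm_height hy hy0]
  rw [tsum_neg, h1.tsum_eq]
  rfl

end IsHadamardKernel

end Height

/-! ### Entire functions with bounded logarithmic derivative -/

theorem summable_mul_pow_of_le_pow_div_factorial {c : ℕ → ℝ} {T : ℝ}
    (hc : ∀ n, |c n| ≤ T ^ n / n.factorial) (x : ℝ) : Summable fun n => c n * x ^ n := by
  refine Summable.of_norm_bounded (Real.summable_pow_div_factorial (T * |x|)) fun n => ?_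
  rw [norm_mul, norm_pow, Real.norm_eq_abs, Real.norm_eq_abs, mul_pow, mul_div_right_comm]
  exact mul_le_mul_of_nonneg_right (hc n) (by positivity)

theorem analyticOnNhd_tsum_mul_pow {c : ℕ → ℝ} {T : ℝ}
    (hc : ∀ n, |c n| ≤ T ^ n / n.factorial) :
    AnalyticOnNhd ℝ (fun x => ∑' n, c n * x ^ n) univ := by
  let p := FormalMultilinearSeries.ofScalars ℝ c
  have hr : p.radius = ⊤ := by
    refine p.radius_eq_top_of_summable_norm fun r => ?_
    refine (summable_mul_pow_of_le_pow_div_factorial hc r).norm.congr fun n => ?_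
    simp [p]
  have h1 := (p.hasFPowerSeriesOnBall (by rw [hr]; simp)).analyticOnNhd
  rw [hr] at h1
  have h2 : p.sum = fun x => ∑' n, c n * x ^ n := by
    have := FormalMultilinearSeries.ofScalarsSum_eq_tsum (E := ℝ) c
    simpa [p, FormalMultilinearSeries.ofScalarsSum] using this
  rw [← h2]
  exact fun x _ => h1 x (by simp)

theorem hasDerivAt_tsum_mul_pow {c : ℕ → ℝ} {T : ℝ}
    (hc : ∀ n, |c n| ≤ T ^ n / n.factorial) (x : ℝ) :
    HasDerivAt (fun x => ∑' n, c n * x ^ n) (∑' n, c n * (n * x ^ (n - 1))) x := by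
  have hT : 0 ≤ T := by simpa using (abs_nonneg _).trans (hc 1)
  let R := |x| + 1
  have hR : 0 ≤ R := by positivity
  have hu : Summable fun n : ℕ => T ^ n / n.factorial * (n * R ^ (n - 1)) := by
    rw [← summable_nat_add_iff 1]
    refine ((Real.summable_pow_div_factorial (T * R)).mul_left T).congr fun n => ?_
    rw [Nat.factorial_succ]
    push_cast
    have : (n.factorial : ℝ) ≠ 0 := by positivity
    have h3 : (n + 1 : ℝ) ≠ 0 := by positivity
    field_simp
    ring_nf
  refine hasDerivAt_tsum_of_isPreconnected (t := Metric.ball 0 R) (y₀ := 0) hu Metric.isOpen_ball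
    (convex_ball 0 R).isPreconnected (fun n y _ => (hasDerivAt_pow n y).const_mul (c n))
    (fun n y hy => ?_) (by simp [R]; positivity)
    (summable_mul_pow_of_le_pow_div_factorial hc 0) (by simp [R])
  rw [norm_mul, norm_mul, norm_pow, RCLike.norm_natCast]
  have hy' : ‖y‖ ≤ R := by simpa using (mem_ball_zero_iff.1 hy).le
  exact mul_le_mul (hc n) (by gcongr) (by positivity) (by positivity)

/-- If the sum vanished at `1`, Grönwall's inequality with zero initial value would make it vanish
on an interval to the right of `1`, hence everywhere by analyticity, whereas its value at `0` is `c
0`. -/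
theorem tsum_ne_zero_of_abs_deriv_le {c : ℕ → ℝ} {T C : ℝ}
    (hc : ∀ n, |c n| ≤ T ^ n / n.factorial) (hc0 : c 0 ≠ 0)
    (h : ∀ᶠ x in 𝓝 (1 : ℝ), |∑' n, c n * (n * x ^ (n - 1))| ≤ C * |∑' n, c n * x ^ n|) :
    ∑' n, c n ≠ 0 := by
  intro h0
  obtain ⟨ε, hε, hball⟩ := Metric.eventually_nhds_iff.1 h
  have hmem : ∀ x ∈ Ico (1 : ℝ) (1 + ε), dist x 1 < ε := fun x hx => by
    rw [Real.dist_eq, abs_of_nonneg (by linarith [hx.1])]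
    linarith [hx.2]
  have hzero : ∀ x ∈ Icc (1 : ℝ) (1 + ε), ∑' n, c n * x ^ n = 0 := by
    intro x hx
    have := norm_le_gronwallBound_of_norm_deriv_right_le (δ := 0) (K := C) (ε := 0)
      (f := fun x => ∑' n, c n * x ^ n) (a := 1) (b := 1 + ε)
      (fun x _ => (hasDerivAt_tsum_mul_pow hc x).continuousAt.continuousWithinAt)
      (fun x _ => (hasDerivAt_tsum_mul_pow hc x).hasDerivWithinAt) (by simp [h0])
      (fun x hx => by simpa using hball (hmem x hx)) x hx
    rw [gronwallBound_ε0_δ0] at this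
    exact norm_le_zero_iff.1 this
  have hfreq : ∃ᶠ x in 𝓝[≠] (1 : ℝ), ∑' n, c n * x ^ n = 0 := by
    have hI : Ioo (1 : ℝ) (1 + ε) ∈ 𝓝[>] (1 : ℝ) := Ioo_mem_nhdsGT (by linarith)
    have : ∀ᶠ x in 𝓝[>] (1 : ℝ), ∑' n, c n * x ^ n = 0 := by
      filter_upwards [hI] with x hx using hzero x ⟨hx.1.le, hx.2.le⟩
    exact this.frequently.filter_mono (nhdsWithin_mono _ fun x hx => ne_of_gt hx)
  have := (analyticOnNhd_tsum_mul_pow hc).eqOn_zero_of_preconnected_of_frequently_eq_zero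
    isPreconnected_univ (mem_univ 1) hfreq (mem_univ 0)
  simp only [Pi.zero_apply] at this
  rw [tsum_eq_single 0 (by intro n hn; simp [hn])] at this
  simp [hc0] at this

/-! ### Frames and their Gram kernels -/

section Frame

variable {α : Type*} [MeasurableSpace α] {m : Measure α} {H : Type*} [NormedAddCommGroup H]
  [InnerProductSpace ℝ H] {φ : α → H}

/-- The Gram kernel `⟪φ p, φ q⟫`. -/
def gramKernel (φ : α → H) (p q : α) : ℝ := ⟪φ p, φ q⟫_ℝ

/-- The operator `∫ φ(p) ⊗ φ(p) dm(p)`. -/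
noncomputable def frameOp (m : Measure α) (φ : α → H) : H →L[ℝ] H :=
  ∫ p, InnerProductSpace.rankOne ℝ (φ p) (φ p) ∂m

theorem isHadamardKernel_gramKernel (hm : StronglyMeasurable φ) (hφ : MemLp φ 2 m) :
    IsHadamardKernel m (gramKernel φ) fun p => ‖φ p‖ where
  measurable := ((hm.comp_measurable measurable_fst).inner
    (hm.comp_measurable measurable_snd)).measurable
  nonneg _ := norm_nonneg _
  memLp := hφ.norm
  bound _ u v := abs_det_inner_le (fun i => φ (u i)) (fun j => φ (v j))

theorem continuous_rankOne_self :
    Continuous fun x : H => InnerProductSpace.rankOne ℝ x x := by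
  have : (fun x : H => InnerProductSpace.rankOne ℝ x x) =
      fun x => ((ContinuousLinearMap.smulRightL ℝ H H) (innerSL ℝ x)) x := by
    ext x y
    simp
  rw [this]
  exact ((ContinuousLinearMap.smulRightL ℝ H H).continuous.comp
    (innerSL ℝ).continuous).clm_apply continuous_id

theorem integrable_rankOne (hφ : MemLp φ 2 m) :
    Integrable (fun p => InnerProductSpace.rankOne ℝ (φ p) (φ p)) m := by
  refine hφ.norm.integrable_sq.mono'
    (continuous_rankOne_self.comp_aestronglyMeasurable hφ.aestronglyMeasurable)
    (ae_of_all _ fun p => ?_)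
  simp [pow_two]

theorem MeasureTheory.MemLp.integrable_smul_two {c : α → ℝ} (hc : MemLp c 2 m)
    (hφ : MemLp φ 2 m) : Integrable (fun p => c p • φ p) m := by
  refine (hc.norm.integrable_mul hφ.norm).mono' (hc.1.smul hφ.1) (ae_of_all _ fun p => ?_)
  simp [norm_smul]

theorem MeasureTheory.MemLp.const_inner_two (hφ : MemLp φ 2 m) (f : H) :
    MemLp (fun p => ⟪φ p, f⟫_ℝ) 2 m := by
  refine (hφ.norm.const_mul ‖f‖).mono (hφ.1.inner aestronglyMeasurable_const)
    (ae_of_all _ fun p => ?_)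
  simp only [norm_mul, norm_norm]
  rw [mul_comm]
  exact norm_inner_le_norm _ _

variable [CompleteSpace H]

theorem frameOp_apply (hφ : MemLp φ 2 m) (f : H) :
    frameOp m φ f = ∫ p, ⟪φ p, f⟫_ℝ • φ p ∂m := by
  rw [frameOp, ContinuousLinearMap.integral_apply (integrable_rankOne hφ)]
  rfl

theorem inner_frameOp (hφ : MemLp φ 2 m) (f g : H) :
    ⟪f, frameOp m φ g⟫_ℝ = ∫ p, ⟪φ p, f⟫_ℝ * ⟪φ p, g⟫_ℝ ∂m := by
  rw [frameOp_apply hφ, ← integral_inner ((hφ.const_inner_two g).integrable_smul_two hφ)]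
  refine integral_congr_ae (ae_of_all _ fun p => ?_)
  simp only [inner_smul_right, real_inner_comm f]
  ring

theorem frameOp_symmetric (hφ : MemLp φ 2 m) (f g : H) :
    ⟪frameOp m φ f, g⟫_ℝ = ⟪f, frameOp m φ g⟫_ℝ := by
  rw [real_inner_comm, inner_frameOp hφ, inner_frameOp hφ]
  simp only [mul_comm]

variable [SigmaFinite m]

/-- The first minor of a Gram kernel is given by the resolvent of the frame operator. -/
theorem fredholmFirstMinor_gramKernel (hm : StronglyMeasurable φ) (hφ : MemLp φ 2 m)
    (hu : IsUnit (1 - frameOp m φ)) (p q : α) :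
    fredholmFirstMinor m (gramKernel φ) p q = fredholmDet m (gramKernel φ) *
      ⟪φ p, Ring.inverse (1 - frameOp m φ) (φ q)⟫_ℝ := by
  have h := isHadamardKernel_gramKernel hm hφ
  let D := fredholmFirstMinor m (gramKernel φ)
  let F := fredholmDet m (gramKernel φ)
  have hD : MemLp (fun z => D z q) 2 m := by
    refine (hφ.norm.const_mul (‖φ q‖ * Real.exp (∫ p, ‖φ p‖ ^ 2 ∂m))).mono
      (h.measurable_fredholmFirstMinor.comp
        (measurable_id.prodMk measurable_const)).aestronglyMeasurable (ae_of_all _ fun z => ?_)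
    refine (h.abs_fredholmFirstMinor_le z q).trans_eq ?_
    rw [Real.norm_of_nonneg (by positivity)]
    ring
  have hI := hD.integrable_smul_two hφ
  -- Fredholm's relation says that `D p q` is the inner product of `φ p` with this vector.
  -- Substituting that back into the integral gives `(1 - T) Ψ = F • φ q` for the frame operator
  -- `T`.
  let Ψ : H := F • φ q + ∫ z, D z q • φ z ∂m
  have h1 : ∀ p, D p q = ⟪φ p, Ψ⟫_ℝ := fun p => by
    rw [inner_add_right, inner_smul_right, ← integral_inner hI]
    refine (h.fredholmFirstMinor_eq p q).trans ?_
    congr 1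
    refine integral_congr_ae (ae_of_all _ fun z => ?_)
    simp only [inner_smul_right, D, gramKernel]
    ring
  have h2 : (1 - frameOp m φ) Ψ = F • φ q := by
    rw [sub_apply, frameOp_apply hφ]
    simp only [← h1, one_apply_eq_self]
    exact add_sub_cancel_right _ _
  have h3 : Ψ = F • Ring.inverse (1 - frameOp m φ) (φ q) := by
    rw [← map_smul, ← h2, ← mul_apply_eq_comp, Ring.inverse_mul_cancel _ hu]
    rfl
  change D p q = _
  rw [h1, h3, inner_smul_right]

theorem fredholmTerm_smul_kernel (K : α → α → ℝ) (t : ℝ) (n : ℕ) :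
    fredholmTerm m (fun p q => t * K p q) n = fredholmTerm m K n * t ^ n := by
  have : fredholmMinor (fun p q => t * K p q) n = fun x => t ^ n * fredholmMinor K n x := by
    ext x
    have h := Matrix.det_smul (Matrix.of fun i j : Fin n => K (x i) (x j)) t
    rw [Fintype.card_fin] at h
    rw [fredholmMinor, fredholmMinor, ← h]
    rfl
  rw [fredholmTerm, fredholmTerm, this, integral_const_mul]
  ring

/-- Rescaling the frame by `√t` keeps `Det(I - tK)` within the Gram kernel theory. -/
theorem gramKernel_sqrt_smul {t : ℝ} (ht : 0 ≤ t) (φ : α → H) :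
    gramKernel (fun p => Real.sqrt t • φ p) = fun p q => t * gramKernel φ p q := by
  ext p q
  simp only [gramKernel, inner_smul_left, inner_smul_right, RCLike.conj_to_real]
  rw [← mul_assoc, Real.mul_self_sqrt ht]

theorem frameOp_sqrt_smul {t : ℝ} (ht : 0 ≤ t) (φ : α → H) :
    frameOp m (fun p => Real.sqrt t • φ p) = t • frameOp m φ := by
  rw [frameOp, frameOp, ← integral_smul]
  refine integral_congr_ae (ae_of_all _ fun p => ?_)
  ext f
  simp only [InnerProductSpace.rankOne_apply, inner_smul_left, RCLike.conj_to_real,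
    smul_apply, smul_smul]
  congr 1
  rw [mul_right_comm, Real.mul_self_sqrt ht]

/-- Setting the two base points equal and integrating restores the next Fredholm integral, up to a
factor `-(n + 1)`. The sum is therefore minus the derivative of `Det(I - tK)` at `t = 1`. -/
theorem integral_fredholmFirstMinor_diag {K : α → α → ℝ} {c : α → ℝ}
    (h : IsHadamardKernel m K c) :
    ∫ p, fredholmFirstMinor m K p p ∂m = -∑' n, fredholmTerm m K n * n := by
  have hI : ∀ n, Integrable (fun p => firstMinorTerm m K n p p) m := fun n => by
    refine (h.integrable_sq.mul_const ((∫ p, c p ^ 2 ∂m) ^ n / n.factorial)).mono'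
      ((IsHadamardKernel.measurable_firstMinorTerm h.measurable n).comp
        (measurable_id.prodMk measurable_id)).aestronglyMeasurable (ae_of_all _ fun p => ?_)
    rw [pow_two]
    exact h.abs_firstMinorTerm_le n p p
  have hsum : Summable fun n => ∫ p, ‖firstMinorTerm m K n p p‖ ∂m := by
    refine Summable.of_nonneg_of_le (fun n => integral_nonneg fun z => norm_nonneg _)
      (fun n => ?_) ((Real.summable_pow_div_factorial (∫ p, c p ^ 2 ∂m)).mul_left
        (∫ p, c p ^ 2 ∂m))
    rw [← integral_mul_const]
    refine integral_mono (hI n).norm (h.integrable_sq.mul_const _) fun p => ?_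
    simp only
    rw [pow_two (c p)]
    exact h.abs_firstMinorTerm_le n p p
  have h1 := hasSum_integral_of_summable_integral_norm hI hsum
  have h2 : ∀ n, ∫ p, firstMinorTerm m K n p p ∂m =
      -(fredholmTerm m K (n + 1) * (n + 1 : ℕ)) := fun n => by
    simp only [firstMinorTerm]
    rw [integral_const_mul, h.integral_firstMinor_diag, fredholmTerm, Nat.factorial_succ]
    push_cast
    have : (n.factorial : ℝ) ≠ 0 := by positivity
    have h3 : (n + 1 : ℝ) ≠ 0 := by positivity
    field_simp
    ring
  simp only [h2] at h1
  have h3 : Summable fun n : ℕ => fredholmTerm m K n * n :=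
    (summable_nat_add_iff 1).1 (by simpa using h1.summable.neg)
  rw [h3.tsum_eq_zero_add]
  simp only [Nat.cast_zero, mul_zero, zero_add]
  rw [← tsum_neg, h1.tsum_eq]
  rfl

theorem fredholmDet_sqrt_smul {t : ℝ} (ht : 0 ≤ t) (φ : α → H) :
    fredholmDet m (gramKernel fun p => Real.sqrt t • φ p) =
      ∑' n, fredholmTerm m (gramKernel φ) n * t ^ n := by
  rw [gramKernel_sqrt_smul ht, fredholmDet]
  simp only [fredholmTerm_smul_kernel]

theorem eventually_norm_inverse_le {A : Type*} [NormedRing A] [CompleteSpace A] {X : Type*}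
    [TopologicalSpace X] {f : X → A} {x : X} (hf : ContinuousAt f x) (hu : IsUnit (f x)) :
    ∀ᶠ z in 𝓝 x, IsUnit (f z) ∧ ‖Ring.inverse (f z)‖ ≤ ‖Ring.inverse (f x)‖ + 1 := by
  obtain ⟨u, hu⟩ := hu
  have h1 : ContinuousAt Ring.inverse (f x) := hu ▸ NormedRing.inverse_continuousAt u
  have h2 : ContinuousAt (fun z => ‖Ring.inverse (f z)‖) x :=
    (ContinuousAt.comp (f := f) (g := Ring.inverse) h1 hf).norm
  have h3 : ∀ᶠ z in 𝓝 x, IsUnit (f z) := by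
    have := hf.tendsto (hu ▸ u.nhds)
    exact this
  filter_upwards [h3, h2.eventually (gt_mem_nhds (lt_add_one _))] with z hz hz'
  exact ⟨hz, hz'.le⟩

/-- With `Φ(t) = Det(I - tK)`, the trace of the first minor is `-t Φ'(t)`, while each diagonal value
is `Φ(t)` times a resolvent element, bounded for `t` near `1`. Hence `|Φ'| ≤ C |Φ|` there. -/
theorem fredholmDet_gramKernel_ne_zero (hm : StronglyMeasurable φ) (hφ : MemLp φ 2 m)
    (hu : IsUnit (1 - frameOp m φ)) : fredholmDet m (gramKernel φ) ≠ 0 := by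
  have h := isHadamardKernel_gramKernel hm hφ
  have hcont : Continuous fun t : ℝ => 1 - t • frameOp m φ := by fun_prop
  have hev := eventually_norm_inverse_le (hcont.continuousAt (x := 1)) (by simpa using hu)
  refine tsum_ne_zero_of_abs_deriv_le (C := (‖Ring.inverse (1 - (1 : ℝ) • frameOp m φ)‖ + 1) *
    ∫ p, ‖φ p‖ ^ 2 ∂m) h.abs_fredholmTerm_le
    (by rw [IsHadamardKernel.fredholmTerm_zero]; exact one_ne_zero) ?_
  filter_upwards [hev, lt_mem_nhds zero_lt_one] with t ht ht0
  set C := ‖Ring.inverse (1 - (1 : ℝ) • frameOp m φ)‖ + 1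
  have hm' : StronglyMeasurable fun p => Real.sqrt t • φ p := hm.const_smul _
  have hφ' : MemLp (fun p => Real.sqrt t • φ p) 2 m := hφ.const_smul _
  have h1 := integral_fredholmFirstMinor_diag (isHadamardKernel_gramKernel hm' hφ')
  have h2 : ∀ n : ℕ, fredholmTerm m (gramKernel fun p => Real.sqrt t • φ p) n * n =
      t * (fredholmTerm m (gramKernel φ) n * (n * t ^ (n - 1))) := fun n => by
    rw [gramKernel_sqrt_smul ht0.le, fredholmTerm_smul_kernel]
    rcases n with - | n
    · simp
    · rw [pow_succ, Nat.add_sub_cancel]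
      ring
  simp only [h2] at h1
  rw [tsum_mul_left] at h1
  have h3 : |∫ p, fredholmFirstMinor m (gramKernel fun p => Real.sqrt t • φ p) p p ∂m| ≤
      t * (C * (∫ p, ‖φ p‖ ^ 2 ∂m) * |∑' n, fredholmTerm m (gramKernel φ) n * t ^ n|) := by
    rw [← fredholmDet_sqrt_smul ht0.le]
    have h4 : ∀ p, |fredholmFirstMinor m (gramKernel fun p => Real.sqrt t • φ p) p p| ≤
        t * C * |fredholmDet m (gramKernel fun p => Real.sqrt t • φ p)| * ‖φ p‖ ^ 2 := fun p => by
      rw [fredholmFirstMinor_gramKernel hm' hφ' (by rw [frameOp_sqrt_smul ht0.le]; exact ht.1),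
        abs_mul, frameOp_sqrt_smul ht0.le, map_smul, inner_smul_left, inner_smul_right,
        RCLike.conj_to_real, ← mul_assoc, Real.mul_self_sqrt ht0.le, abs_mul, abs_of_pos ht0]
      have h5 : |⟪φ p, Ring.inverse (1 - t • frameOp m φ) (φ p)⟫_ℝ| ≤ C * ‖φ p‖ ^ 2 := by
        refine (abs_real_inner_le_norm _ _).trans ?_
        calc _ ≤ ‖φ p‖ * (C * ‖φ p‖) := by
              gcongr
              exact (ContinuousLinearMap.le_opNorm _ _).trans (by gcongr; exact ht.2)
          _ = _ := by ring
      calc _ ≤ |fredholmDet m (gramKernel fun p => Real.sqrt t • φ p)| *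
            (t * (C * ‖φ p‖ ^ 2)) := by gcongr
        _ = _ := by ring
    refine abs_integral_le_integral_abs.trans ((integral_mono_of_nonneg
      (ae_of_all _ fun p => abs_nonneg _) (hφ.norm.integrable_sq.const_mul _)
      (ae_of_all _ h4)).trans_eq ?_)
    rw [integral_const_mul]
    ring
  rw [h1, abs_neg, abs_mul, abs_of_pos ht0] at h3
  exact le_of_mul_le_mul_left h3 ht0

/-- `Det(I - tK)` is continuous in `t`, equals `1` at `t = 0` and has no zero on `[0, 1]`, so the
intermediate value theorem fixes its sign. -/
theorem fredholmDet_gramKernel_pos (hm : StronglyMeasurable φ) (hφ : MemLp φ 2 m)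
    (hu : ∀ t ∈ Ioc (0 : ℝ) 1, IsUnit (1 - t • frameOp m φ)) :
    0 < fredholmDet m (gramKernel φ) := by
  have h := isHadamardKernel_gramKernel hm hφ
  let Φ : ℝ → ℝ := fun t => ∑' n, fredholmTerm m (gramKernel φ) n * t ^ n
  have hc : Continuous Φ := continuous_iff_continuousAt.2 fun t =>
    (hasDerivAt_tsum_mul_pow h.abs_fredholmTerm_le t).continuousAt
  have h0 : Φ 0 = 1 := by
    simp only [Φ]
    rw [tsum_eq_single 0 (by intro n hn; simp [hn]), IsHadamardKernel.fredholmTerm_zero]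
    simp
  have h1 : Φ 1 = fredholmDet m (gramKernel φ) := by simp [Φ, fredholmDet]
  have hne : ∀ t ∈ Icc (0 : ℝ) 1, Φ t ≠ 0 := by
    intro t ht
    rcases ht.1.eq_or_lt with rfl | ht0
    · rw [h0]; exact one_ne_zero
    · simp only [Φ]
      rw [← fredholmDet_sqrt_smul ht.1]
      exact fredholmDet_gramKernel_ne_zero (hm.const_smul _) (hφ.const_smul _)
        (by rw [frameOp_sqrt_smul ht.1]; exact hu t ⟨ht0, ht.2⟩)
  rw [← h1]
  by_contra hneg
  obtain ⟨t, ht, ht0⟩ := intermediate_value_Icc' zero_le_one hc.continuousOn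
    (show (0 : ℝ) ∈ Icc (Φ 1) (Φ 0) from ⟨not_lt.1 hneg, by rw [h0]; exact zero_le_one⟩)
  exact hne t ht ht0

end Frame

/-! ### Andréief's identity -/

section Andreief

variable {α β : Type*} [MeasurableSpace α] [MeasurableSpace β] {μ : Measure α} {ν : Measure β}
  [SigmaFinite μ] [SigmaFinite ν]

theorem det_sq_eq_sum {n : ℕ} (ψ : Fin n → β → ℝ) (z : Fin n → β) :
    (Matrix.of fun i j => ψ i (z j)).det ^ 2 = ∑ τ : Equiv.Perm (Fin n), ∑ π : Equiv.Perm (Fin n),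
      ((Equiv.Perm.sign τ : ℤ) : ℝ) * (((Equiv.Perm.sign π : ℤ) : ℝ) *
        ∏ i, (ψ (π i) (z i) * ψ (τ i) (z i))) := by
  rw [pow_two, Matrix.det_apply', Finset.sum_mul_sum, Finset.sum_comm]
  refine Finset.sum_congr rfl fun τ _ => Finset.sum_congr rfl fun π _ => ?_
  simp only [Matrix.of_apply, Finset.prod_mul_distrib]
  ring

theorem integrable_det_sq {n : ℕ} {ψ : Fin n → β → ℝ} (hψ : ∀ i, MemLp (ψ i) 2 ν) :
    Integrable (fun z : Fin n → β => (Matrix.of fun i j => ψ i (z j)).det ^ 2)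
      (Measure.pi fun _ => ν) := by
  simp only [det_sq_eq_sum]
  refine integrable_finsetSum _ fun τ _ => integrable_finsetSum _ fun π _ =>
    ((Integrable.fintype_prod (f := fun i z => ψ (π i) z * ψ (τ i) z) fun i => ?_).const_mul
      _).const_mul _
  exact (hψ _).integrable_mul (hψ _)

/-- In the double permutation expansion of the squared determinant the integrals factor over the
variables. For each fixed `τ` the sum over `π` is the full Gram determinant, so it appears `n!`
times. -/
theorem det_integral_mul {n : ℕ} {ψ : Fin n → β → ℝ} (hψ : ∀ i, MemLp (ψ i) 2 ν) :
    (Matrix.of fun i j => ∫ z, ψ i z * ψ j z ∂ν).det = (n.factorial : ℝ)⁻¹ *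
      ∫ z : Fin n → β, (Matrix.of fun i j => ψ i (z j)).det ^ 2 ∂(Measure.pi fun _ => ν) := by
  have hI : ∀ τ π : Equiv.Perm (Fin n), Integrable (fun z : Fin n → β =>
      ∏ i, (ψ (π i) (z i) * ψ (τ i) (z i))) (Measure.pi fun _ => ν) := fun τ π =>
    Integrable.fintype_prod (f := fun i z => ψ (π i) z * ψ (τ i) z)
      fun i => (hψ _).integrable_mul (hψ _)
  set G : Matrix (Fin n) (Fin n) ℝ := Matrix.of fun i j => ∫ z, ψ i z * ψ j z ∂ν with hG
  have h1 : ∀ τ : Equiv.Perm (Fin n), ∑ π : Equiv.Perm (Fin n),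
      ((Equiv.Perm.sign τ : ℤ) : ℝ) * (((Equiv.Perm.sign π : ℤ) : ℝ) *
        ∏ i, G (π i) (τ i)) = G.det := fun τ => by
    have h2 := Matrix.det_permute' τ G
    rw [Matrix.det_apply' (G.submatrix id τ)] at h2
    simp only [Matrix.submatrix_apply, id] at h2
    rw [← Finset.mul_sum, h2, ← mul_assoc, ← Int.cast_mul, ← Units.val_mul, Int.units_mul_self]
    simp
  simp only [det_sq_eq_sum]
  rw [integral_finsetSum _ fun τ _ => integrable_finsetSum _ fun π _ =>
    ((hI τ π).const_mul _).const_mul _]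
  have h3 : ∀ τ : Equiv.Perm (Fin n), ∫ z : Fin n → β, ∑ π : Equiv.Perm (Fin n),
      ((Equiv.Perm.sign τ : ℤ) : ℝ) * (((Equiv.Perm.sign π : ℤ) : ℝ) *
        ∏ i, (ψ (π i) (z i) * ψ (τ i) (z i))) ∂(Measure.pi fun _ => ν) = G.det := fun τ => by
    rw [integral_finsetSum _ fun π _ => ((hI τ π).const_mul _).const_mul _, ← h1 τ]
    refine Finset.sum_congr rfl fun π _ => ?_
    rw [integral_const_mul, integral_const_mul,
      integral_fintype_prod_eq_prod (fun i z => ψ (π i) z * ψ (τ i) z)]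
    rfl
  simp only [h3, Finset.sum_const, Finset.card_univ, Fintype.card_perm, Fintype.card_fin,
    nsmul_eq_mul]
  rw [← mul_assoc, inv_mul_cancel₀ (by positivity), one_mul]

theorem integral_integral_swap_of_nonneg {f : α → β → ℝ} (hf : Measurable (Function.uncurry f))
    (h0 : ∀ x z, 0 ≤ f x z) (h1 : ∀ x, Integrable (f x) ν)
    (h2 : ∀ z, Integrable (fun x => f x z) μ) :
    ∫ x, ∫ z, f x z ∂ν ∂μ = ∫ z, ∫ x, f x z ∂μ ∂ν := by
  rw [integral_eq_lintegral_of_nonneg_ae (ae_of_all _ fun x => integral_nonneg (h0 x))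
    hf.stronglyMeasurable.integral_prod_right.aestronglyMeasurable,
    integral_eq_lintegral_of_nonneg_ae (ae_of_all _ fun z => integral_nonneg fun x => h0 x z)
    hf.stronglyMeasurable.integral_prod_left.aestronglyMeasurable]
  congr 1
  simp only [fun x => ofReal_integral_eq_lintegral_ofReal (h1 x) (ae_of_all _ (h0 x)),
    fun z => ofReal_integral_eq_lintegral_ofReal (h2 z) (ae_of_all _ fun x => h0 x z)]
  exact lintegral_lintegral_swap hf.ennreal_ofReal.aemeasurable

/-- The Fredholm determinants of `Φᵀ Φ` and `Φ Φᵀ` agree term by term. -/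
theorem fredholmTerm_gram_comm {Φ : β → α → ℝ} (hΦ : Measurable (Function.uncurry Φ))
    (h1 : ∀ x, MemLp (fun z => Φ z x) 2 ν) (h2 : ∀ z, MemLp (Φ z) 2 μ) (n : ℕ) :
    fredholmTerm μ (fun x x' => ∫ z, Φ z x * Φ z x' ∂ν) n =
      fredholmTerm ν (fun z z' => ∫ x, Φ z x * Φ z' x ∂μ) n := by
  rw [fredholmTerm, fredholmTerm]
  congr 1
  simp only [fredholmMinor]
  -- Both sides become the double integral of the same square of `det [Φ(z_j, x_i)]`, with the same
  -- factor `1 / n!`. Nonnegativity lets Tonelli exchange the integrals.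
  have e1 := fun x : Fin n → α =>
    det_integral_mul (ψ := fun i z => Φ z (x i)) fun i => h1 (x i)
  have e2 := fun z : Fin n → β => det_integral_mul (ψ := fun i => Φ (z i)) fun i => h2 (z i)
  simp only [e1, e2, integral_const_mul]
  congr 1
  rw [integral_integral_swap_of_nonneg]
  · refine integral_congr_ae (ae_of_all _ fun z => integral_congr_ae (ae_of_all _ fun x => ?_))
    simp only
    rw [← Matrix.det_transpose]
    rfl
  · refine Measurable.pow_const ?_ 2
    simp only [Matrix.det_apply, Matrix.of_apply]
    refine Finset.measurable_sum _ fun π _ => Measurable.const_smul ?_ _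
    refine Finset.measurable_prod _ fun i _ => ?_
    have h : Measurable fun r : (Fin n → α) × (Fin n → β) => (r.2 i, r.1 (π i)) := by fun_prop
    exact hΦ.comp h
  · exact fun _ _ => sq_nonneg _
  · exact fun x => integrable_det_sq (ψ := fun i z => Φ z (x i)) fun i => h1 (x i)
  · intro z
    refine (integrable_det_sq (ψ := fun i => Φ (z i)) fun i => h2 (z i)).congr (ae_of_all _ fun x => ?_)
    simp only
    rw [← Matrix.det_transpose]
    rfl

end Andreief

/-! ### Integrals over half-lines with moving endpoint -/

section MovingEndpoint

variable {E : Type*} [NormedAddCommGroup E] [NormedSpace ℝ E] {f : ℝ → E}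

theorem integral_Ioi_eq_sub_intervalIntegral (hf : ∀ s, IntegrableOn f (Ioi s)) (s₀ s : ℝ) :
    ∫ u in Ioi s, f u = (∫ u in Ioi s₀, f u) - ∫ u in s₀..s, f u := by
  rw [← intervalIntegral.integral_Ioi_sub_Ioi' (hf s₀) (hf s)]
  abel

theorem intervalIntegrable_of_integrableOn_Ioi (hf : ∀ s, IntegrableOn f (Ioi s)) (a b : ℝ) :
    IntervalIntegrable f volume a b := by
  rw [intervalIntegrable_iff]
  exact (hf (min a b)).mono_set Ioc_subset_Ioi_self

theorem continuous_integral_Ioi (hf : ∀ s, IntegrableOn f (Ioi s)) :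
    Continuous fun s => ∫ u in Ioi s, f u := by
  rw [funext (integral_Ioi_eq_sub_intervalIntegral hf 0)]
  exact continuous_const.sub
    (intervalIntegral.continuous_primitive (intervalIntegrable_of_integrableOn_Ioi hf) 0)

theorem hasDerivAt_integral_Ioi [CompleteSpace E] (hf : ∀ s, IntegrableOn f (Ioi s)) {s : ℝ}
    (hc : ContinuousAt f s) :
    HasDerivAt (fun s => ∫ u in Ioi s, f u) (-f s) s := by
  rw [funext (integral_Ioi_eq_sub_intervalIntegral hf s)]
  refine HasDerivAt.const_sub _ ?_
  refine intervalIntegral.integral_hasDerivAt_right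
    (intervalIntegrable_of_integrableOn_Ioi hf s s) ?_ hc
  exact ⟨Ioi (s - 1), Ioi_mem_nhds (by linarith), (hf (s - 1)).aestronglyMeasurable⟩

end MovingEndpoint

/-! ### Translates of `A` as `L²` vectors, and integration over the strip -/

theorem measurePreserving_add_right_halfLine (s : ℝ) :
    MeasurePreserving (fun y : ℝ => y + s) halfLine (volume.restrict (Ioi s)) := by
  have := (measurePreserving_add_right (volume : Measure ℝ) s).restrict_preimage
    (measurableSet_Ioi (a := s))
  simpa using this

theorem toL2_of_memLp {α : Type*} [MeasurableSpace α] {μ : Measure α} {f : α → ℝ}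
    (hf : MemLp f 2 μ) : toL2 μ f = hf.toLp f := dif_pos hf

theorem coeFn_toL2 {α : Type*} [MeasurableSpace α] {μ : Measure α} {f : α → ℝ}
    (hf : MemLp f 2 μ) : toL2 μ f =ᵐ[μ] f := by
  rw [toL2_of_memLp hf]
  exact hf.coeFn_toLp

theorem inner_toL2 {α : Type*} [MeasurableSpace α] {μ : Measure α} {f : α → ℝ}
    (hf : MemLp f 2 μ) (g : Lp ℝ 2 μ) : ⟪toL2 μ f, g⟫_ℝ = ∫ x, f x * g x ∂μ := by
  rw [L2.inner_def]
  refine integral_congr_ae ?_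
  filter_upwards [coeFn_toL2 hf] with x hx
  rw [hx]
  simp [mul_comm]

theorem inner_toL2_toL2 {α : Type*} [MeasurableSpace α] {μ : Measure α} {f g : α → ℝ}
    (hf : MemLp f 2 μ) (hg : MemLp g 2 μ) : ⟪toL2 μ f, toL2 μ g⟫_ℝ = ∫ x, f x * g x ∂μ := by
  rw [inner_toL2 hf]
  refine integral_congr_ae ?_
  filter_upwards [coeFn_toL2 hg] with x hx
  rw [hx]

theorem norm_toL2_sq {α : Type*} [MeasurableSpace α] {μ : Measure α} {f : α → ℝ}
    (hf : MemLp f 2 μ) : ‖toL2 μ f‖ ^ 2 = ∫ x, f x ^ 2 ∂μ := by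
  rw [← real_inner_self_eq_norm_sq, inner_toL2_toL2 hf hf]
  simp only [pow_two]

/-- The vector `A(τ + ·)` of `L²(ℝ₊)`. -/
noncomputable def shiftVec (A : ℝ → ℝ) (τ : ℝ) : Lp ℝ 2 halfLine :=
  toL2 halfLine fun y => A (τ + y)

/-- The vector `σ^{1/2} A(· + x)` of `L²(ℝ)`. -/
noncomputable def weightedVec (A σ : ℝ → ℝ) (x : ℝ) : Lp ℝ 2 (volume : Measure ℝ) :=
  toL2 volume fun r => Real.sqrt (σ r) * A (r + x)

/-- The measure `dy dσ(t)` on the half-plane `y > s`. -/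
noncomputable abbrev strip (ν : Measure ℝ) (s : ℝ) : Measure (ℝ × ℝ) :=
  (volume.restrict (Ioi s)).prod ν

/-- The analytic content of the assumptions on `A` and `σ`, with `ν = dσ`. -/
structure FredholmData (A σ : ℝ → ℝ) (ν : Measure ℝ) : Prop where
  finite : IsFiniteMeasure ν
  continuous : Continuous A
  measurable : Measurable σ
  nonneg : ∀ r, 0 ≤ σ r
  le_one : ∀ r, σ r ≤ 1
  map_strip : (strip ν 0).map (fun p => p.1 + p.2) =
    volume.withDensity fun r => ENNReal.ofReal (σ r)
  memLp_shift : ∀ τ, MemLp (fun y => A (τ + y)) 2 halfLine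
  hilbertSchmidt : ∀ s, Integrable (fun p : ℝ × ℝ => σ p.1 * kerA A s p.1 p.2 ^ 2)
    (volume.prod halfLine)
  integrable_sq : ∀ s, Integrable (fun t => A (t + s) ^ 2) ν
  continuous_integral_sq : Continuous fun s => ∫ t, A (t + s) ^ 2 ∂ν

namespace FredholmData

variable {A σ : ℝ → ℝ} {ν : Measure ℝ}

theorem measurePreserving_strip [SFinite ν] (s : ℝ) :
    MeasurePreserving (fun p : ℝ × ℝ => (p.1 + s, p.2)) (strip ν 0) (strip ν s) :=
  (measurePreserving_add_right_halfLine s).prod (MeasurePreserving.id ν)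

theorem map_strip_sub (h : FredholmData A σ ν) (s : ℝ) :
    (strip ν s).map (fun p => p.1 + p.2 - s) = volume.withDensity fun r => ENNReal.ofReal (σ r) := by
  have := h.finite
  rw [← h.map_strip, ← (measurePreserving_strip (ν := ν) s).map_eq,
    Measure.map_map (by fun_prop) (by fun_prop)]
  congr 1
  ext p
  simp only [Function.comp]
  ring

section StripIntegral

variable {E : Type*} [NormedAddCommGroup E] [NormedSpace ℝ E] {G : ℝ → E}

/-- The substitution `r = y + t - s` trades `dy dσ(t)` on the strip for `σ(r) dr` on the line. -/
theorem integrable_strip_iff (h : FredholmData A σ ν) (hG : Continuous G) (s : ℝ) :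
    Integrable (fun p : ℝ × ℝ => G (p.1 + p.2)) (strip ν s) ↔
      Integrable (fun r => σ r • G (r + s)) := by
  have h1 : (fun p : ℝ × ℝ => G (p.1 + p.2)) =
      (fun r => G (r + s)) ∘ fun p : ℝ × ℝ => p.1 + p.2 - s := by
    ext p; simp
  have hGs : Continuous fun r => G (r + s) := by fun_prop
  rw [h1, ← integrable_map_measure hGs.aestronglyMeasurable (by fun_prop), h.map_strip_sub,
    integrable_withDensity_iff_integrable_smul' h.measurable.ennreal_ofReal (by simp)]
  simp only [fun r => ENNReal.toReal_ofReal (h.nonneg r)]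

theorem integral_strip (h : FredholmData A σ ν) (hG : Continuous G) (s : ℝ) :
    ∫ p, G (p.1 + p.2) ∂(strip ν s) = ∫ r, σ r • G (r + s) := by
  have hGs : Continuous fun r => G (r + s) := by fun_prop
  have h2 : ∫ p, G (p.1 + p.2) ∂(strip ν s) = ∫ p, (fun r => G (r + s)) (p.1 + p.2 - s)
      ∂(strip ν s) := by simp
  rw [h2, ← integral_map (φ := fun p : ℝ × ℝ => p.1 + p.2 - s) (by fun_prop)
    hGs.aestronglyMeasurable, h.map_strip_sub,
    integral_withDensity_eq_integral_toReal_smul h.measurable.ennreal_ofReal (by simp)]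
  simp only [fun r => ENNReal.toReal_ofReal (h.nonneg r)]

end StripIntegral

theorem strip_mono [SFinite ν] {s u : ℝ} (hsu : s ≤ u) : strip ν u ≤ strip ν s :=
  Measure.prod_mono (Measure.restrict_mono (Ioi_subset_Ioi hsu) le_rfl) le_rfl

theorem integrable_sq_strip (h : FredholmData A σ ν) (s : ℝ) :
    Integrable (fun p : ℝ × ℝ => A (p.1 + p.2) ^ 2) (strip ν s) := by
  have := h.finite
  have hc := h.continuous
  -- Fubini gives square integrability only at almost every base point. A good `x` in `(0, 1)` over
  -- the base `s - 1` yields the strip above `s - 1 + x < s`, which contains the strip above `s`.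
  have h1 := (h.hilbertSchmidt (s - 1)).prod_left_ae
  have h2 : ∀ᵐ x ∂(volume.restrict (Ioo (0 : ℝ) 1)), Integrable fun r =>
      σ r * kerA A (s - 1) r x ^ 2 :=
    ae_mono (Measure.restrict_mono Ioo_subset_Ioi_self le_rfl) h1
  have h3 : ∃ x ∈ Ioo (0 : ℝ) 1, Integrable fun r => σ r * kerA A (s - 1) r x ^ 2 := by
    have hne : (ae (volume.restrict (Ioo (0 : ℝ) 1))).NeBot := by
      rw [ae_restrict_neBot]
      simp
    obtain ⟨x, hx⟩ := (h2.and (ae_restrict_mem measurableSet_Ioo)).exists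
    exact ⟨x, hx.2, hx.1⟩
  obtain ⟨x, hx, hI⟩ := h3
  have h4 : Integrable (fun p : ℝ × ℝ => A (p.1 + p.2) ^ 2) (strip ν (s - 1 + x)) := by
    rw [h.integrable_strip_iff (G := fun r => A r ^ 2) (by fun_prop)]
    refine hI.congr (ae_of_all _ fun r => ?_)
    simp only [kerA, smul_eq_mul]
    rw [show r + x + (s - 1) = r + (s - 1 + x) by ring]
  exact h4.mono_measure (strip_mono (by linarith [hx.2]))

/-- `κ(s) = K₂(0, 0)`, the mass of `A²` over the half-plane. -/
noncomputable def diagMass (A : ℝ → ℝ) (ν : Measure ℝ) (s : ℝ) : ℝ :=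
  ∫ p, A (p.1 + p.2) ^ 2 ∂(strip ν s)

theorem diagMass_eq (h : FredholmData A σ ν) (s : ℝ) :
    diagMass A ν s = ∫ u in Ioi s, ∫ t, A (t + u) ^ 2 ∂ν := by
  have := h.finite
  rw [diagMass, integral_prod _ (h.integrable_sq_strip s)]
  simp only [add_comm]

theorem integrableOn_integral_sq (h : FredholmData A σ ν) (s : ℝ) :
    IntegrableOn (fun u => ∫ t, A (t + u) ^ 2 ∂ν) (Ioi s) := by
  have := h.finite
  refine (h.integrable_sq_strip s).integral_prod_left.congr (ae_of_all _ fun u => ?_)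
  simp only [add_comm]

theorem continuous_diagMass (h : FredholmData A σ ν) : Continuous (diagMass A ν) := by
  simp only [funext h.diagMass_eq]
  exact continuous_integral_Ioi h.integrableOn_integral_sq

theorem hasDerivAt_diagMass (h : FredholmData A σ ν) (s : ℝ) :
    HasDerivAt (diagMass A ν) (-∫ t, A (t + s) ^ 2 ∂ν) s := by
  rw [funext h.diagMass_eq]
  exact hasDerivAt_integral_Ioi h.integrableOn_integral_sq h.continuous_integral_sq.continuousAt

theorem integral_weighted_sq (h : FredholmData A σ ν) (x : ℝ) :
    ∫ r, σ r * A (r + x) ^ 2 = diagMass A ν x := by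
  have hc := h.continuous
  rw [diagMass, h.integral_strip (G := fun r => A r ^ 2) (by fun_prop)]
  rfl

theorem integrable_weighted_sq (h : FredholmData A σ ν) (x : ℝ) :
    Integrable fun r => σ r * A (r + x) ^ 2 := by
  have hc := h.continuous
  exact (h.integrable_strip_iff (G := fun r => A r ^ 2) (by fun_prop) x).1
    (h.integrable_sq_strip x)

theorem memLp_weighted (h : FredholmData A σ ν) (x : ℝ) :
    MemLp (fun r => Real.sqrt (σ r) * A (r + x)) 2 := by
  have hc := h.continuous
  refine (memLp_two_iff_integrable_sq ?_).2 ((h.integrable_weighted_sq x).congr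
    (ae_of_all _ fun r => ?_))
  · exact (h.measurable.sqrt.mul (by fun_prop)).aestronglyMeasurable
  · simp only [mul_pow, Real.sq_sqrt (h.nonneg r)]

theorem inner_weightedVec (h : FredholmData A σ ν) (x y : ℝ) :
    ⟪weightedVec A σ x, weightedVec A σ y⟫_ℝ = ∫ r, σ r * (A (r + x) * A (r + y)) := by
  rw [weightedVec, weightedVec, inner_toL2_toL2 (h.memLp_weighted x) (h.memLp_weighted y)]
  refine integral_congr_ae (ae_of_all _ fun r => ?_)
  have := Real.mul_self_sqrt (h.nonneg r)
  simp only
  linear_combination (A (r + x) * A (r + y)) * this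

theorem norm_weightedVec_sq (h : FredholmData A σ ν) (x : ℝ) :
    ‖weightedVec A σ x‖ ^ 2 = diagMass A ν x := by
  rw [← real_inner_self_eq_norm_sq, h.inner_weightedVec, ← h.integral_weighted_sq]
  simp only [pow_two]

/-- The squared norm is `κ(x)`, an integral with moving endpoint and so continuous; this upgrades
the pointwise continuity of `A` to continuity in `L²`. -/
theorem continuous_weightedVec (h : FredholmData A σ ν) : Continuous (weightedVec A σ) := by
  have hc := h.continuous
  have := continuous_toLp_two h.memLp_weighted (fun r => by fun_prop) (by
    have h1 : ∀ x, ∫ r, (Real.sqrt (σ r) * A (r + x)) ^ 2 = diagMass A ν x := fun x => by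
      rw [← h.norm_weightedVec_sq, weightedVec, norm_toL2_sq (h.memLp_weighted x)]
    simp only [h1]
    exact h.continuous_diagMass)
  unfold weightedVec
  simpa only [toL2_of_memLp (h.memLp_weighted _)] using this

theorem norm_shiftVec_sq (h : FredholmData A σ ν) (τ : ℝ) :
    ‖shiftVec A τ‖ ^ 2 = ∫ y, A (τ + y) ^ 2 ∂halfLine := norm_toL2_sq (h.memLp_shift τ)

theorem inner_shiftVec (h : FredholmData A σ ν) (τ τ' : ℝ) :
    ⟪shiftVec A τ, shiftVec A τ'⟫_ℝ = ∫ y, A (τ + y) * A (τ' + y) ∂halfLine :=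
  inner_toL2_toL2 (h.memLp_shift τ) (h.memLp_shift τ')

theorem continuous_shiftVec (h : FredholmData A σ ν) : Continuous (shiftVec A) := by
  have hc := h.continuous
  have h1 : ∀ τ, ∫ y, A (τ + y) ^ 2 ∂halfLine = ∫ u in Ioi τ, A u ^ 2 := fun τ => by
    rw [← (measurePreserving_add_right_halfLine τ).integral_comp
      (measurableEmbedding_addRight τ)]
    simp only [add_comm]
  have h2 : ∀ τ, IntegrableOn (fun u => A u ^ 2) (Ioi τ) := fun τ => by
    rw [IntegrableOn, ← (measurePreserving_add_right_halfLine τ).integrable_comp_emb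
      (measurableEmbedding_addRight τ)]
    refine (h.memLp_shift τ).integrable_sq.congr (ae_of_all _ fun y => ?_)
    simp [add_comm]
  have := continuous_toLp_two h.memLp_shift (fun r => by fun_prop) (by
    simp only [h1]
    exact continuous_integral_Ioi h2)
  unfold shiftVec
  simpa only [toL2_of_memLp (h.memLp_shift _)] using this

/-- The trace of `K₂` is finite. -/
theorem memLp_shiftVec_strip (h : FredholmData A σ ν) (s : ℝ) :
    MemLp (fun p : ℝ × ℝ => shiftVec A (p.1 + p.2)) 2 (strip ν s) := by
  have hc := h.continuous_shiftVec
  refine (memLp_two_iff_integrable_sq_norm (Continuous.aestronglyMeasurable (by fun_prop))).2 ?_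
  rw [h.integrable_strip_iff (G := fun r => ‖shiftVec A r‖ ^ 2) (by fun_prop)]
  refine (h.hilbertSchmidt s).integral_prod_left.congr (ae_of_all _ fun r => ?_)
  simp only [integral_const_mul, smul_eq_mul, h.norm_shiftVec_sq, kerA]
  congr 1
  refine integral_congr_ae (ae_of_all _ fun y => ?_)
  simp only
  rw [add_right_comm]

theorem memLp_weightedVec_Ioi (h : FredholmData A σ ν) (s : ℝ) :
    MemLp (weightedVec A σ) 2 (volume.restrict (Ioi s)) := by
  have hc := h.continuous_weightedVec
  refine (memLp_two_iff_integrable_sq_norm hc.aestronglyMeasurable).2 ?_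
  simp only [h.norm_weightedVec_sq]
  rw [← (measurePreserving_add_right_halfLine s).integrable_comp_emb
      (measurableEmbedding_addRight s)]
  refine (h.hilbertSchmidt s).integral_prod_right.congr (ae_of_all _ fun y => ?_)
  simp only [Function.comp, ← h.integral_weighted_sq, kerA, add_assoc]

/-- The square norms of `A_sᵀ` at `t` add up to `κ(s)`. -/
theorem integrable_norm_shiftVec_sq (h : FredholmData A σ ν) (s : ℝ) :
    Integrable (fun t => ‖shiftVec A (t + s)‖ ^ 2) ν ∧
      ∫ t, ‖shiftVec A (t + s)‖ ^ 2 ∂ν = diagMass A ν s := by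
  have := h.finite
  have hI : Integrable (fun p : ℝ × ℝ => A (p.1 + s + p.2) ^ 2) (strip ν 0) :=
    ((measurePreserving_strip (ν := ν) s).integrable_comp
      (h.integrable_sq_strip s).aestronglyMeasurable).2 (h.integrable_sq_strip s)
  have h2 : ∫ p, A (p.1 + s + p.2) ^ 2 ∂(strip ν 0) = diagMass A ν s :=
    (measurePreserving_strip (ν := ν) s).integral_comp
      ((measurableEmbedding_addRight s).prodMap MeasurableEmbedding.id)
      (fun p : ℝ × ℝ => A (p.1 + p.2) ^ 2)
  have h3 : ∀ t, ‖shiftVec A (t + s)‖ ^ 2 = ∫ y, A (y + s + t) ^ 2 ∂halfLine := fun t => by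
    rw [h.norm_shiftVec_sq]
    refine integral_congr_ae (ae_of_all _ fun y => ?_)
    simp only
    rw [show t + s + y = y + s + t by ring]
  simp only [h3]
  exact ⟨hI.integral_prod_right, by rw [← h2, integral_prod_symm _ hI]⟩

theorem memLp_shiftVec (h : FredholmData A σ ν) (s : ℝ) :
    MemLp (fun t => shiftVec A (t + s)) 2 ν := by
  have hc := h.continuous_shiftVec
  exact (memLp_two_iff_integrable_sq_norm (Continuous.aestronglyMeasurable (by fun_prop))).2
    (h.integrable_norm_shiftVec_sq s).1

theorem memLp_A (h : FredholmData A σ ν) (s : ℝ) : MemLp (fun t => A (t + s)) 2 ν := by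
  have hc := h.continuous
  exact (memLp_two_iff_integrable_sq (Continuous.aestronglyMeasurable (by fun_prop))).2
    (h.integrable_sq s)

theorem memLp_A_strip (h : FredholmData A σ ν) (s x : ℝ) :
    MemLp (fun p : ℝ × ℝ => A (p.1 + p.2 + x)) 2 (strip ν s) := by
  have hc := h.continuous
  refine (memLp_two_iff_integrable_sq (Continuous.aestronglyMeasurable (by fun_prop))).2 ?_
  rw [h.integrable_strip_iff (G := fun r => A (r + x) ^ 2) (by fun_prop)]
  simpa only [add_assoc, smul_eq_mul] using h.integrable_weighted_sq (s + x)

end FredholmData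

/-- A Bochner integral in `L²` is computed pointwise. -/
theorem coeFn_integral_smul_toL2 {α β : Type*} [MeasurableSpace α] [MeasurableSpace β]
    {μ : Measure α} [SigmaFinite μ] {π : Measure β} [SFinite π] {c : β → ℝ} {Φ : β → α → ℝ}
    (hc : MemLp c 2 π) (hΦ : MemLp (Function.uncurry Φ) 2 (π.prod μ))
    (hΦz : ∀ z, MemLp (Φ z) 2 μ) (hb : MemLp (fun z => toL2 μ (Φ z)) 2 π) :
    (∫ z, c z • toL2 μ (Φ z) ∂π : Lp ℝ 2 μ) =ᵐ[μ] fun x => ∫ z, c z * Φ z x ∂π := by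
  have hI : ∀ s, MeasurableSet s → μ s < ⊤ →
      Integrable (fun r : β × α => c r.1 * Φ r.1 r.2) (π.prod (μ.restrict s)) := by
    intro s hs hμs
    have : IsFiniteMeasure (μ.restrict s) := ⟨by simpa using hμs⟩
    have h1 : MemLp (fun r : β × α => c r.1) 2 (π.prod (μ.restrict s)) := hc.comp_fst _
    exact h1.integrable_mul (hΦ.mono_measure (Measure.prod_mono le_rfl Measure.restrict_le_self))
  have hLp : ∀ s, MeasurableSet s → μ s < ⊤ →
      IntegrableOn (∫ z, c z • toL2 μ (Φ z) ∂π : Lp ℝ 2 μ) s μ := fun s hs hμs =>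
    (integrableOn_Lp_of_measure_ne_top _ (by norm_num) hμs.ne)
  refine ae_eq_of_forall_setIntegral_eq_of_sigmaFinite hLp
    (fun s hs hμs => (hI s hs hμs).integral_prod_right) fun s hs hμs => ?_
  -- Pairing with indicators of sets of finite measure reduces the claim to Fubini on such sets,
  -- where integrability follows from Cauchy–Schwarz.
  rw [← L2.inner_indicatorConstLp_one (𝕜 := ℝ) hs hμs.ne,
    ← integral_inner (hc.integrable_smul_two hb)]
  rw [← integral_integral_swap (f := fun z x => c z * Φ z x) (hI s hs hμs)]
  refine integral_congr_ae (ae_of_all _ fun z => ?_)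
  simp only [inner_smul_right, integral_const_mul]
  rw [L2.inner_indicatorConstLp_one]
  congr 1
  exact setIntegral_congr_ae hs ((coeFn_toL2 (hΦz z)).mono fun x hx _ => hx)

/-! ### `K₂` over the strip: kernel, sections and operator -/

namespace FredholmData

variable {A σ : ℝ → ℝ} {ν : Measure ℝ}

/-- `K₂` as a superposition of rank one operators. -/
noncomputable def opK (A : ℝ → ℝ) (ν : Measure ℝ) (s : ℝ) :
    Lp ℝ 2 halfLine →L[ℝ] Lp ℝ 2 halfLine :=
  frameOp (strip ν s) fun p => shiftVec A (p.1 + p.2)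

/-- `-∂ₛ K₂ = A_sᵀ σ' A_s`. -/
noncomputable def opW (A : ℝ → ℝ) (ν : Measure ℝ) (s : ℝ) :
    Lp ℝ 2 halfLine →L[ℝ] Lp ℝ 2 halfLine :=
  frameOp ν fun t => shiftVec A (t + s)

/-- The function `K₂(·, x)`. -/
noncomputable def vecK (A : ℝ → ℝ) (ν : Measure ℝ) (s x : ℝ) : Lp ℝ 2 halfLine :=
  ∫ p, A (p.1 + p.2 + x) • shiftVec A (p.1 + p.2) ∂(strip ν s)

/-- `-∂ₛ K₂(·, 0)`. -/
noncomputable def vecV (A : ℝ → ℝ) (ν : Measure ℝ) (s : ℝ) : Lp ℝ 2 halfLine :=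
  ∫ t, A (t + s) • shiftVec A (t + s) ∂ν

theorem kerK₂_eq (h : FredholmData A σ ν) (s x y : ℝ) :
    kerK₂ A σ s x y = ∫ p, A (p.1 + p.2 + x) * A (p.1 + p.2 + y) ∂(strip ν s) := by
  have hc := h.continuous
  rw [h.integral_strip (G := fun r => A (r + x) * A (r + y)) (by fun_prop), kerK₂]
  refine integral_congr_ae (ae_of_all _ fun r => ?_)
  simp only [kerA, smul_eq_mul, add_right_comm r]
  ring

/-- Translation by `s` moves the whole dependence on `s` from the kernel to the interval `(s, ∞)`.
-/
theorem kerK₂_eq_inner (h : FredholmData A σ ν) (s x y : ℝ) :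
    kerK₂ A σ s x y = gramKernel (weightedVec A σ) (x + s) (y + s) := by
  rw [gramKernel, h.inner_weightedVec, kerK₂]
  refine integral_congr_ae (ae_of_all _ fun r => ?_)
  simp only [kerA, add_assoc]
  ring

theorem kerK₂_symm (h : FredholmData A σ ν) (s x y : ℝ) :
    kerK₂ A σ s x y = kerK₂ A σ s y x := by
  simp only [h.kerK₂_eq, mul_comm]

theorem kerK₂_zero (h : FredholmData A σ ν) (s : ℝ) : kerK₂ A σ s 0 0 = diagMass A ν s := by
  rw [h.kerK₂_eq_inner, gramKernel, real_inner_self_eq_norm_sq, h.norm_weightedVec_sq, zero_add]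

theorem memLp_strip_prod (h : FredholmData A σ ν) (s : ℝ) :
    MemLp (Function.uncurry fun (p : ℝ × ℝ) (y : ℝ) => A (p.1 + p.2 + y)) 2
      ((strip ν s).prod halfLine) := by
  have := h.finite
  have hc := h.continuous
  have hm : Continuous (Function.uncurry fun (p : ℝ × ℝ) (y : ℝ) => A (p.1 + p.2 + y)) := by
    unfold Function.uncurry
    fun_prop
  refine (memLp_two_iff_integrable_sq hm.aestronglyMeasurable).2 ?_
  refine (integrable_prod_iff (hm.pow 2).aestronglyMeasurable).2 ⟨ae_of_all _ fun p =>
    (h.memLp_shift (p.1 + p.2)).integrable_sq, ?_⟩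
  refine (h.memLp_shiftVec_strip s).norm.integrable_sq.congr (ae_of_all _ fun p => ?_)
  simp [h.norm_shiftVec_sq]

theorem coeFn_integral_smul_shiftVec (h : FredholmData A σ ν) (s : ℝ) {c : ℝ × ℝ → ℝ}
    (hc : MemLp c 2 (strip ν s)) :
    (∫ p, c p • shiftVec A (p.1 + p.2) ∂(strip ν s) : Lp ℝ 2 halfLine) =ᵐ[halfLine]
      fun x => ∫ p, c p * A (p.1 + p.2 + x) ∂(strip ν s) := by
  have := h.finite
  exact coeFn_integral_smul_toL2 (Φ := fun (p : ℝ × ℝ) y => A (p.1 + p.2 + y)) hc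
    (h.memLp_strip_prod s) (fun p => h.memLp_shift _) (h.memLp_shiftVec_strip s)

theorem coeFn_vecK (h : FredholmData A σ ν) (s x : ℝ) :
    vecK A ν s x =ᵐ[halfLine] kerK₂ A σ s x := by
  filter_upwards [h.coeFn_integral_smul_shiftVec s (h.memLp_A_strip s x)] with y hy
  rw [vecK, hy, h.kerK₂_eq]

theorem memLp_kerK₂_section (h : FredholmData A σ ν) (s x : ℝ) :
    MemLp (kerK₂ A σ s x) 2 halfLine :=
  (memLp_congr_ae (h.coeFn_vecK s x)).1 (Lp.memLp _)

theorem toL2_kerK₂ (h : FredholmData A σ ν) (s : ℝ) :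
    toL2 halfLine (fun y => kerK₂ A σ s y 0) = vecK A ν s 0 := by
  simp only [fun y => h.kerK₂_symm s y 0]
  refine Lp.ext ?_
  exact (coeFn_toL2 (h.memLp_kerK₂_section s 0)).trans (h.coeFn_vecK s 0).symm

theorem memLp_kerK₂ (h : FredholmData A σ ν) (s : ℝ) :
    MemLp (Function.uncurry (kerK₂ A σ s)) 2 (halfLine.prod halfLine) := by
  have hb := h.continuous_weightedVec
  have hm : Continuous (Function.uncurry (kerK₂ A σ s)) := by
    have : Function.uncurry (kerK₂ A σ s) = fun p : ℝ × ℝ =>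
        ⟪weightedVec A σ (p.1 + s), weightedVec A σ (p.2 + s)⟫_ℝ := by
      ext p
      exact h.kerK₂_eq_inner s p.1 p.2
    rw [this]
    fun_prop
  refine (memLp_two_iff_integrable_sq hm.aestronglyMeasurable).2 ?_
  have h1 : Integrable (fun x => ‖weightedVec A σ (x + s)‖ ^ 2) halfLine :=
    ((measurePreserving_add_right_halfLine s).integrable_comp_emb
      (measurableEmbedding_addRight s)).2 (h.memLp_weightedVec_Ioi s).norm.integrable_sq
  refine (h1.mul_prod h1).mono' (hm.pow 2).aestronglyMeasurable (ae_of_all _ fun p => ?_)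
  rw [Real.norm_of_nonneg (sq_nonneg _), ← mul_pow, ← sq_abs]
  gcongr
  change |kerK₂ A σ s p.1 p.2| ≤ _
  rw [h.kerK₂_eq_inner]
  exact abs_real_inner_le_norm _ _

theorem opK₂_apply (h : FredholmData A σ ν) (s : ℝ) (f : Lp ℝ 2 halfLine) :
    opK₂ A σ s f =ᵐ[halfLine] fun x => ∫ y, kerK₂ A σ s x y * f y ∂halfLine := by
  rw [opK₂, integralOp, dif_pos (h.memLp_kerK₂ s)]
  exact hilbertSchmidtOp_apply _ _ f

theorem inner_vecK (h : FredholmData A σ ν) (s x : ℝ) (f : Lp ℝ 2 halfLine) :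
    ⟪vecK A ν s x, f⟫_ℝ = ∫ y, kerK₂ A σ s x y * f y ∂halfLine := by
  rw [L2.inner_def]
  refine integral_congr_ae ?_
  filter_upwards [h.coeFn_vecK s x] with y hy
  rw [hy]
  simp [mul_comm]

/-- Both operators send `f` to the function whose value at `x` is the pairing of `f` with `K₂(·,
x)`. The Bochner form is the one that can be differentiated in operator norm. -/
theorem opK₂_eq (h : FredholmData A σ ν) (s : ℝ) : opK₂ A σ s = opK A ν s := by
  ext1 f
  refine Lp.ext ((h.opK₂_apply s f).trans ?_)
  have hφ := h.memLp_shiftVec_strip s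
  rw [opK, frameOp_apply hφ]
  refine EventuallyEq.trans ?_ (h.coeFn_integral_smul_shiftVec s (hφ.const_inner_two f)).symm
  refine ae_of_all _ fun x => ?_
  simp only
  rw [← h.inner_vecK, real_inner_comm, vecK,
    ← integral_inner ((h.memLp_A_strip s x).integrable_smul_two hφ)]
  refine integral_congr_ae (ae_of_all _ fun p => ?_)
  simp only [inner_smul_right, real_inner_comm f]
  ring

/-! ### Derivatives in `s` -/

theorem opK_eq_integral (h : FredholmData A σ ν) (s : ℝ) :
    opK A ν s = ∫ u in Ioi s, opW A ν u := by
  have := h.finite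
  rw [opK, frameOp, integral_prod _ (integrable_rankOne (h.memLp_shiftVec_strip s))]
  simp only [opW, frameOp, add_comm]

theorem integrableOn_opW (h : FredholmData A σ ν) (s : ℝ) : IntegrableOn (opW A ν) (Ioi s) := by
  have := h.finite
  refine (integrable_rankOne (h.memLp_shiftVec_strip s)).integral_prod_left.congr
    (ae_of_all _ fun u => ?_)
  simp only [opW, frameOp, add_comm]

theorem continuous_integral_norm_shiftVec_sq (h : FredholmData A σ ν) :
    Continuous fun s => ∫ t, ‖shiftVec A (t + s)‖ ^ 2 ∂ν := by
  rw [funext fun s => (h.integrable_norm_shiftVec_sq s).2]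
  exact h.continuous_diagMass

/-- The integrand has norm `‖a_{t+s}‖²`, whose `dσ`-integral is `κ(s)`; continuity of `κ` replaces a
fixed majorant. -/
theorem continuous_opW (h : FredholmData A σ ν) : Continuous (opW A ν) := by
  have hc := h.continuous_shiftVec
  refine continuous_iff_continuousAt.2 fun s => ?_
  refine continuousAt_integral_of_continuousAt_integral_bound (U := univ)
    (g := fun u t => ‖shiftVec A (t + u)‖ ^ 2) univ_mem
    (fun u _ => (integrable_rankOne (h.memLp_shiftVec u)).aestronglyMeasurable)
    (fun u _ => (h.integrable_norm_shiftVec_sq u).1)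
    (fun u _ => ae_of_all _ fun t => by simp [pow_two])
    (ae_of_all _ fun t => ?_) (ae_of_all _ fun t => ?_)
    h.continuous_integral_norm_shiftVec_sq.continuousAt
  · exact (continuous_rankOne_self.comp (hc.comp (continuous_const.add continuous_id))).continuousAt
  · exact Continuous.continuousAt (by fun_prop)

theorem hasDerivAt_opK (h : FredholmData A σ ν) (s : ℝ) :
    HasDerivAt (opK A ν) (-opW A ν s) s := by
  rw [funext h.opK_eq_integral]
  exact hasDerivAt_integral_Ioi h.integrableOn_opW h.continuous_opW.continuousAt

theorem integrable_smul_shiftVec_strip (h : FredholmData A σ ν) (s : ℝ) :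
    Integrable (fun p : ℝ × ℝ => A (p.1 + p.2) • shiftVec A (p.1 + p.2)) (strip ν s) := by
  have := (h.memLp_A_strip s 0).integrable_smul_two (h.memLp_shiftVec_strip s)
  simpa only [add_zero] using this

theorem vecK_zero_eq_integral (h : FredholmData A σ ν) (s : ℝ) :
    vecK A ν s 0 = ∫ u in Ioi s, vecV A ν u := by
  have := h.finite
  simp only [vecK, add_zero]
  rw [integral_prod _ (h.integrable_smul_shiftVec_strip s)]
  simp only [vecV, add_comm]

theorem integrableOn_vecV (h : FredholmData A σ ν) (s : ℝ) : IntegrableOn (vecV A ν) (Ioi s) := by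
  have := h.finite
  refine (h.integrable_smul_shiftVec_strip s).integral_prod_left.congr
    (ae_of_all _ fun u => ?_)
  simp only [vecV, add_comm]

theorem continuous_vecV (h : FredholmData A σ ν) : Continuous (vecV A ν) := by
  have hA := h.continuous
  have hc := h.continuous_shiftVec
  refine continuous_iff_continuousAt.2 fun s => ?_
  refine continuousAt_integral_of_continuousAt_integral_bound (U := univ)
    (g := fun u t => A (t + u) ^ 2 + ‖shiftVec A (t + u)‖ ^ 2) univ_mem
    (fun u _ => ((h.memLp_A u).integrable_smul_two (h.memLp_shiftVec u)).aestronglyMeasurable)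
    (fun u _ => (h.integrable_sq u).add (h.integrable_norm_shiftVec_sq u).1)
    (fun u _ => ae_of_all _ fun t => ?_)
    (ae_of_all _ fun t => Continuous.continuousAt (by fun_prop))
    (ae_of_all _ fun t => Continuous.continuousAt (by fun_prop)) ?_
  · rw [norm_smul, Real.norm_eq_abs, ← sq_abs (A (t + u))]
    nlinarith [sq_nonneg (|A (t + u)| - ‖shiftVec A (t + u)‖), sq_nonneg (|A (t + u)|),
      sq_nonneg ‖shiftVec A (t + u)‖]
  · have : (fun u => ∫ t, (A (t + u) ^ 2 + ‖shiftVec A (t + u)‖ ^ 2) ∂ν) =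
        fun u => ∫ t, A (t + u) ^ 2 ∂ν + ∫ t, ‖shiftVec A (t + u)‖ ^ 2 ∂ν := by
      ext u
      rw [integral_add (h.integrable_sq u) (h.integrable_norm_shiftVec_sq u).1]
    rw [this]
    exact (h.continuous_integral_sq.add h.continuous_integral_norm_shiftVec_sq).continuousAt

theorem hasDerivAt_vecK_zero (h : FredholmData A σ ν) (s : ℝ) :
    HasDerivAt (fun s => vecK A ν s 0) (-vecV A ν s) s := by
  rw [funext h.vecK_zero_eq_integral]
  exact hasDerivAt_integral_Ioi h.integrableOn_vecV h.continuous_vecV.continuousAt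

/-! ### The resolvent -/

theorem resolvent_eq (h : FredholmData A σ ν) (s : ℝ) :
    InhomFredholm.resolvent A σ s = Ring.inverse (1 - opK A ν s) := by
  rw [InhomFredholm.resolvent, h.opK₂_eq]

theorem resolventDelta_eq (h : FredholmData A σ ν) (s : ℝ) :
    resolventDelta A σ s = InhomFredholm.resolvent A σ s (vecK A ν s 0) := by
  rw [resolventDelta, h.toL2_kerK₂]

theorem deltaResolventDelta_eq (h : FredholmData A σ ν) (s : ℝ) :
    deltaResolventDelta A σ s =
      diagMass A ν s + ⟪vecK A ν s 0, InhomFredholm.resolvent A σ s (vecK A ν s 0)⟫_ℝ := by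
  rw [deltaResolventDelta, pairResolventDelta, h.inner_vecK, h.resolventDelta_eq, h.kerK₂_zero]

theorem kerA_eq (A : ℝ → ℝ) (s t y : ℝ) : kerA A s t y = A (t + s + y) := by
  rw [kerA, add_right_comm]

theorem q₀_eq (h : FredholmData A σ ν) (s t : ℝ) :
    q₀ A σ s t = A (t + s) + ⟪shiftVec A (t + s), InhomFredholm.resolvent A σ s (vecK A ν s 0)⟫_ℝ := by
  rw [q₀, pairResolventDelta, shiftVec, inner_toL2 (h.memLp_shift _), h.resolventDelta_eq]
  simp only [kerA_eq, add_zero]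

theorem u₀_eq (h : FredholmData A σ ν) (s t t' : ℝ) :
    u₀ A σ s t t' = ⟪shiftVec A (t + s), InhomFredholm.resolvent A σ s (shiftVec A (t' + s))⟫_ℝ := by
  rw [shiftVec, inner_toL2 (h.memLp_shift _), u₀]
  simp only [kerA_eq]
  rfl

theorem opK_symmetric (h : FredholmData A σ ν) (s : ℝ) (f g : Lp ℝ 2 halfLine) :
    ⟪opK A ν s f, g⟫_ℝ = ⟪f, opK A ν s g⟫_ℝ :=
  frameOp_symmetric (h.memLp_shiftVec_strip s) f g

theorem resolvent_symmetric (h : FredholmData A σ ν) {s : ℝ} (hu : IsUnit (1 - opK A ν s))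
    (f g : Lp ℝ 2 halfLine) :
    ⟪InhomFredholm.resolvent A σ s f, g⟫_ℝ = ⟪f, InhomFredholm.resolvent A σ s g⟫_ℝ := by
  have h1 : ∀ f, (1 - opK A ν s) (InhomFredholm.resolvent A σ s f) = f := fun f => by
    rw [h.resolvent_eq, ← mul_apply_eq_comp, Ring.mul_inverse_cancel _ hu]
    rfl
  conv_lhs => rw [← h1 g]
  conv_rhs => rw [← h1 f]
  simp only [sub_apply, one_apply_eq_self, inner_sub_left, inner_sub_right, h.opK_symmetric]

/-- Since `∂ₛ(1 - K₂) = W` with `W = A_sᵀ σ' A_s`, the derivative of inversion gives `∂ₛ R = -R W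
R`. -/
theorem hasDerivAt_resolvent (h : FredholmData A σ ν) {s : ℝ} (hu : IsUnit (1 - opK A ν s)) :
    HasDerivAt (InhomFredholm.resolvent A σ)
      (-(InhomFredholm.resolvent A σ s * opW A ν s * InhomFredholm.resolvent A σ s)) s := by
  obtain ⟨x, hx⟩ := hu
  have h1 := hasFDerivAt_ringInverse (𝕜 := ℝ) x
  rw [hx] at h1
  have h2 : HasDerivAt (fun s => 1 - opK A ν s) (opW A ν s) s := by
    simpa using (h.hasDerivAt_opK s).const_sub 1
  have h3 := HasFDerivAt.comp_hasDerivAt s h1 h2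
  rw [funext h.resolvent_eq]
  refine h3.congr_deriv ?_
  simp [← hx]

theorem inner_opW (h : FredholmData A σ ν) (s : ℝ) (f g : Lp ℝ 2 halfLine) :
    ⟪f, opW A ν s g⟫_ℝ = ∫ t, ⟪shiftVec A (t + s), f⟫_ℝ * ⟪shiftVec A (t + s), g⟫_ℝ ∂ν :=
  inner_frameOp (h.memLp_shiftVec s) f g

theorem memLp_q₀ (h : FredholmData A σ ν) (s : ℝ) : MemLp (q₀ A σ s) 2 ν := by
  rw [funext (h.q₀_eq s)]
  exact (h.memLp_A s).add ((h.memLp_shiftVec s).const_inner_two _)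

/-- Let `k = K₂(·, 0)`, `v = -∂ₛ k` and `R` the resolvent. The derivative of `κ + ⟪k, R k⟫` is `-∫
A² dσ - 2⟪v, R k⟫ - ⟪R k, W R k⟫` by symmetry of `R`. These are the three terms of `-∫ (A + ⟪a, R
k⟫)² dσ`, and the bracket is `q₀`. -/
theorem hasDerivAt_deltaResolventDelta (h : FredholmData A σ ν) {s : ℝ}
    (hu : IsUnit (1 - opK A ν s)) :
    HasDerivAt (deltaResolventDelta A σ) (-∫ t, q₀ A σ s t ^ 2 ∂ν) s := by
  rw [funext h.deltaResolventDelta_eq]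
  have hR := h.hasDerivAt_resolvent hu
  have hv := h.hasDerivAt_vecK_zero s
  refine ((h.hasDerivAt_diagMass s).add (hv.inner ℝ (hR.clm_apply hv))).congr_deriv ?_
  set R := InhomFredholm.resolvent A σ s with hRdef
  set k := vecK A ν s 0
  have e1 : ⟪k, R (vecV A ν s)⟫_ℝ = ⟪vecV A ν s, R k⟫_ℝ := by
    rw [← h.resolvent_symmetric hu, real_inner_comm]
  have e2 : ⟪k, R (opW A ν s (R k))⟫_ℝ = ⟪R k, opW A ν s (R k)⟫_ℝ :=
    (h.resolvent_symmetric hu _ _).symm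
  have e3 : ⟪vecV A ν s, R k⟫_ℝ = ∫ t, A (t + s) * ⟪shiftVec A (t + s), R k⟫_ℝ ∂ν := by
    rw [real_inner_comm, vecV,
      ← integral_inner ((h.memLp_A s).integrable_smul_two (h.memLp_shiftVec s))]
    simp only [inner_smul_right, real_inner_comm (R k)]
  have i1 : Integrable (fun t => A (t + s) * ⟪shiftVec A (t + s), R k⟫_ℝ) ν :=
    (h.memLp_A s).integrable_mul ((h.memLp_shiftVec s).const_inner_two (R k))
  have i3 : Integrable (fun t => A (t + s) ^ 2 + 2 * (A (t + s) * ⟪shiftVec A (t + s), R k⟫_ℝ)) ν :=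
    (h.integrable_sq s).add (i1.const_mul 2)
  have i2 := ((h.memLp_shiftVec s).const_inner_two (R k)).integrable_sq
  have e4 : ∫ t, q₀ A σ s t ^ 2 ∂ν = ∫ t, A (t + s) ^ 2 ∂ν +
      2 * ∫ t, A (t + s) * ⟪shiftVec A (t + s), R k⟫_ℝ ∂ν +
      ∫ t, ⟪shiftVec A (t + s), R k⟫_ℝ ^ 2 ∂ν := by
    rw [← integral_const_mul, ← integral_add (h.integrable_sq s) (i1.const_mul 2),
      ← integral_add i3 i2]
    refine integral_congr_ae (ae_of_all _ fun t => ?_)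
    simp only [h.q₀_eq]
    ring
  rw [e4]
  simp only [neg_apply, mul_apply_eq_comp, map_neg, inner_add_right, inner_neg_left,
    inner_neg_right, e1, e2, e3, h.inner_opW, ← pow_two]
  ring

end FredholmData

namespace FredholmData

variable {A σ : ℝ → ℝ} {ν : Measure ℝ}

/-! ### The four Fredholm determinants -/

/-- The vectors `σ(x)^{1/2} A(x + s + ·)`, whose Gram kernel is the symmetrized `K₁`. -/
noncomputable def frameK₁ (A σ : ℝ → ℝ) (s x : ℝ) : Lp ℝ 2 halfLine :=
  Real.sqrt (σ x) • shiftVec A (x + s)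

theorem kerK₁_eq (h : FredholmData A σ ν) (s x y : ℝ) :
    kerK₁ A σ s x y = σ x * ⟪shiftVec A (x + s), shiftVec A (y + s)⟫_ℝ := by
  rw [kerK₁, h.inner_shiftVec]
  simp only [kerA_eq]

/-- The factor `∏ σ(xᵢ)` may be taken out of the rows, or split as `√σ` between rows and columns.
Nothing is divided by `σ`, so its zeros do no harm. -/
theorem fredholmMinor_kerK₁ (h : FredholmData A σ ν) (s : ℝ) (n : ℕ) :
    fredholmMinor (kerK₁ A σ s) n = fredholmMinor (gramKernel (frameK₁ A σ s)) n := by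
  ext x
  let G : Matrix (Fin n) (Fin n) ℝ :=
    Matrix.of fun i j => ⟪shiftVec A (x i + s), shiftVec A (x j + s)⟫_ℝ
  have h1 : fredholmMinor (kerK₁ A σ s) n x = (∏ i, σ (x i)) * G.det := by
    rw [← Matrix.det_mul_column, fredholmMinor]
    congr 1
    ext i j
    simp only [Matrix.of_apply, h.kerK₁_eq, G]
  have h2 : fredholmMinor (gramKernel (frameK₁ A σ s)) n x =
      (∏ i, Real.sqrt (σ (x i))) * ((∏ i, Real.sqrt (σ (x i))) * G.det) := by
    rw [← Matrix.det_mul_column, ← Matrix.det_mul_row, fredholmMinor]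
    congr 1
    ext i j
    simp only [Matrix.of_apply, gramKernel, frameK₁, inner_smul_left, inner_smul_right,
      RCLike.conj_to_real, G]
  rw [h1, h2, ← mul_assoc, ← Finset.prod_mul_distrib]
  simp only [fun i => Real.mul_self_sqrt (h.nonneg (x i))]

theorem stronglyMeasurable_frameK₁ (h : FredholmData A σ ν) (s : ℝ) :
    StronglyMeasurable (frameK₁ A σ s) := by
  have hc := h.continuous_shiftVec
  exact h.measurable.sqrt.stronglyMeasurable.smul
    (Continuous.stronglyMeasurable (by fun_prop))

theorem memLp_frameK₁ (h : FredholmData A σ ν) (s : ℝ) : MemLp (frameK₁ A σ s) 2 := by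
  have hc := h.continuous_shiftVec
  refine (memLp_two_iff_integrable_sq_norm
    (h.stronglyMeasurable_frameK₁ s).aestronglyMeasurable).2 ?_
  refine ((h.integrable_strip_iff (G := fun r => ‖shiftVec A r‖ ^ 2) (by fun_prop) s).1
    (h.memLp_shiftVec_strip s).norm.integrable_sq).congr (ae_of_all _ fun x => ?_)
  simp only [frameK₁, norm_smul, mul_pow, Real.norm_eq_abs, sq_abs, Real.sq_sqrt (h.nonneg x),
    smul_eq_mul]

theorem isHadamardKernel_frameK₁ (h : FredholmData A σ ν) (s : ℝ) :
    IsHadamardKernel volume (gramKernel (frameK₁ A σ s)) fun x => ‖frameK₁ A σ s x‖ :=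
  isHadamardKernel_gramKernel (h.stronglyMeasurable_frameK₁ s) (h.memLp_frameK₁ s)

theorem isHadamardKernel_weightedVec (h : FredholmData A σ ν) (s : ℝ) :
    IsHadamardKernel (volume.restrict (Ioi s)) (gramKernel (weightedVec A σ))
      fun x => ‖weightedVec A σ x‖ :=
  isHadamardKernel_gramKernel h.continuous_weightedVec.stronglyMeasurable
    (h.memLp_weightedVec_Ioi s)

theorem isHadamardKernel_kerK₂ (h : FredholmData A σ ν) (s : ℝ) :
    IsHadamardKernel halfLine (kerK₂ A σ s) fun x => ‖weightedVec A σ (x + s)‖ := by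
  have hc := h.continuous_weightedVec
  have hk : kerK₂ A σ s = gramKernel fun x => weightedVec A σ (x + s) := by
    ext x y
    exact h.kerK₂_eq_inner s x y
  rw [hk]
  exact isHadamardKernel_gramKernel (Continuous.stronglyMeasurable (by fun_prop))
    ((h.memLp_weightedVec_Ioi s).comp_measurePreserving (measurePreserving_add_right_halfLine s))

theorem continuous_stripVec (h : FredholmData A σ ν) :
    Continuous fun p : ℝ × ℝ => shiftVec A (p.1 + p.2) :=
  h.continuous_shiftVec.comp (continuous_fst.add continuous_snd)

theorem fredholmTerm_kerK₁ (h : FredholmData A σ ν) (s : ℝ) (n : ℕ) :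
    fredholmTerm volume (kerK₁ A σ s) n = fredholmTerm halfLine (kerK₂ A σ s) n := by
  have hA := h.continuous
  have hσ := h.measurable
  have h1 := fredholmTerm_gram_comm (μ := halfLine) (ν := (volume : Measure ℝ))
    (Φ := fun z x => Real.sqrt (σ z) * A (z + s + x))
    ((hσ.comp measurable_fst).sqrt.mul
      (hA.measurable.comp (by fun_prop : Measurable fun p : ℝ × ℝ => p.1 + s + p.2)))
    (fun x => by simpa only [add_assoc] using h.memLp_weighted (s + x))
    (fun z => (h.memLp_shift (z + s)).const_mul _) n
  have e1 : kerK₂ A σ s = fun x x' => ∫ z, Real.sqrt (σ z) * A (z + s + x) *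
      (Real.sqrt (σ z) * A (z + s + x')) := by
    ext x x'
    refine integral_congr_ae (ae_of_all _ fun r => ?_)
    simp only [kerA, add_right_comm r]
    linear_combination (-A (r + s + x) * A (r + s + x')) * Real.mul_self_sqrt (h.nonneg r)
  have e2 : gramKernel (frameK₁ A σ s) = fun z z' => ∫ x, Real.sqrt (σ z) * A (z + s + x) *
      (Real.sqrt (σ z') * A (z' + s + x)) ∂halfLine := by
    ext z z'
    simp only [gramKernel, frameK₁, inner_smul_left, inner_smul_right, RCLike.conj_to_real,
      h.inner_shiftVec, ← integral_const_mul]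
    refine integral_congr_ae (ae_of_all _ fun r => ?_)
    ring
  rw [fredholmTerm, h.fredholmMinor_kerK₁, ← fredholmTerm, e1, e2, h1]

theorem fredholmTerm_strip (h : FredholmData A σ ν) (s : ℝ) (n : ℕ) :
    fredholmTerm (strip ν s) (gramKernel fun p : ℝ × ℝ => shiftVec A (p.1 + p.2)) n =
      fredholmTerm halfLine (kerK₂ A σ s) n := by
  have := h.finite
  have hA := h.continuous
  have h1 := fredholmTerm_gram_comm (μ := halfLine) (ν := strip ν s)
    (Φ := fun p x => A (p.1 + p.2 + x))
    (hA.measurable.comp (by fun_prop : Measurable fun r : (ℝ × ℝ) × ℝ => r.1.1 + r.1.2 + r.2))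
    (fun x => h.memLp_A_strip s x) (fun p => h.memLp_shift (p.1 + p.2)) n
  have e1 : kerK₂ A σ s = fun x x' => ∫ p : ℝ × ℝ, A (p.1 + p.2 + x) * A (p.1 + p.2 + x')
      ∂(strip ν s) := by
    ext x x'
    exact h.kerK₂_eq s x x'
  have e2 : (gramKernel fun p : ℝ × ℝ => shiftVec A (p.1 + p.2)) = fun p p' =>
      ∫ x, A (p.1 + p.2 + x) * A (p'.1 + p'.2 + x) ∂halfLine := by
    ext p p'
    exact h.inner_shiftVec _ _
  rw [e1, e2, h1]

/-- Passing through `K₁` puts the translation by `s` inside a one-variable integral, so no change of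
variables in the `n`-fold integral is needed. -/
theorem fredholmTerm_Ioi (h : FredholmData A σ ν) (s : ℝ) (n : ℕ) :
    fredholmTerm (volume.restrict (Ioi s)) (gramKernel (weightedVec A σ)) n =
      fredholmTerm halfLine (kerK₂ A σ s) n := by
  have hA := h.continuous
  have hσ := h.measurable
  have hmp := measurePreserving_add_right_halfLine s
  have hm : ∀ z, MemLp (fun x => A (z + x)) 2 (volume.restrict (Ioi s)) := fun z => by
    rw [← hmp.map_eq, memLp_map_measure_iff (Continuous.aestronglyMeasurable (by fun_prop))
      (by fun_prop)]
    refine (h.memLp_shift (z + s)).ae_eq (ae_of_all _ fun x => ?_)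
    simp only [Function.comp]
    rw [add_assoc, add_comm s]
  have h1 := fredholmTerm_gram_comm (μ := volume.restrict (Ioi s)) (ν := (volume : Measure ℝ))
    (Φ := fun z x => Real.sqrt (σ z) * A (z + x))
    ((hσ.comp measurable_fst).sqrt.mul
      (hA.measurable.comp (by fun_prop : Measurable fun p : ℝ × ℝ => p.1 + p.2)))
    h.memLp_weighted (fun z => (hm z).const_mul _) n
  have e1 : gramKernel (weightedVec A σ) = fun x x' => ∫ z, Real.sqrt (σ z) * A (z + x) *
      (Real.sqrt (σ z) * A (z + x')) := by
    ext x x'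
    exact inner_toL2_toL2 (h.memLp_weighted x) (h.memLp_weighted x')
  have e2 : gramKernel (frameK₁ A σ s) = fun z z' => ∫ x, Real.sqrt (σ z) * A (z + x) *
      (Real.sqrt (σ z') * A (z' + x)) ∂(volume.restrict (Ioi s)) := by
    ext z z'
    rw [← hmp.integral_comp (measurableEmbedding_addRight s)]
    simp only [gramKernel, frameK₁, inner_smul_left, inner_smul_right, RCLike.conj_to_real,
      h.inner_shiftVec, ← integral_const_mul]
    refine integral_congr_ae (ae_of_all _ fun r => ?_)
    simp only
    rw [show z + s + r = z + (r + s) by ring, show z' + s + r = z' + (r + s) by ring]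
    ring
  rw [← h.fredholmTerm_kerK₁, fredholmTerm, fredholmTerm, h.fredholmMinor_kerK₁, ← fredholmTerm,
    ← fredholmTerm, e1, e2, h1]

theorem fredholmSeriesConverges_kerK₁ (h : FredholmData A σ ν) (s : ℝ) :
    FredholmSeriesConverges volume (kerK₁ A σ s) := by
  have h1 := (h.isHadamardKernel_frameK₁ s).fredholmSeriesConverges
  refine ⟨fun n => ?_, ?_⟩
  · rw [h.fredholmMinor_kerK₁]
    exact h1.1 n
  · refine h1.2.congr fun n => ?_
    rw [fredholmTerm, fredholmTerm, h.fredholmMinor_kerK₁]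

theorem fredholmDet_kerK₁ (h : FredholmData A σ ν) (s : ℝ) :
    fredholmDet volume (kerK₁ A σ s) = fredholmDet halfLine (kerK₂ A σ s) :=
  tsum_congr (h.fredholmTerm_kerK₁ s)

theorem fredholmDet_strip (h : FredholmData A σ ν) (s : ℝ) :
    fredholmDet (strip ν s) (gramKernel fun p : ℝ × ℝ => shiftVec A (p.1 + p.2)) =
      fredholmDet halfLine (kerK₂ A σ s) :=
  tsum_congr (h.fredholmTerm_strip s)

theorem fredholmDet_Ioi (h : FredholmData A σ ν) (s : ℝ) :
    fredholmDet (volume.restrict (Ioi s)) (gramKernel (weightedVec A σ)) =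
      fredholmDet halfLine (kerK₂ A σ s) :=
  tsum_congr (h.fredholmTerm_Ioi s)

/-! ### The first derivative through the moving endpoint -/

theorem integrableOn_firstMinor_Ioi (h : FredholmData A σ ν) (s : ℝ) :
    IntegrableOn (fun u => fredholmFirstMinor (volume.restrict (Ioi u))
      (gramKernel (weightedVec A σ)) u u) (Ioi s) :=
  IsHadamardKernel.integrable_fredholmFirstMinor_height (μ := volume) (y := fun u : ℝ => u)
    (h.isHadamardKernel_weightedVec s) measurable_id

theorem fredholmDet_kerK₂_eq (h : FredholmData A σ ν) (s : ℝ) :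
    fredholmDet halfLine (kerK₂ A σ s) = 1 - ∫ u in Ioi s,
      fredholmFirstMinor (volume.restrict (Ioi u)) (gramKernel (weightedVec A σ)) u u := by
  rw [← h.fredholmDet_Ioi]
  exact IsHadamardKernel.fredholmDet_height (μ := volume) (y := fun u : ℝ => u)
    (h.isHadamardKernel_weightedVec s) measurable_id (fun t => by simp)

theorem continuous_fredholmDet (h : FredholmData A σ ν) :
    Continuous fun s => fredholmDet halfLine (kerK₂ A σ s) := by
  rw [funext h.fredholmDet_kerK₂_eq]
  exact continuous_const.sub (continuous_integral_Ioi h.integrableOn_firstMinor_Ioi)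

/-- Translated to `ℝ₊`, Fredholm's relation reads `d = F K₂(·, 0) + K₂ d` with `F` the determinant,
so `d = F (I - K₂)⁻¹ K₂(·, 0)` in `L²`. The relation holds at every point, so inserting this on its
right side gives a genuine value at `0`. -/
theorem firstMinor_endpoint (h : FredholmData A σ ν) {s : ℝ} (hu : IsUnit (1 - opK A ν s)) :
    fredholmFirstMinor (volume.restrict (Ioi s)) (gramKernel (weightedVec A σ)) s s =
      fredholmDet halfLine (kerK₂ A σ s) * deltaResolventDelta A σ s := by
  have hk := h.isHadamardKernel_weightedVec s
  have hmp := measurePreserving_add_right_halfLine s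
  set F := fredholmDet halfLine (kerK₂ A σ s) with hF
  let d : ℝ → ℝ := fun x => fredholmFirstMinor (volume.restrict (Ioi s))
    (gramKernel (weightedVec A σ)) (x + s) s
  have hd : ∀ x, d x = F * kerK₂ A σ s x 0 + ∫ z, kerK₂ A σ s x z * d z ∂halfLine := fun x => by
    refine (hk.fredholmFirstMinor_eq (x + s) s).trans ?_
    rw [h.fredholmDet_Ioi, ← hmp.integral_comp (measurableEmbedding_addRight s)]
    simp only [h.kerK₂_eq_inner, zero_add, d, hF]
  have hdL : MemLp d 2 halfLine := by
    have h1 : MemLp (fun x => ‖weightedVec A σ (x + s)‖ * ‖weightedVec A σ s‖ *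
        Real.exp (∫ p, ‖weightedVec A σ p‖ ^ 2 ∂(volume.restrict (Ioi s)))) 2 halfLine :=
      ((((h.memLp_weightedVec_Ioi s).comp_measurePreserving hmp).norm).mul_const _).mul_const _
    refine h1.mono (hk.measurable_fredholmFirstMinor.comp
      ((measurable_id.add_const s).prodMk measurable_const)).aestronglyMeasurable
      (ae_of_all _ fun x => ?_)
    exact (hk.abs_fredholmFirstMinor_le (x + s) s).trans (le_abs_self _)
  have hz : ∀ x, ∫ z, kerK₂ A σ s x z * d z ∂halfLine = ⟪vecK A ν s x, toL2 halfLine d⟫_ℝ :=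
    fun x => by
      rw [h.inner_vecK]
      refine integral_congr_ae ?_
      filter_upwards [coeFn_toL2 hdL] with z hz
      rw [hz]
  have h2 : (1 - opK A ν s) (toL2 halfLine d) = F • vecK A ν s 0 := by
    rw [← h.opK₂_eq, sub_apply, one_apply_eq_self, sub_eq_iff_eq_add]
    refine Lp.ext ?_
    filter_upwards [coeFn_toL2 hdL, Lp.coeFn_add (F • vecK A ν s 0)
      (opK₂ A σ s (toL2 halfLine d)), Lp.coeFn_smul F (vecK A ν s 0), h.coeFn_vecK s 0,
      h.opK₂_apply s (toL2 halfLine d)] with x e1 e2 e3 e4 e5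
    rw [e1, e2, Pi.add_apply, e3, Pi.smul_apply, e4, e5, hd x, hz, h.inner_vecK,
      h.kerK₂_symm s 0 x]
    rfl
  have h3 : toL2 halfLine d = F • InhomFredholm.resolvent A σ s (vecK A ν s 0) := by
    rw [← map_smul, ← h2, ← mul_apply_eq_comp, h.resolvent_eq, Ring.inverse_mul_cancel _ hu]
    rfl
  have h4 : fredholmFirstMinor (volume.restrict (Ioi s)) (gramKernel (weightedVec A σ)) s s =
      d 0 := by simp [d]
  rw [h4, hd, hz, h3, inner_smul_right, h.deltaResolventDelta_eq, h.kerK₂_zero]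
  ring

theorem eventually_isUnit (h : FredholmData A σ ν) {s : ℝ} (hu : IsUnit (1 - opK A ν s)) :
    ∀ᶠ u in 𝓝 s, IsUnit (1 - opK A ν u) ∧
      ‖InhomFredholm.resolvent A σ u‖ ≤ ‖InhomFredholm.resolvent A σ s‖ + 1 := by
  have h1 : ContinuousAt (fun u => 1 - opK A ν u) s :=
    continuousAt_const.sub (h.hasDerivAt_opK s).continuousAt
  simpa only [h.resolvent_eq] using eventually_norm_inverse_le h1 hu

/-- The endpoint rule needs a continuous integrand. Invertibility is an open condition, so near `s`
the first minor is the product of the determinant and the resolvent element, both continuous at `s`.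
-/
theorem hasDerivAt_fredholmDet (h : FredholmData A σ ν) {s : ℝ}
    (hu : IsUnit (1 - opK A ν s)) :
    HasDerivAt (fun s => fredholmDet halfLine (kerK₂ A σ s))
      (fredholmDet halfLine (kerK₂ A σ s) * deltaResolventDelta A σ s) s := by
  have hc : ContinuousAt (fun u => fredholmFirstMinor (volume.restrict (Ioi u))
      (gramKernel (weightedVec A σ)) u u) s := by
    have h1 : (fun u => fredholmDet halfLine (kerK₂ A σ u) * deltaResolventDelta A σ u) =ᶠ[𝓝 s]
        fun u => fredholmFirstMinor (volume.restrict (Ioi u))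
          (gramKernel (weightedVec A σ)) u u := by
      filter_upwards [h.eventually_isUnit hu] with u hu'
      exact (h.firstMinor_endpoint hu'.1).symm
    exact (h.continuous_fredholmDet.continuousAt.mul
      (h.hasDerivAt_deltaResolventDelta hu).continuousAt).congr h1
  have h2 := (hasDerivAt_integral_Ioi h.integrableOn_firstMinor_Ioi hc).const_sub 1
  rw [← funext h.fredholmDet_kerK₂_eq, neg_neg, h.firstMinor_endpoint hu] at h2
  exact h2

/-! ### The first derivative through the measure `dσ` -/

theorem heightRestrict_fst [SFinite ν] (s : ℝ) :
    heightRestrict (volume.prod ν) Prod.fst s = strip ν s := by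
  have : {p : ℝ × ℝ | s < p.1} = Ioi s ×ˢ univ := by ext; simp
  rw [heightRestrict, this, ← Measure.prod_restrict, Measure.restrict_univ]

theorem isHadamardKernel_strip (h : FredholmData A σ ν) (s : ℝ) :
    IsHadamardKernel (strip ν s) (gramKernel fun p : ℝ × ℝ => shiftVec A (p.1 + p.2))
      fun p => ‖shiftVec A (p.1 + p.2)‖ :=
  isHadamardKernel_gramKernel h.continuous_stripVec.stronglyMeasurable (h.memLp_shiftVec_strip s)

theorem integrable_firstMinor_strip (h : FredholmData A σ ν) (s : ℝ) :
    Integrable (fun p : ℝ × ℝ => fredholmFirstMinor (strip ν p.1)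
      (gramKernel fun p : ℝ × ℝ => shiftVec A (p.1 + p.2)) p p) (strip ν s) := by
  have := h.finite
  have h1 := IsHadamardKernel.integrable_fredholmFirstMinor_height (μ := volume.prod ν)
    (y := Prod.fst) (s := s) (by rw [heightRestrict_fst]; exact h.isHadamardKernel_strip s)
    measurable_fst
  simpa only [heightRestrict_fst] using h1

/-- The first minor averaged over `dσ`. -/
noncomputable def stripMinor (A : ℝ → ℝ) (ν : Measure ℝ) (u : ℝ) : ℝ :=
  ∫ t, fredholmFirstMinor (strip ν u) (gramKernel fun p : ℝ × ℝ => shiftVec A (p.1 + p.2))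
    (u, t) (u, t) ∂ν

theorem integrableOn_stripMinor (h : FredholmData A σ ν) (s : ℝ) :
    IntegrableOn (stripMinor A ν) (Ioi s) := by
  have := h.finite
  exact (h.integrable_firstMinor_strip s).integral_prod_left

theorem fredholmDet_kerK₂_eq_strip (h : FredholmData A σ ν) (s : ℝ) :
    fredholmDet halfLine (kerK₂ A σ s) = 1 - ∫ u in Ioi s, stripMinor A ν u := by
  have := h.finite
  -- The height is the Lebesgue coordinate, so level sets are null even when `dσ` has atoms.
  have h0 : ∀ t, (volume.prod ν) {p : ℝ × ℝ | p.1 = t} = 0 := fun t => by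
    have : {p : ℝ × ℝ | p.1 = t} = {t} ×ˢ univ := by ext; simp
    rw [this, Measure.prod_prod]
    simp
  have h1 := IsHadamardKernel.fredholmDet_height (μ := volume.prod ν)
    (y := Prod.fst) (s := s) (by rw [heightRestrict_fst]; exact h.isHadamardKernel_strip s)
    measurable_fst h0
  simp only [heightRestrict_fst] at h1
  rw [← h.fredholmDet_strip, h1, integral_prod _ (h.integrable_firstMinor_strip s)]
  rfl

theorem stripMinor_eq (h : FredholmData A σ ν) {s : ℝ} (hu : IsUnit (1 - opK A ν s)) :
    stripMinor A ν s = fredholmDet halfLine (kerK₂ A σ s) * ∫ t, u₀ A σ s t t ∂ν := by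
  have := h.finite
  rw [stripMinor, ← integral_const_mul]
  refine integral_congr_ae (ae_of_all _ fun t => ?_)
  simp only
  rw [fredholmFirstMinor_gramKernel h.continuous_stripVec.stronglyMeasurable
    (h.memLp_shiftVec_strip s) hu, h.fredholmDet_strip, h.u₀_eq, h.resolvent_eq, add_comm s t]
  rfl

theorem abs_u₀_le (h : FredholmData A σ ν) (s t : ℝ) :
    |u₀ A σ s t t| ≤ ‖InhomFredholm.resolvent A σ s‖ * ‖shiftVec A (t + s)‖ ^ 2 := by
  rw [h.u₀_eq]
  refine (abs_real_inner_le_norm _ _).trans ?_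
  calc _ ≤ ‖shiftVec A (t + s)‖ * (‖InhomFredholm.resolvent A σ s‖ * ‖shiftVec A (t + s)‖) := by
        gcongr
        exact ContinuousLinearMap.le_opNorm _ _
    _ = _ := by ring

theorem integrable_u₀ (h : FredholmData A σ ν) (s : ℝ) :
    Integrable (fun t => u₀ A σ s t t) ν := by
  have hc := h.continuous_shiftVec
  refine ((h.integrable_norm_shiftVec_sq s).1.const_mul _).mono' ?_
    (ae_of_all _ (h.abs_u₀_le s))
  simp only [h.u₀_eq]
  exact Continuous.aestronglyMeasurable (by fun_prop)

/-- A local bound `C` on the resolvent gives the majorant `C ‖a_{t+s}‖²`, whose integral `C κ(s)` is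
continuous. -/
theorem continuousAt_integral_u₀ (h : FredholmData A σ ν) {s : ℝ}
    (hu : IsUnit (1 - opK A ν s)) : ContinuousAt (fun s => ∫ t, u₀ A σ s t t ∂ν) s := by
  have hc := h.continuous_shiftVec
  set C := ‖InhomFredholm.resolvent A σ s‖ + 1
  refine continuousAt_integral_of_continuousAt_integral_bound
    (U := {u | IsUnit (1 - opK A ν u) ∧ ‖InhomFredholm.resolvent A σ u‖ ≤ C})
    (g := fun u t => C * ‖shiftVec A (t + u)‖ ^ 2) (h.eventually_isUnit hu)
    (fun u _ => (h.integrable_u₀ u).aestronglyMeasurable)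
    (fun u _ => (h.integrable_norm_shiftVec_sq u).1.const_mul C)
    (fun u hu => ae_of_all _ fun t => (h.abs_u₀_le u t).trans
      (mul_le_mul_of_nonneg_right hu.2 (sq_nonneg _)))
    (ae_of_all _ fun t => ?_) (ae_of_all _ fun t => Continuous.continuousAt (by fun_prop)) ?_
  · simp only [h.u₀_eq]
    have h1 := (h.hasDerivAt_resolvent hu).continuousAt
    have h2 : ContinuousAt (fun u => shiftVec A (t + u)) s :=
      Continuous.continuousAt (by fun_prop)
    exact h2.inner (h1.clm_apply h2)
  · simp only [integral_const_mul]
    exact (h.continuous_integral_norm_shiftVec_sq.const_mul C).continuousAt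

theorem hasDerivAt_fredholmDet_strip (h : FredholmData A σ ν) {s : ℝ}
    (hu : IsUnit (1 - opK A ν s)) :
    HasDerivAt (fun s => fredholmDet halfLine (kerK₂ A σ s))
      (fredholmDet halfLine (kerK₂ A σ s) * ∫ t, u₀ A σ s t t ∂ν) s := by
  have hc : ContinuousAt (stripMinor A ν) s := by
    have h1 : (fun u => fredholmDet halfLine (kerK₂ A σ u) * ∫ t, u₀ A σ u t t ∂ν) =ᶠ[𝓝 s]
        stripMinor A ν := by
      filter_upwards [h.eventually_isUnit hu] with u hu'
      exact (h.stripMinor_eq hu'.1).symm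
    exact (h.continuous_fredholmDet.continuousAt.mul (h.continuousAt_integral_u₀ hu)).congr h1
  have h2 := (hasDerivAt_integral_Ioi h.integrableOn_stripMinor hc).const_sub 1
  rw [← funext h.fredholmDet_kerK₂_eq_strip, neg_neg, h.stripMinor_eq hu] at h2
  exact h2

theorem fredholmDet_ne_zero (h : FredholmData A σ ν) {s : ℝ} (hu : IsUnit (1 - opK A ν s)) :
    fredholmDet halfLine (kerK₂ A σ s) ≠ 0 := by
  have := h.finite
  rw [← h.fredholmDet_strip]
  exact fredholmDet_gramKernel_ne_zero h.continuous_stripVec.stronglyMeasurable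
    (h.memLp_shiftVec_strip s) hu

/-- Both sides times the nonzero determinant are its derivative at `s`. -/
theorem deltaResolventDelta_eq_integral (h : FredholmData A σ ν) {s : ℝ}
    (hu : IsUnit (1 - opK A ν s)) :
    deltaResolventDelta A σ s = ∫ t, u₀ A σ s t t ∂ν :=
  mul_left_cancel₀ (h.fredholmDet_ne_zero hu)
    ((h.hasDerivAt_fredholmDet hu).unique (h.hasDerivAt_fredholmDet_strip hu))

theorem hasDerivAt_log_fredholmDet (h : FredholmData A σ ν) {s : ℝ}
    (hu : IsUnit (1 - opK A ν s)) :
    HasDerivAt (fun s => Real.log (fredholmDet halfLine (kerK₂ A σ s)))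
      (deltaResolventDelta A σ s) s := by
  have h1 := (h.hasDerivAt_fredholmDet hu).log (h.fredholmDet_ne_zero hu)
  rwa [mul_div_cancel_left₀ _ (h.fredholmDet_ne_zero hu)] at h1

theorem hasDerivAt_deriv_log_fredholmDet (h : FredholmData A σ ν) {s : ℝ}
    (hu : IsUnit (1 - opK A ν s)) :
    HasDerivAt (deriv fun s => Real.log (fredholmDet halfLine (kerK₂ A σ s)))
      (-∫ t, q₀ A σ s t ^ 2 ∂ν) s := by
  refine (h.hasDerivAt_deltaResolventDelta hu).congr_of_eventuallyEq ?_
  filter_upwards [h.eventually_isUnit hu] with u hu'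
  exact (h.hasDerivAt_log_fredholmDet hu'.1).deriv

end FredholmData

/-! ### Test functions on the half-line -/

/-- Classes of smooth compactly supported functions that vanish off the half-line. -/
def testSubmodule : Submodule ℝ (Lp ℝ 2 halfLine) where
  carrier := {v | ∃ f : ℝ → ℝ, ContDiff ℝ ∞ f ∧ HasCompactSupport f ∧
    Function.support f ⊆ Ioi 0 ∧ v =ᵐ[halfLine] f}
  add_mem' := by
    rintro u v ⟨f, hf, hfc, hfs, hu⟩ ⟨g, hg, hgc, hgs, hv⟩
    refine ⟨f + g, hf.add hg, hfc.add hgc,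
      (Function.support_add f g).trans (union_subset hfs hgs), ?_⟩
    exact (Lp.coeFn_add u v).trans (hu.add hv)
  zero_mem' := ⟨0, contDiff_const, HasCompactSupport.zero, by simp, Lp.coeFn_zero _ _ _⟩
  smul_mem' := by
    rintro c u ⟨f, hf, hfc, hfs, hu⟩
    refine ⟨c • f, hf.const_smul c, hfc.smul_left (f := fun _ => c),
      (Function.support_const_smul_subset c f).trans hfs, ?_⟩
    exact (Lp.coeFn_smul c u).trans (hu.const_smul c)

/-- A vector orthogonal to all test functions vanishes almost everywhere on the open half-line, by
the fundamental lemma of the calculus of variations. -/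
theorem dense_testSubmodule : Dense (testSubmodule : Set (Lp ℝ 2 halfLine)) := by
  rw [Submodule.dense_iff_topologicalClosure_eq_top, Submodule.topologicalClosure_eq_top_iff,
    Submodule.eq_bot_iff]
  intro v hv
  have hloc : LocallyIntegrableOn v (Ioi (0 : ℝ)) volume := by
    have h1 : LocallyIntegrable v halfLine := (Lp.memLp v).locallyIntegrable (by norm_num)
    exact locallyIntegrableOn_of_locallyIntegrable_restrict h1
  have h := isOpen_Ioi.ae_eq_zero_of_integral_contDiff_smul_eq_zero hloc fun g hg hgc hgs => by
    have hgs' : Function.support g ⊆ Ioi 0 := (subset_tsupport g).trans hgs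
    have hgm : MemLp g 2 halfLine :=
      (hg.continuous.memLp_of_hasCompactSupport hgc).mono_measure Measure.restrict_le_self
    have h2 := (Submodule.mem_orthogonal _ v).1 hv (toL2 halfLine g)
      ⟨g, hg, hgc, hgs', coeFn_toL2 hgm⟩
    rw [inner_toL2 hgm] at h2
    rw [← h2, setIntegral_eq_integral_of_forall_compl_eq_zero]
    · rfl
    · intro x hx
      rw [Function.notMem_support.1 fun h => hx (hgs' h), zero_mul]
  refine Lp.ext ?_
  have h3 : ∀ᵐ x ∂halfLine, v x = 0 := (ae_restrict_iff' measurableSet_Ioi).2 h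
  filter_upwards [h3, Lp.coeFn_zero ℝ 2 halfLine] with x hx hx'
  rw [hx, hx', Pi.zero_apply]

namespace FredholmData

variable {A σ : ℝ → ℝ} {ν : Measure ℝ}

/-! ### Positivity under the orthogonality relation -/

theorem inner_opK_eq (h : FredholmData A σ ν) (s : ℝ) (f : Lp ℝ 2 halfLine) :
    ⟪opK A ν s f, f⟫_ℝ = ∫ r, σ r * ⟪shiftVec A (r + s), f⟫_ℝ ^ 2 := by
  have hc := h.continuous_shiftVec
  rw [h.opK_symmetric, opK, inner_frameOp (h.memLp_shiftVec_strip s),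
    h.integral_strip (G := fun r => ⟪shiftVec A r, f⟫_ℝ * ⟪shiftVec A r, f⟫_ℝ) (by fun_prop)]
  simp only [smul_eq_mul, pow_two]

/-- The quadratic form is `∫ σ(r) ⟪a_{r+s}, v⟫² dr`. Dropping `σ ≤ 1` and translating leaves the
integral that the orthogonality relation evaluates as `‖v‖²`. -/
theorem inner_opK_le_of_mem_testSubmodule (h : FredholmData A σ ν)
    (hA : OrthogonalityRelation A) (s : ℝ) {v : Lp ℝ 2 halfLine} (hv : v ∈ testSubmodule) :
    ⟪opK A ν s v, v⟫_ℝ ≤ ‖v‖ ^ 2 := by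
  obtain ⟨f, hf, hfc, hfs, hvf⟩ := hv
  have hfz : ∀ x ∉ Ioi (0 : ℝ), f x = 0 := fun x hx =>
    Function.notMem_support.1 fun h => hx (hfs h)
  have hfm : MemLp f 2 halfLine :=
    (hf.continuous.memLp_of_hasCompactSupport hfc).mono_measure Measure.restrict_le_self
  have h1 : ∀ τ, ⟪shiftVec A τ, v⟫_ℝ = ∫ y, A (τ + y) * f y := fun τ => by
    have hset : ∫ y in Ioi 0, A (τ + y) * f y = ∫ y, A (τ + y) * f y :=
      setIntegral_eq_integral_of_forall_compl_eq_zero fun x hx => by rw [hfz x hx, mul_zero]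
    rw [shiftVec, inner_toL2 (h.memLp_shift τ), ← hset]
    refine integral_congr_ae ?_
    filter_upwards [hvf] with x hx
    rw [hx]
  have h2 := hA f f hf hfc hf hfc
  have h3 : ∀ r, (∫ s, A (s + r) * f s) * (∫ s', A (r + s') * f s') =
      ⟪shiftVec A r, v⟫_ℝ ^ 2 := fun r => by
    rw [h1, pow_two]
    simp only [add_comm]
  simp only [h3] at h2
  have h4 : ‖v‖ ^ 2 = ∫ s, f s * f s := by
    have hset : ∫ y in Ioi 0, f y * f y = ∫ y, f y * f y :=
      setIntegral_eq_integral_of_forall_compl_eq_zero fun x hx => by rw [hfz x hx, mul_zero]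
    rw [← real_inner_self_eq_norm_sq, L2.inner_def, ← hset]
    refine integral_congr_ae ?_
    filter_upwards [hvf] with x hx
    rw [hx]
    simp [pow_two]
  have h5 : ∫ r, ⟪shiftVec A (r + s), v⟫_ℝ ^ 2 = ∫ r, ⟪shiftVec A r, v⟫_ℝ ^ 2 :=
    integral_add_right_eq_self (fun r => ⟪shiftVec A r, v⟫_ℝ ^ 2) s
  rw [h4, ← h2.2, h.inner_opK_eq, ← h5]
  refine integral_mono_of_nonneg (ae_of_all _ fun r => mul_nonneg (h.nonneg r) (sq_nonneg _))
    (h2.1.comp_add_right s) (ae_of_all _ fun r => ?_)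
  exact mul_le_of_le_one_left (sq_nonneg _) (h.le_one r)

theorem inner_opK_le (h : FredholmData A σ ν) (hA : OrthogonalityRelation A) (s : ℝ)
    (f : Lp ℝ 2 halfLine) : ⟪opK A ν s f, f⟫_ℝ ≤ ‖f‖ ^ 2 := by
  have hcl : IsClosed {f : Lp ℝ 2 halfLine | ⟪opK A ν s f, f⟫_ℝ ≤ ‖f‖ ^ 2} :=
    isClosed_le (by fun_prop) (by fun_prop)
  exact hcl.closure_subset_iff.2 (fun v hv => h.inner_opK_le_of_mem_testSubmodule hA s hv)
    (dense_testSubmodule f)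

/-- For `t < 1` the bound `K₂ ≤ I` makes `I - tK₂` coercive with constant `1 - t`; at `t = 1`
invertibility is assumed. -/
theorem fredholmDet_pos (h : FredholmData A σ ν) (hA : OrthogonalityRelation A) {s : ℝ}
    (hu : IsUnit (1 - opK A ν s)) : 0 < fredholmDet halfLine (kerK₂ A σ s) := by
  have := h.finite
  rw [← h.fredholmDet_strip]
  refine fredholmDet_gramKernel_pos h.continuous_stripVec.stronglyMeasurable
    (h.memLp_shiftVec_strip s) fun t ht => ?_
  rcases ht.2.eq_or_lt with rfl | ht1
  · rw [one_smul]
    exact hu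
  · refine ContinuousLinearMap.isUnit_of_forall_le_norm_inner_map _
      (c := ⟨1 - t, by linarith⟩) (show (0 : ℝ) < 1 - t from sub_pos.2 ht1) fun f => ?_
    refine le_trans ?_ (le_abs_self _)
    have h1 := h.inner_opK_le hA s f
    have h2 : ⟪(1 - t • opK A ν s) f, f⟫_ℝ = ‖f‖ ^ 2 - t * ⟪opK A ν s f, f⟫_ℝ := by
      rw [sub_apply, one_apply_eq_self, smul_apply, inner_sub_left, inner_smul_left,
        real_inner_self_eq_norm_sq, RCLike.conj_to_real]
    change ‖f‖ ^ 2 * (1 - t) ≤ ⟪(1 - t • opK A ν s) f, f⟫_ℝ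
    rw [h2]
    nlinarith [ht.1]

end FredholmData

/-! ### The measure `dσ` -/

section StieltjesMeasure

variable {σ : ℝ → ℝ} {γ : ℝ}

theorem tendsto_stieltjesFunction_atBot (hσ : Monotone σ) (h : Tendsto σ atBot (𝓝 0)) :
    Tendsto hσ.stieltjesFunction atBot (𝓝 0) := by
  have h1 : Tendsto (fun x => σ (x + 1)) atBot (𝓝 0) :=
    h.comp (tendsto_atBot_add_const_right _ 1 tendsto_id)
  refine tendsto_of_tendsto_of_tendsto_of_le_of_le h h1 (fun x => hσ.le_rightLim le_rfl)
    fun x => hσ.rightLim_le (by linarith)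

theorem tendsto_stieltjesFunction_atTop (hσ : Monotone σ) (h : Tendsto σ atTop (𝓝 γ)) :
    Tendsto hσ.stieltjesFunction atTop (𝓝 γ) := by
  have h1 : Tendsto (fun x => σ (x + 1)) atTop (𝓝 γ) :=
    h.comp (tendsto_atTop_add_const_right _ 1 tendsto_id)
  refine tendsto_of_tendsto_of_tendsto_of_le_of_le h h1 (fun x => hσ.le_rightLim le_rfl)
    fun x => hσ.rightLim_le (by linarith)

/-- A monotone function has countably many jumps; elsewhere `σ`, its right-continuous version and
the left limit of that version agree. -/
theorem ae_stieltjesFunction_measure_Iio (hσ : Monotone σ) (h : Tendsto σ atBot (𝓝 0)) :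
    ∀ᵐ r, hσ.stieltjesFunction.measure (Iio r) = ENNReal.ofReal (σ r) := by
  have h1 : ∀ᵐ r, r ∉ {r | ¬ContinuousAt σ r} :=
    (hσ.countable_not_continuousAt.measure_zero volume) |> compl_mem_ae_iff.2
  have h2 : ∀ᵐ r, r ∉ {r | Function.leftLim hσ.stieltjesFunction r ≠ hσ.stieltjesFunction r} :=
    (hσ.stieltjesFunction.countable_leftLim_ne.measure_zero volume) |> compl_mem_ae_iff.2
  filter_upwards [h1, h2] with r hr1 hr2
  rw [hσ.stieltjesFunction.measure_Iio (tendsto_stieltjesFunction_atBot hσ h), sub_zero]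
  simp only [not_not] at hr1 hr2
  rw [hr2, hσ.stieltjesFunction_eq]
  congr 1
  exact rightLim_eq_of_tendsto (hr1.tendsto.mono_left nhdsWithin_le_nhds)

/-- By Tonelli, the density of `y + t` at `r` is the `dσ`-mass of `{t < r}`, which is `σ(r)` almost
everywhere. This replaces integration by parts and covers jumps of `σ`. -/
theorem map_strip_stieltjesFunction (hσ : Monotone σ) (h : Tendsto σ atBot (𝓝 0))
    [IsFiniteMeasure hσ.stieltjesFunction.measure] :
    (strip hσ.stieltjesFunction.measure 0).map (fun p => p.1 + p.2) =
      volume.withDensity fun r => ENNReal.ofReal (σ r) := by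
  refine Measure.ext_of_lintegral _ fun f hf => ?_
  have hm : Measurable fun p : ℝ × ℝ => (Ioi p.2).indicator f p.1 := by
    have : (fun p : ℝ × ℝ => (Ioi p.2).indicator f p.1) =
        {p : ℝ × ℝ | p.2 < p.1}.indicator (fun p => f p.1) := by
      ext p
      simp [indicator]
    rw [this]
    exact (hf.comp measurable_fst).indicator (measurableSet_lt measurable_snd measurable_fst)
  rw [lintegral_map hf (by fun_prop), lintegral_prod_symm _ (by fun_prop),
    lintegral_withDensity_eq_lintegral_mul _ hσ.measurable.ennreal_ofReal hf]
  have h1 : ∀ t, ∫⁻ y, f (y + t) ∂(volume.restrict (Ioi 0)) =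
      ∫⁻ r, (Ioi t).indicator f r := fun t => by
    rw [lintegral_indicator measurableSet_Ioi]
    exact (measurePreserving_add_right_halfLine t).lintegral_comp hf
  simp only [h1]
  rw [lintegral_lintegral_swap (f := fun t r => (Ioi t).indicator f r)
    (hm.comp measurable_swap).aemeasurable]
  refine lintegral_congr_ae ?_
  filter_upwards [ae_stieltjesFunction_measure_Iio hσ h] with r hr
  have h2 : ∀ t, (Ioi t).indicator f r = (Iio r).indicator (fun _ => f r) t := fun t => by
    simp [indicator]
  simp only [h2, Pi.mul_apply]
  rw [lintegral_indicator_const measurableSet_Iio, hr, mul_comm]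

end StieltjesMeasure

/-! ### From the hypotheses on `A` and `σ` to the theorem -/

theorem memLp_shift_of_isBigO_exp {A : ℝ → ℝ} (hA : Continuous A) {c : ℝ} (hc : 0 < c)
    (hO : A =O[atTop] fun x => Real.exp (-c * x)) (τ : ℝ) :
    MemLp (fun y => A (τ + y)) 2 halfLine := by
  refine (memLp_two_iff_integrable_sq (Continuous.aestronglyMeasurable (by fun_prop))).2 ?_
  have h1 : IntegrableOn (fun u => A u ^ 2) (Ioi τ) := by
    refine integrable_of_isBigO_exp_neg (b := 2 * c) (by positivity)
      (Continuous.continuousOn (by fun_prop)) ((hO.pow 2).congr_right fun x => ?_)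
    rw [← Real.exp_nat_mul]
    congr 1
    push_cast
    ring
  have h2 := ((measurePreserving_add_right_halfLine τ).integrable_comp_emb
    (measurableEmbedding_addRight τ)).2 h1
  refine h2.congr (ae_of_all _ fun y => ?_)
  simp [add_comm]

theorem fredholmData_stieltjesFunction {A σ : ℝ → ℝ} {γ : ℝ} (hA : Continuous A)
    (hA_decay : ∃ c > 0, A =O[atTop] fun x => Real.exp (-c * x)) (hγ : γ ≤ 1) (hσ : Monotone σ)
    (hσ_bot : Tendsto σ atBot (𝓝 0)) (hσ_top : Tendsto σ atTop (𝓝 γ))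
    (hHS : ∀ s, Integrable (fun p : ℝ × ℝ => σ p.1 * kerA A s p.1 p.2 ^ 2)
      (volume.prod halfLine))
    (hInt : ∀ s, Integrable (fun t => A (t + s) ^ 2) hσ.stieltjesFunction.measure)
    (hCont : Continuous fun s => ∫ t, A (t + s) ^ 2 ∂hσ.stieltjesFunction.measure) :
    FredholmData A σ hσ.stieltjesFunction.measure := by
  obtain ⟨c, hc, hO⟩ := hA_decay
  have hfin : IsFiniteMeasure hσ.stieltjesFunction.measure :=
    hσ.stieltjesFunction.isFiniteMeasure (tendsto_stieltjesFunction_atBot hσ hσ_bot)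
      (tendsto_stieltjesFunction_atTop hσ hσ_top)
  exact
    { finite := hfin
      continuous := hA
      measurable := hσ.measurable
      nonneg := hσ.le_of_tendsto hσ_bot
      le_one := fun r => (hσ.ge_of_tendsto hσ_top r).trans hγ
      map_strip := map_strip_stieltjesFunction hσ hσ_bot
      memLp_shift := memLp_shift_of_isBigO_exp hA hc hO
      hilbertSchmidt := hHS
      integrable_sq := hInt
      continuous_integral_sq := hCont }

theorem mainTheorem10 (A σ : ℝ → ℝ) (γ : ℝ)
    -- `A` is smooth and vanishes exponentially fast at `+∞`
    (hA : ContDiff ℝ ∞ A)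
    (hA_decay : ∃ c > 0, A =O[atTop] fun x => Real.exp (-c * x))
    -- `σ` increases from `0` to `γ ∈ (0, 1]` with exponential rates, smooth off a finite set
    (hγ : 0 < γ ∧ γ ≤ 1)
    (hσ : Monotone σ)
    (hσ_smooth : ∃ F : Finset ℝ, ∀ t ∉ F, ContDiffAt ℝ ∞ σ t)
    (hσ_bot : ∃ c > 0, σ =O[atBot] fun t => Real.exp (c * t))
    (hσ_top : ∃ c > 0, (fun t => σ t - γ) =O[atTop] fun t => Real.exp (-c * t))
    -- `σ^{1/2} A_s` is Hilbert–Schmidt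
    (hHS : ∀ s, Integrable (fun p : ℝ × ℝ => σ p.1 * kerA A s p.1 p.2 ^ 2)
      (volume.prod halfLine))
    -- `s ↦ ∫ A(t + s)² dσ(t)` is finite and continuous
    (hInt : ∀ s, Integrable (fun t => A (t + s) ^ 2) hσ.stieltjesFunction.measure)
    (hCont : Continuous fun s => ∫ t, A (t + s) ^ 2 ∂hσ.stieltjesFunction.measure) :
    -- the two Fredholm determinants are well defined and equal
    (∀ s, FredholmSeriesConverges volume (kerK₁ A σ s) ∧
      FredholmSeriesConverges halfLine (kerK₂ A σ s) ∧
      fredholmDet volume (kerK₁ A σ s) = fredholmDet halfLine (kerK₂ A σ s)) ∧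
    (∀ s, MemLp (Function.uncurry (kerK₂ A σ s)) 2 (halfLine.prod halfLine)) ∧
    ∀ s, IsUnit (1 - opK₂ A σ s) →
      -- the logarithm makes sense
      fredholmDet volume (kerK₁ A σ s) ≠ 0 ∧
      (OrthogonalityRelation A → 0 < fredholmDet volume (kerK₁ A σ s)) ∧
      -- first derivative
      HasDerivAt (fun s => Real.log (fredholmDet volume (kerK₁ A σ s)))
        (deltaResolventDelta A σ s) s ∧
      Integrable (fun t => u₀ A σ s t t) hσ.stieltjesFunction.measure ∧
      HasDerivAt (fun s => Real.log (fredholmDet halfLine (kerK₂ A σ s)))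
        (∫ t, u₀ A σ s t t ∂hσ.stieltjesFunction.measure) s ∧
      deltaResolventDelta A σ s = ∫ t, u₀ A σ s t t ∂hσ.stieltjesFunction.measure ∧
      -- second derivative
      Integrable (fun t => q₀ A σ s t ^ 2) hσ.stieltjesFunction.measure ∧
      HasDerivAt (deriv fun s => Real.log (fredholmDet volume (kerK₁ A σ s)))
        (-∫ t, q₀ A σ s t ^ 2 ∂hσ.stieltjesFunction.measure) s ∧
      HasDerivAt (deriv fun s => Real.log (fredholmDet halfLine (kerK₂ A σ s)))
        (-∫ t, q₀ A σ s t ^ 2 ∂hσ.stieltjesFunction.measure) s := by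

  obtain ⟨b, hb, hOb⟩ := hσ_bot
  obtain ⟨d, hd, hOd⟩ := hσ_top
  have hbot : Tendsto σ atBot (𝓝 0) := hOb.trans_tendsto <|
    Real.tendsto_exp_atBot.comp (tendsto_id.const_mul_atBot hb)
  have htop : Tendsto σ atTop (𝓝 γ) := by
    refine tendsto_sub_nhds_zero_iff.1 (hOd.trans_tendsto ?_)
    exact Real.tendsto_exp_atBot.comp (tendsto_id.const_mul_atTop_of_neg (neg_lt_zero.2 hd))
  have h := fredholmData_stieltjesFunction hA.continuous hA_decay hγ.2 hσ hbot htop hHS hInt hCont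
  refine ⟨fun s => ⟨h.fredholmSeriesConverges_kerK₁ s,
    (h.isHadamardKernel_kerK₂ s).fredholmSeriesConverges, h.fredholmDet_kerK₁ s⟩,
    h.memLp_kerK₂, fun s hs => ?_⟩
  rw [h.opK₂_eq] at hs
  simp only [h.fredholmDet_kerK₁]
  have h1 := h.hasDerivAt_log_fredholmDet hs
  have h2 := h.hasDerivAt_deriv_log_fredholmDet hs
  have h3 := h.deltaResolventDelta_eq_integral hs
  exact ⟨h.fredholmDet_ne_zero hs, fun hO => h.fredholmDet_pos hO hs, h1, h.integrable_u₀ s,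
    h3 ▸ h1, h3, (h.memLp_q₀ s).integrable_sq, h2, h2⟩
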